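/- Let $N=\dim_S\ge 2$, $\Delta>0$, and let $H_S=\sum_{i=1}^{N}\lambda_S(i)\,|i\rangle\langle i|$ with $\lambda_S(i)=i\Delta+b$ ($b\in\mathbb R$ an arbitrary offset) be a truncated harmonic oscillator, written in its energy eigenbasis. The environment is one qubit with $H_E=\mathrm{diag}(0,\gamma)$, $\gamma=\Delta$, and $H=H_S\otimes 1+1\otimes H_E$ has total dimension $2N$. Let $G=UDU^\dagger$ with $U$ Haar distributed on the unitary group of dimension $2N$ and, independently, $D$ diagonal with i.i.d. standard normal entries. For $\beta\in[0,\infty]$ put $\rho_S(\beta)=e^{-\beta H_S}/\mathrm{Tr}\,e^{-\beta H_S}$ and $\rho_E(\beta)=e^{-\beta H_E}/\mathrm{Tr}\,e^{-\beta H_E}=\mathrm{diag}(q_0,q_1)$, so $q_0=\frac1{1+e^{-\beta\gamma}}$ and $q_1=1-q_0$ (at $\beta=\infty$ these are the ground states). The thermalizing channel is $$\Phi_\beta(\rho)=\mathrm{Tr}_E\,\mathbb E_G\big[e^{i(H+\alpha G)t}(\rho\otimes\rho_E(\beta))e^{-i(H+\alpha G)t}\big].$$ Put $\widetilde\alpha=\alpha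 t/\sqrt{2N+1}$. The on-resonance transition matrix $T=T(\beta)$ has, for $i\ne j$, $$T_{ji}=\widetilde\alpha^2\Big(q_0\,\mathbf I\big[|\Delta_S(i,j)-\gamma|<\delta_{\min}\big]\,\mathrm{sinc}^2\tfrac{(\Delta_S(i,j)-\gamma)t}{2}+q_1\,\mathbf I\big[|\Delta_S(i,j)+\gamma|<\delta_{\min}\big]\,\mathrm{sinc}^2\tfrac{(\Delta_S(i,j)+\gamma)t}{2}\Big),$$ where $\Delta_S(i,j)=\lambda_S(i)-\lambda_S(j)$, $\mathrm{sinc}\,x=\sin x/x$, and $\delta_{\min}$ is the least distance between two distinct values of $\Delta_S$; the diagonal entries make every column sum to zero. The induced Markov chain has transition matrix $1+T$. Let $\widetilde\lambda_\star(\beta)$ be the spectral gap of $T/\widetilde\alpha^2$, i.e. the least modulus of its eigenvalues after one copy of the eigenvalue $0$ is removed. (1) For all $\alpha,t>0$ and $0\le\beta<\infty$: $T_{ji}=\widetilde\alpha^2\big(q_0\mathbf I[j=i-1]+q_1\mathbf I[j=i+1]\big)$ for $i\neq j$; if $\widetilde\alpha\le1$, then $1+T$ is column stochastic; the populations $e^{-\beta\lambda_S(i)}/\mathcal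 Z_S(\beta)$ of $\rho_S(\beta)$ form the unique probability vector fixed by $1+T$; and $\widetilde\lambda_\star(\beta)>0$. (2) For all $\alpha,t>0$, as $\beta\to\infty$: $T(\beta)$ converges to $T(\infty)$, the nearest-neighbour matrix as in (1) with $q_0=1$, $q_1=0$. It is upper triangular with characteristic polynomial $x(x+\widetilde\alpha^2)^{N-1}$ and spectrum $\{0,-\widetilde\alpha^2\}$, and the ground state is its unique fixed probability vector. Moreover $\widetilde\lambda_\star(\beta)\to1=\widetilde\lambda_\star(\infty)$, $\rho_E(\beta)\to|0\rangle\langle0|$, $\rho_S(\beta)\to|1\rangle\langle1|$, and $\Phi_\beta(\rho)\to\Phi_\infty(\rho)$ for every $\rho$. (3) There are universal constants $c>0$ and $k\in\mathbb N$ such that for every $K>0$ there is a constant $C>0$, depending only on $K$, with the following property. Let $N\ge2$, $\Delta>0$, $b\in\mathbb R$, $0<\varepsilon\le1$, $\beta\in[0,\infty]$, $\widetilde\lambda=\widetilde\lambda_\star(\beta)$ (so $\widetilde\lambda=1$ for $\beta=\infty$), and $$\alpha=\frac{\varepsilon^{3/2}\,\widetilde\lambda^{3/2}\Delta}{N^4},\qquad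 t=\frac{N}{\Delta\sqrt{\varepsilon\widetilde\lambda}},\qquad \ell=\log\frac{N}{\varepsilon\widetilde\lambda}.$$ Then for every $L\in\mathbb N$ with $c\,\frac{N^2}{\alpha^2t^2\widetilde\lambda}\,\ell^k\le L\le K\,\frac{N^2}{\alpha^2t^2\widetilde\lambda}\,\ell^k$, i.e. $L=\widetilde O\big(\frac{N^2}{\alpha^2t^2\widetilde\lambda}\big)$, and every density matrix $\rho$ that commutes with $H_S$, $$\big\|\rho_S(\beta)-\Phi_\beta^{\circ L}(\rho)\big\|_1\le C\,\varepsilon\,\ell^k=\widetilde O(\varepsilon),\qquad L\,t\le C\,\frac{N^9}{\Delta\,\varepsilon^{5/2}\,\widetilde\lambda^{7/2}}\,\ell^k .$$ In particular, at $\beta=\infty$ the ground state is prepared with total simulation time $\widetilde O\big(\frac{N^9}{\Delta\varepsilon^{5/2}}\big)$. -/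

import Mathlib

open Matrix MeasureTheory Filter Topology
open scoped ComplexOrder

noncomputable section

namespace OscThermal

/-! ## Random interaction -/

section Haar

variable {ι : Type} [Fintype ι] [DecidableEq ι]

/-- The unitary group is compact (closed, with entries of modulus at most one). -/
instance unitaryGroup_compactSpace : CompactSpace (Matrix.unitaryGroup ι ℂ) := by
  have hc : IsCompact ((Metric.closedBall (0 : ℂ) 1).matrix : Set (Matrix ι ι ℂ)) :=
    (isCompact_closedBall (0 : ℂ) 1).matrix
  have hcl : IsClosed ((Matrix.unitaryGroup ι ℂ : Submonoid (Matrix ι ι ℂ)) :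
      Set (Matrix ι ι ℂ)) := isClosed_unitary
  refine isCompact_iff_compactSpace.mp (hc.of_isClosed_subset hcl ?_)
  intro U hU i j
  simpa using entry_norm_bound_of_unitary hU i j

instance unitaryGroup_measurableSpace : MeasurableSpace (Matrix.unitaryGroup ι ℂ) := borel _

instance unitaryGroup_borelSpace : BorelSpace (Matrix.unitaryGroup ι ℂ) := ⟨rfl⟩

variable (ι) in
/-- Haar measure on the unitary group, normalised to total mass one. -/
def haarUnitary : Measure (Matrix.unitaryGroup ι ℂ) := Measure.haarMeasure ⊤

variable (ι) in
/-- The law of the pair `(U, D)`: a Haar unitary and, independently, i.i.d. standard Gaussian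
eigenvalues. -/
def interactionLaw : Measure (Matrix.unitaryGroup ι ℂ × (ι → ℝ)) :=
  (haarUnitary ι).prod (Measure.pi fun _ => ProbabilityTheory.gaussianReal 0 1)

/-- The random interaction `G = U D U†`. -/
def interaction (ω : Matrix.unitaryGroup ι ℂ × (ι → ℝ)) : Matrix ι ι ℂ :=
  (ω.1 : Matrix ι ι ℂ) * Matrix.diagonal (fun i => (ω.2 i : ℂ)) * (ω.1 : Matrix ι ι ℂ)ᴴ

end Haar

/-! ## The thermalizing channel -/

section Channel

variable {S : Type} [Fintype S] [DecidableEq S]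

/-- The operator that is diagonal in the energy eigenbasis, with real eigenvalues `v`. -/
def diagOp {κ : Type} [DecidableEq κ] (v : κ → ℝ) : Matrix κ κ ℂ :=
  Matrix.diagonal fun i => (v i : ℂ)

/-- Partial trace over the environment qubit. -/
def traceEnv (A : Matrix (S × Fin 2) (S × Fin 2) ℂ) : Matrix S S ℂ :=
  Matrix.of fun i j => ∑ a, A (i, a) (j, a)

/-- Eigenvalues of the environment qubit Hamiltonian `diag(0, γ)`. -/
def envEnergy (γ : ℝ) : Fin 2 → ℝ := ![0, γ]

/-- The total free Hamiltonian `H_S ⊗ 1 + 1 ⊗ H_E`. -/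
def freeHamiltonian (E : S → ℝ) (γ : ℝ) : Matrix (S × Fin 2) (S × Fin 2) ℂ :=
  Matrix.kronecker (diagOp E) (1 : Matrix (Fin 2) (Fin 2) ℂ) +
    Matrix.kronecker (1 : Matrix S S ℂ) (diagOp (envEnergy γ))

/-- Evolution of `ρ ⊗ ρ_E` for one fixed interaction `G`:
`e^{i (H + α G) t} (ρ ⊗ ρ_E) e^{-i (H + α G) t}`. -/
def fixedEvolution (E : S → ℝ) (γ α t : ℝ) (G : Matrix (S × Fin 2) (S × Fin 2) ℂ)
    (σ : Matrix (S × Fin 2) (S × Fin 2) ℂ) : Matrix (S × Fin 2) (S × Fin 2) ℂ :=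
  NormedSpace.exp ((Complex.I * (t : ℂ)) • (freeHamiltonian E γ + (α : ℂ) • G)) * σ *
    NormedSpace.exp (-((Complex.I * (t : ℂ)) • (freeHamiltonian E γ + (α : ℂ) • G)))

/-- The channel `Φ(ρ) = Tr_E 𝔼_G [e^{i(H+αG)t} (ρ ⊗ diag q) e^{-i(H+αG)t}]`, where the environment
qubit is prepared with populations `q`. The expectation is taken entry by entry. -/
def channel (E : S → ℝ) (γ : ℝ) (q : Fin 2 → ℝ) (α t : ℝ) (ρ : Matrix S S ℂ) : Matrix S S ℂ :=
  traceEnv (Matrix.of fun x y => ∫ ω, fixedEvolution E γ α t (interaction ω)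
    (Matrix.kronecker ρ (diagOp q)) x y ∂(interactionLaw (S × Fin 2)))

/-- Trace norm: the sum of the singular values. -/
def traceNorm (A : Matrix S S ℂ) : ℝ :=
  ∑ i, Real.sqrt ((Matrix.isHermitian_conjTranspose_mul_self A).eigenvalues i)

/-- Density matrices. -/
def IsDensity (ρ : Matrix S S ℂ) : Prop := ρ.PosSemidef ∧ ρ.trace = 1

end Channel

/-! ## Thermal populations -/

/-- Boltzmann populations `e^{-β E i} / Z(β)`; the thermal state is `diagOp (gibbs E β)`. -/
def gibbs {κ : Type} [Fintype κ] (E : κ → ℝ) (β : ℝ) (i : κ) : ℝ :=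
  Real.exp (-β * E i) / ∑ j, Real.exp (-β * E j)

/-- Populations of the pure state on the lowest level (the `β = ∞` state of a system whose
energies are strictly increasing). -/
def ground (n : ℕ) (i : Fin n) : ℝ := if (i : ℕ) = 0 then 1 else 0

/-! ## The on-resonance Markov chain -/

section Chain

variable {S : Type} [Fintype S] [DecidableEq S]

/-- The rescaled coupling `α t / √(dim + 1)`, with `dim = 2 dim_S`. -/
def rescaledCoupling (S : Type) [Fintype S] (α t : ℝ) : ℝ :=
  α * t / Real.sqrt (2 * (Fintype.card S : ℝ) + 1)

/-- The least distance between two distinct differences of system energies. -/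
def deltaMin (E : S → ℝ) : ℝ :=
  sInf {x | ∃ i j k l, E i - E j ≠ E k - E l ∧ x = |(E i - E j) - (E k - E l)|}

/-- The `sinc²` factor of a transition with energy mismatch `x`, kept only on resonance, that is
for a mismatch smaller than `δ`. -/
def resonant (δ t x : ℝ) : ℝ := if |x| < δ then Real.sinc (x * t / 2) ^ 2 else 0

/-- The on-resonance transition amplitude from level `i` to level `j ≠ i`. -/
def onRate (E : S → ℝ) (γ : ℝ) (q : Fin 2 → ℝ) (α t : ℝ) (i j : S) : ℝ :=
  rescaledCoupling S α t ^ 2 *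
    (q 0 * resonant (deltaMin E) t (E i - E j - γ) + q 1 * resonant (deltaMin E) t (E i - E j + γ))

/-- The on-resonance transition matrix `T`. The entry in row `j`, column `i` is the transition
`i → j`, and every column sums to zero. The Markov chain is `1 + T`. -/
def transition (E : S → ℝ) (γ : ℝ) (q : Fin 2 → ℝ) (α t : ℝ) : Matrix S S ℝ :=
  Matrix.of fun j i =>
    if j = i then -∑ k ∈ Finset.univ.erase i, onRate E γ q α t i k else onRate E γ q α t i j

/-- Spectral gap of a matrix with eigenvalue `0`: remove one copy of the eigenvalue `0` (with
algebraic multiplicity) from the complex spectrum and take the least modulus of the rest. -/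
def spectralGap (A : Matrix S S ℝ) : ℝ :=
  sInf {x | ∃ μ ∈ (A.map (algebraMap ℝ ℂ)).charpoly.roots.erase 0, x = ‖μ‖}

end Chain

/-! ## The truncated harmonic oscillator -/

/-- Energy levels `Δ, 2Δ, …, NΔ`, up to a constant offset `b`. -/
def oscEnergy (N : ℕ) (Δ b : ℝ) (i : Fin N) : ℝ := ((i : ℕ) + 1 : ℝ) * Δ + b

/-- The nearest-neighbour generator with rate `q 0` one level down and `q 1` one level up (row:
target, column: source; columns sum to zero). -/
def ladder (N : ℕ) (q : Fin 2 → ℝ) : Matrix (Fin N) (Fin N) ℝ :=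
  Matrix.of fun j i =>
    if (j : ℕ) + 1 = i then q 0
    else if (j : ℕ) = i + 1 then q 1
    else if j = i then
      -((if 0 < (i : ℕ) then q 0 else 0) + (if (i : ℕ) + 1 < N then q 1 else 0))
    else 0

/-- The spectral gap of the rescaled transition matrix at inverse temperature `β`. -/
def oscGap (N : ℕ) (Δ β : ℝ) : ℝ := spectralGap (ladder N (gibbs (envEnergy Δ) β))

/-- The coupling constant `α = ε^{3/2} λ^{3/2} Δ / N⁴`. -/
def oscAlpha (N : ℕ) (Δ ε lam : ℝ) : ℝ :=
  ε ^ (3 / 2 : ℝ) * lam ^ (3 / 2 : ℝ) * Δ / (N : ℝ) ^ 4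

/-- The time per interaction `t = N / (Δ √(ε λ))`. -/
def oscTime (N : ℕ) (Δ ε lam : ℝ) : ℝ := (N : ℝ) / (Δ * Real.sqrt (ε * lam))

/-- The number of interactions without logarithms, `N² / (α² t² λ)`. -/
def oscSteps (N : ℕ) (Δ ε lam : ℝ) : ℝ :=
  (N : ℝ) ^ 2 / (oscAlpha N Δ ε lam ^ 2 * oscTime N Δ ε lam ^ 2 * lam)

/-- The logarithmic factor that soft-O notation hides. -/
def oscLog (N : ℕ) (ε lam : ℝ) : ℝ := Real.log ((N : ℝ) / (ε * lam))

end OscThermal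

end

noncomputable section

namespace OscThermal

/-! ## The nearest-neighbour generator -/

section Ladder

variable {N : ℕ} {q : Fin 2 → ℝ}

/-- The generator acts as a discrete divergence of the probability flux. -/
theorem ladder_mulVec_eq_flux (p : ℕ → ℝ) (j : Fin N) :
    (ladder N q *ᵥ fun i : Fin N => p i) j =
      (if 0 < (j : ℕ) then q 1 * p (j - 1) - q 0 * p j else 0) -
        (if (j : ℕ) + 1 < N then q 1 * p j - q 0 * p (j + 1) else 0) := by
  have h1 : ∀ i : Fin N, ladder N q j i * p i =
      (if (i : ℕ) = j + 1 then q 0 * p (j + 1) else 0) +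
      (if (i : ℕ) + 1 = j then q 1 * p (j - 1) else 0) +
      (if (i : ℕ) = j then
        -((if 0 < (j : ℕ) then q 0 else 0) + (if (j : ℕ) + 1 < N then q 1 else 0)) * p j
        else 0) := by
    intro i
    simp only [ladder, of_apply]
    by_cases h : (i : ℕ) = j + 1
    · rw [if_pos h.symm, if_pos h, if_neg (by omega), if_neg (by omega), h]; ring
    rw [if_neg (Ne.symm h), if_neg h]
    by_cases h' : (i : ℕ) + 1 = j
    · rw [if_pos h'.symm, if_pos h', if_neg (by omega)]
      have : (i : ℕ) = j - 1 := by omega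
      rw [this]; ring
    rw [if_neg (Ne.symm h'), if_neg h']
    by_cases h'' : (i : ℕ) = j
    · rw [if_pos (Fin.ext h''.symm), if_pos h'', h'']; ring
    · rw [if_neg (fun e => h'' (by rw [e])), if_neg h'']; ring
  have h2 : (ladder N q *ᵥ fun i : Fin N => p i) j = ∑ i : Fin N, ladder N q j i * p i := rfl
  rw [h2, Finset.sum_congr rfl fun i _ => h1 i, Finset.sum_add_distrib, Finset.sum_add_distrib]
  have hj := j.2
  rw [Fin.sum_univ_eq_sum_range (fun i => if i = (j : ℕ) + 1 then q 0 * p (j + 1) else 0),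
    Fin.sum_univ_eq_sum_range (fun i => if i + 1 = (j : ℕ) then q 1 * p (j - 1) else 0),
    Fin.sum_univ_eq_sum_range (fun i => if i = (j : ℕ) then
        -((if 0 < (j : ℕ) then q 0 else 0) + (if (j : ℕ) + 1 < N then q 1 else 0)) * p j
        else 0)]
  have h3 : (∑ i ∈ Finset.range N, if i + 1 = (j : ℕ) then q 1 * p (j - 1) else 0) =
      if 0 < (j : ℕ) then q 1 * p (j - 1) else 0 := by
    rcases Nat.eq_zero_or_pos (j : ℕ) with h | h
    · rw [if_neg (by omega)]
      exact Finset.sum_eq_zero fun i _ => if_neg (by omega)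
    · rw [if_pos h, Finset.sum_eq_single ((j : ℕ) - 1)]
      · rw [if_pos (by omega)]
      · intro i _ hi; exact if_neg (by omega)
      · intro hi; exact absurd (Finset.mem_range.2 (by omega)) hi
  rw [h3, Finset.sum_ite_eq', Finset.sum_ite_eq']
  simp only [Finset.mem_range, hj, if_true]
  split_ifs <;> ring

/-- The difference vector `F i - F (i + 1)`. -/
def diffVec (N : ℕ) (F : ℕ → ℝ) (i : Fin N) : ℝ := F i - F (i + 1)

/-- The generator acting on cumulative sums. -/
def cumulativeGen (N : ℕ) (q : Fin 2 → ℝ) (F : ℕ → ℝ) (j : ℕ) : ℝ :=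
  if 0 < j ∧ j < N then q 1 * F (j - 1) + q 0 * F (j + 1) - F j else 0

theorem ladder_mulVec_diffVec (hq : q 0 + q 1 = 1) (F : ℕ → ℝ) :
    ladder N q *ᵥ diffVec N F = diffVec N (cumulativeGen N q F) := by
  ext j
  have h := ladder_mulVec_eq_flux (N := N) (q := q) (fun i => F i - F (i + 1)) j
  have hq0 : q 0 = 1 - q 1 := by linarith
  have h' : (ladder N q *ᵥ diffVec N F) j =
    (ladder N q *ᵥ fun i : Fin N => F i - F (i + 1)) j := rfl
  rw [h', h]
  simp only [diffVec, cumulativeGen]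
  have hj := j.2
  rcases Nat.eq_zero_or_pos (j : ℕ) with h0 | h0
  · rw [h0]
    by_cases h1 : 0 + 1 < N
    · simp [h1, hq0]; ring
    · simp [h1]
  · have e : (j : ℕ) - 1 + 1 = j := by omega
    by_cases h1 : (j : ℕ) + 1 < N
    · simp [h0, h1, hq0, e, hj]; ring
    · simp [h0, h1, hq0, e, hj]; ring

theorem ladder_mulVec_eq_zero_iff (p : ℕ → ℝ) :
    (ladder N q *ᵥ fun i : Fin N => p i) = 0 ↔
      ∀ i, i + 1 < N → q 0 * p (i + 1) = q 1 * p i := by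
  constructor
  · intro h i
    induction i with
    | zero =>
      intro hi
      have := congrFun h ⟨0, by omega⟩
      rw [ladder_mulVec_eq_flux] at this
      simp only [lt_irrefl, if_false, hi, if_true, Pi.zero_apply] at this
      linarith
    | succ i ih =>
      intro hi
      have := congrFun h ⟨i + 1, by omega⟩
      rw [ladder_mulVec_eq_flux] at this
      simp only [Nat.succ_pos, hi, if_true, Pi.zero_apply, Nat.add_sub_cancel] at this
      have := ih (by omega)
      linarith
  · intro h
    ext j
    rw [ladder_mulVec_eq_flux, Pi.zero_apply]
    have hj := j.2
    have h1 : (if 0 < (j : ℕ) then q 1 * p (j - 1) - q 0 * p j else 0) = 0 := by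
      split_ifs with h0
      · have := h ((j : ℕ) - 1) (by omega)
        rw [Nat.sub_add_cancel h0] at this
        linarith
      · rfl
    have h2 : (if (j : ℕ) + 1 < N then q 1 * p j - q 0 * p (j + 1) else 0) = 0 := by
      split_ifs with h0
      · have := h j h0
        linarith
      · rfl
    rw [h1, h2, sub_zero]

/-- A stationary probability vector is unique as soon as the downward rate does not vanish. -/
theorem eq_of_ladder_mulVec_eq_zero (hq0 : q 0 ≠ 0) {p p' : Fin N → ℝ}
    (hp : ladder N q *ᵥ p = 0) (hp' : ladder N q *ᵥ p' = 0)
    (hs : ∑ i, p i = 1) (hs' : ∑ i, p' i = 1) : p = p' := by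
  have key : ∀ v : Fin N → ℝ, ladder N q *ᵥ v = 0 →
      ∃ a : ℝ, v = fun i : Fin N => a * (q 1 / q 0) ^ (i : ℕ) := by
    intro v hv
    set w : ℕ → ℝ := fun i => if h : i < N then v ⟨i, h⟩ else 0 with hw
    have hvw : v = fun i : Fin N => w i := by ext i; simp [hw]
    rw [hvw, ladder_mulVec_eq_zero_iff] at hv
    refine ⟨w 0, ?_⟩
    have : ∀ i, i < N → w i = w 0 * (q 1 / q 0) ^ i := by
      intro i
      induction i with
      | zero => simp
      | succ i ih =>
        intro hi
        have h1 := hv i hi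
        rw [ih (by omega)] at h1
        rw [pow_succ]
        field_simp
        field_simp at h1
        linarith
    rw [hvw]
    ext i
    exact this i i.2
  obtain ⟨a, ha⟩ := key p hp
  obtain ⟨a', ha'⟩ := key p' hp'
  rw [ha, ← Finset.mul_sum] at hs
  rw [ha', ← Finset.mul_sum] at hs'
  have hne : ∑ i : Fin N, (q 1 / q 0) ^ (i : ℕ) ≠ 0 := by
    intro h; rw [h, mul_zero] at hs; exact zero_ne_one hs
  have : a = a' := mul_right_cancel₀ hne (hs.trans hs'.symm)
  rw [ha, ha', this]

/-! ### Spectrum -/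

/-- The nonzero eigenvalues of the generator, up to sign. -/
def ladderRate (N : ℕ) (q : Fin 2 → ℝ) (k : ℕ) : ℝ :=
  1 - 2 * Real.sqrt (q 0 * q 1) * Real.cos (k * Real.pi / N)

theorem two_mul_sqrt_mul_le (hq : q 0 + q 1 = 1) :
    2 * Real.sqrt (q 0 * q 1) ≤ 1 := by
  have : Real.sqrt (q 0 * q 1) ≤ 1 / 2 := by
    apply Real.sqrt_le_iff.2 ⟨by norm_num, ?_⟩
    have : q 0 = 1 - q 1 := by linarith
    rw [this]
    nlinarith [sq_nonneg (q 1 - 1 / 2)]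
  linarith

theorem ladderRate_pos (hq : q 0 + q 1 = 1) {k : ℕ} (hk : 0 < k)
    (hkN : k < N) : 0 < ladderRate N q k := by
  have hN : (0 : ℝ) < N := by exact_mod_cast (by omega : 0 < N)
  have hc : Real.cos (k * Real.pi / N) < 1 := by
    rw [← Real.cos_zero]
    apply Real.cos_lt_cos_of_nonneg_of_le_pi le_rfl
    · rw [div_le_iff₀ hN, mul_comm]
      have : (k : ℝ) ≤ N := by exact_mod_cast hkN.le
      exact mul_le_mul_of_nonneg_left this Real.pi_pos.le
    · have := Real.pi_pos
      positivity
  have hs := Real.sqrt_nonneg (q 0 * q 1)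
  unfold ladderRate
  rcases (two_mul_sqrt_mul_le hq).lt_or_eq with h | h
  · nlinarith
  · rw [h]; linarith

theorem ladderRate_strictMonoOn (h0 : 0 < q 0) (h1 : 0 < q 1) :
    StrictMonoOn (ladderRate N q) (Set.Iic N) := by
  intro k hk l hl hkl
  have hl' : l ≤ N := hl
  have hN : (0 : ℝ) < N := by exact_mod_cast (by omega : 0 < N)
  have hpi := Real.pi_pos
  have hc : Real.cos (l * Real.pi / N) < Real.cos (k * Real.pi / N) := by
    apply Real.cos_lt_cos_of_nonneg_of_le_pi (by positivity)
    · rw [div_le_iff₀ hN, mul_comm]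
      have : (l : ℝ) ≤ N := by exact_mod_cast hl'
      exact mul_le_mul_of_nonneg_left this hpi.le
    · have : (k : ℝ) < l := by exact_mod_cast hkl
      gcongr
  have hs : 0 < Real.sqrt (q 0 * q 1) := Real.sqrt_pos.2 (mul_pos h0 h1)
  unfold ladderRate
  nlinarith

theorem ladder_mulVec_sine (h0 : 0 < q 0) (h1 : 0 < q 1) (hq : q 0 + q 1 = 1) (k : ℕ) (hN : 0 < N) :
    ladder N q *ᵥ
        diffVec N (fun j => (Real.sqrt (q 1) / Real.sqrt (q 0)) ^ j *
          Real.sin (j * (k * Real.pi / N))) =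
      (-ladderRate N q k) • diffVec N (fun j => (Real.sqrt (q 1) / Real.sqrt (q 0)) ^ j *
          Real.sin (j * (k * Real.pi / N))) := by
  rw [ladder_mulVec_diffVec hq]
  set a := Real.sqrt (q 0) with ha
  set b := Real.sqrt (q 1) with hb
  have ha0 : 0 < a := Real.sqrt_pos.2 h0
  have hb0 : 0 < b := Real.sqrt_pos.2 h1
  have hqa : q 0 = a ^ 2 := (Real.sq_sqrt h0.le).symm
  have hqb : q 1 = b ^ 2 := (Real.sq_sqrt h1.le).symm
  have hab : Real.sqrt (q 0 * q 1) = a * b := Real.sqrt_mul h0.le _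
  set r := b / a with hr
  have hbr : b = r * a := by rw [hr]; field_simp
  set θ := k * Real.pi / N with hθ
  have hend : Real.sin (N * θ) = 0 := by
    have : (N : ℝ) * θ = k * Real.pi := by rw [hθ]; field_simp
    rw [this, Real.sin_nat_mul_pi]
  have hG : ∀ j, j ≤ N → cumulativeGen N q (fun j => r ^ j * Real.sin (j * θ)) j =
      -ladderRate N q k * (r ^ j * Real.sin (j * θ)) := by
    intro j hj
    unfold cumulativeGen
    split_ifs with h
    · obtain ⟨m, rfl⟩ : ∃ m, j = m + 1 := ⟨j - 1, by omega⟩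
      rw [ladderRate, hab, ← hθ]
      simp only [Nat.add_sub_cancel]
      rw [hqa, hqb, hbr]
      have e1 : ((m : ℕ) : ℝ) * θ = ((m + 1 : ℕ) : ℝ) * θ - θ := by push_cast; ring
      have e2 : ((m + 1 + 1 : ℕ) : ℝ) * θ = ((m + 1 : ℕ) : ℝ) * θ + θ := by push_cast; ring
      rw [e1, e2, Real.sin_sub, Real.sin_add]
      ring
    · have : j = 0 ∨ j = N := by omega
      rcases this with rfl | rfl
      · simp
      · rw [hend]; simp
  ext i
  have hi := i.2
  simp only [diffVec, Pi.smul_apply, smul_eq_mul]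
  rw [hG _ hi.le, hG _ hi]
  exact (mul_sub _ _ _).symm

/-- A matrix with as many distinct eigenvalues as its size has no others. -/
theorem roots_charpoly_eq_of_eigenvectors {n : ℕ} (A : Matrix (Fin n) (Fin n) ℝ) (μ : Fin n → ℝ)
    (hμ : Function.Injective μ) (v : Fin n → Fin n → ℝ) (hv : ∀ k, v k ≠ 0)
    (hA : ∀ k, A *ᵥ v k = μ k • v k) :
    (A.map (algebraMap ℝ ℂ)).charpoly.roots = (Finset.univ.image fun k => (μ k : ℂ)).val := by
  symm
  have hdeg : (A.map (algebraMap ℝ ℂ)).charpoly.natDegree = n := by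
    rw [Matrix.charpoly_natDegree_eq_dim, Fintype.card_fin]
  apply Multiset.eq_of_le_of_card_le
  · rw [Multiset.le_iff_subset (Finset.nodup _)]
    intro x hx
    obtain ⟨k, -, rfl⟩ := Finset.mem_image.1 (Finset.mem_def.2 hx)
    rw [Polynomial.mem_roots (Matrix.charpoly_monic _).ne_zero, Matrix.charpoly_map]
    have : A.charpoly.IsRoot (μ k) := by
      rw [← Matrix.mem_spectrum_iff_isRoot_charpoly, ← Matrix.spectrum_toLin',
        ← Module.End.hasEigenvalue_iff_mem_spectrum]
      exact Module.End.hasEigenvalue_of_hasEigenvector (x := v k)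
        ⟨Module.End.mem_eigenspace_iff.2 (by rw [Matrix.toLin'_apply, hA]), hv k⟩
    exact this.map (f := algebraMap ℝ ℂ)
  · have hc : (Finset.univ.image fun k => (μ k : ℂ)).card = n := by
      rw [Finset.card_image_of_injective (f := fun k => (μ k : ℂ)) _
        (Complex.ofReal_injective.comp hμ), Finset.card_univ, Fintype.card_fin]
    calc _ ≤ _ := Polynomial.card_roots' _
      _ = (Finset.univ.image fun k => (μ k : ℂ)).card := by rw [hdeg, hc]

theorem ladder_mulVec_geometric (h0 : 0 < q 0) :
    (ladder N q *ᵥ fun i : Fin N => (q 1 / q 0) ^ (i : ℕ)) = 0 := by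
  rw [ladder_mulVec_eq_zero_iff (p := fun i => (q 1 / q 0) ^ i)]
  intro i _
  rw [pow_succ]
  field_simp

/-- The exact spectral gap `1 - 2 √(q₀ q₁) cos (π / N)`. -/
theorem spectralGap_ladder (h0 : 0 < q 0) (h1 : 0 < q 1) (hq : q 0 + q 1 = 1) (hN : 2 ≤ N) :
    spectralGap (ladder N q) = ladderRate N q 1 := by
  set μ : Fin N → ℝ := fun k => if (k : ℕ) = 0 then 0 else -ladderRate N q k with hμdef
  have hpos : ∀ k : Fin N, (k : ℕ) ≠ 0 → 0 < ladderRate N q k := fun k hk =>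
    ladderRate_pos hq (Nat.pos_of_ne_zero hk) k.2
  have hμ : Function.Injective μ := by
    intro k l hkl
    simp only [hμdef] at hkl
    split_ifs at hkl with hk hl hl
    · exact Fin.ext (hk.trans hl.symm)
    · have := hpos l hl; linarith
    · have := hpos k hk; linarith
    · exact Fin.ext ((ladderRate_strictMonoOn h0 h1).injOn k.2.le l.2.le (neg_injective hkl))
  have hroots := roots_charpoly_eq_of_eigenvectors (ladder N q) μ hμ
    (fun k => if (k : ℕ) = 0 then fun i : Fin N => (q 1 / q 0) ^ (i : ℕ) else
      diffVec N (fun j => (Real.sqrt (q 1) / Real.sqrt (q 0)) ^ j *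
          Real.sin (j * (((k : ℕ) : ℝ) * Real.pi / N)))) ?_ ?_
  · have hset : {x | ∃ z ∈ ((ladder N q).map (algebraMap ℝ ℂ)).charpoly.roots.erase 0, x = ‖z‖} =
        {x | ∃ k : ℕ, 0 < k ∧ k < N ∧ x = ladderRate N q k} := by
      ext x
      rw [hroots]
      constructor
      · rintro ⟨z, hz, rfl⟩
        rw [(Finset.nodup _).mem_erase_iff] at hz
        obtain ⟨hz0, hz⟩ := hz
        obtain ⟨k, -, rfl⟩ := Finset.mem_image.1 (Finset.mem_def.2 hz)
        by_cases hk : (k : ℕ) = 0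
        · exact absurd (by simp [hμdef, hk]) hz0
        · refine ⟨k, Nat.pos_of_ne_zero hk, k.2, ?_⟩
          simp only [hμdef, if_neg hk]
          rw [Complex.norm_real, norm_neg, Real.norm_of_nonneg (hpos k hk).le]
      · rintro ⟨k, hk, hkN, rfl⟩
        have hk' := hpos ⟨k, hkN⟩ hk.ne'
        refine ⟨(-ladderRate N q k : ℝ), ?_, ?_⟩
        · rw [(Finset.nodup _).mem_erase_iff]
          refine ⟨?_, Finset.mem_def.1 (Finset.mem_image.2 ⟨⟨k, hkN⟩, Finset.mem_univ _, ?_⟩)⟩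
          · simp only [ne_eq, Complex.ofReal_eq_zero]
            simp only at hk'
            linarith
          · simp [hμdef, hk.ne']
        · rw [Complex.norm_real, norm_neg, Real.norm_of_nonneg hk'.le]
    rw [spectralGap, hset]
    apply IsLeast.csInf_eq
    refine ⟨⟨1, one_pos, by omega, rfl⟩, ?_⟩
    rintro x ⟨k, hk, hkN, rfl⟩
    exact (ladderRate_strictMonoOn h0 h1).monotoneOn (by simp; omega) hkN.le hk
  · intro k
    split_ifs with hk
    · intro h
      have := congrFun h ⟨0, by omega⟩
      simp at this
    · intro h
      have := congrFun h ⟨0, by omega⟩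
      simp only [diffVec, pow_zero, Pi.zero_apply] at this
      have hNpos : (0 : ℝ) < N := by exact_mod_cast (by omega : 0 < N)
      have hkN : ((k : ℕ) : ℝ) < N := by exact_mod_cast k.2
      have hk0 : (0 : ℝ) < ((k : ℕ) : ℝ) := by exact_mod_cast Nat.pos_of_ne_zero hk
      have hpi := Real.pi_pos
      have hsin : 0 < Real.sin (((k : ℕ) : ℝ) * Real.pi / N) := by
        apply Real.sin_pos_of_pos_of_lt_pi (by positivity)
        rw [div_lt_iff₀ hNpos, mul_comm]
        exact mul_lt_mul_of_pos_left hkN hpi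
      have hr : 0 < Real.sqrt (q 1) / Real.sqrt (q 0) :=
        div_pos (Real.sqrt_pos.2 h1) (Real.sqrt_pos.2 h0)
      have hne := (mul_pos hr hsin).ne'
      apply hne
      simpa using this
  · intro k
    simp only [hμdef]
    split_ifs with hk
    · rw [ladder_mulVec_geometric h0, zero_smul]
    · exact ladder_mulVec_sine h0 h1 hq k (by omega)

end Ladder

section LadderMixing

variable {N : ℕ} {q : Fin 2 → ℝ}

/-! ### Zero temperature -/

theorem ladder_ground_blockTriangular (N : ℕ) : (ladder N (ground 2)).BlockTriangular id := by
  intro j i hij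
  have hij' : (i : ℕ) < j := hij
  simp only [ladder, of_apply]
  have hne : j ≠ i := fun e => by rw [e] at hij'; omega
  rw [if_neg (by omega), if_neg hne]
  simp [ground]

theorem charpoly_smul_ladder_ground (hN : 1 ≤ N) (c : ℝ) :
    (c • ladder N (ground 2)).charpoly =
      Polynomial.X * (Polynomial.X + Polynomial.C c) ^ (N - 1) := by
  obtain ⟨M, rfl⟩ : ∃ M, N = M + 1 := ⟨N - 1, by omega⟩
  have ht : (c • ladder (M + 1) (ground 2)).BlockTriangular id :=
    fun i j h => by rw [Matrix.smul_apply, ladder_ground_blockTriangular _ h, smul_zero]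
  rw [Matrix.charpoly_of_isUpperTriangular _ ht, Fin.prod_univ_succ]
  simp [ladder, ground]

theorem spectralGap_ladder_ground (hN : 2 ≤ N) : spectralGap (ladder N (ground 2)) = 1 := by
  have hc := charpoly_smul_ladder_ground (N := N) (by omega) 1
  rw [one_smul, map_one] at hc
  have hr : ((ladder N (ground 2)).map (algebraMap ℝ ℂ)).charpoly.roots =
      0 ::ₘ Multiset.replicate (N - 1) (-1) := by
    rw [Matrix.charpoly_map, hc]
    simp only [Polynomial.map_mul, Polynomial.map_pow, Polynomial.map_add, Polynomial.map_X,
      Polynomial.map_one]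
    have h1 : (Polynomial.X + 1 : Polynomial ℂ) = Polynomial.X - Polynomial.C (-1) := by simp
    rw [h1, Polynomial.roots_mul
      (mul_ne_zero Polynomial.X_ne_zero (pow_ne_zero _ (Polynomial.X_sub_C_ne_zero _))),
      Polynomial.roots_pow, Polynomial.roots_X_sub_C, Polynomial.roots_X, Multiset.nsmul_singleton,
      Multiset.singleton_add]
  rw [spectralGap, hr, Multiset.erase_cons_head]
  have : {x : ℝ | ∃ μ ∈ Multiset.replicate (N - 1) (-1 : ℂ), x = ‖μ‖} = {1} := by
    ext x
    simp only [Multiset.mem_replicate, Set.mem_ofPred_eq, Set.mem_singleton_iff]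
    constructor
    · rintro ⟨μ, ⟨-, rfl⟩, rfl⟩; simp
    · rintro rfl; exact ⟨-1, ⟨by omega, rfl⟩, by simp⟩
  rw [this, csInf_singleton]

/-! ### Mixing -/

/-- A weight on the cut positions `1, …, N - 1` for which the dual of the generator contracts at
rate `κ`. -/
structure IsCutWeight (N : ℕ) (q : Fin 2 → ℝ) (κ : ℝ) (v : ℕ → ℝ) : Prop where
  nonneg : ∀ j, j ≤ N → 0 ≤ v j
  lower : ∀ j, 0 < j → j < N → 1 / (N : ℝ) ≤ v j
  upper : ∀ j, 0 < j → j < N → v j ≤ 3 ^ N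
  contract : ∀ j, 0 < j → j < N → q 1 * v (j + 1) + q 0 * v (j - 1) ≤ (1 - κ) * v j

theorem isCutWeight_two_pow (hq : q 0 + q 1 = 1) (hq1 : q 1 ≤ 1 / 8) :
    IsCutWeight N q (1 / 4) (fun j => 2 ^ j) where
  nonneg j _ := by positivity
  lower j hj hjN := by
    have : (1 : ℝ) ≤ N := by exact_mod_cast (by omega : 1 ≤ N)
    exact ((div_le_one (by linarith)).2 this).trans (one_le_pow₀ (by norm_num))
  upper j hj hjN := calc
    (2 : ℝ) ^ j ≤ 3 ^ j := by gcongr; norm_num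
    _ ≤ 3 ^ N := pow_le_pow_right₀ (by norm_num) hjN.le
  contract j hj hjN := by
    obtain ⟨m, rfl⟩ : ∃ m, j = m + 1 := ⟨j - 1, by omega⟩
    have h : (0 : ℝ) < 2 ^ m := by positivity
    simp only [Nat.add_sub_cancel, pow_succ]
    have : q 0 = 1 - q 1 := by linarith
    rw [this]
    nlinarith

theorem one_div_le_sin {j : ℕ} (hj : 0 < j) (hjN : j < N) :
    1 / (N : ℝ) ≤ Real.sin (j * (Real.pi / N)) := by
  have hN : (0 : ℝ) < N := by exact_mod_cast (by omega : 0 < N)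
  have hpi := Real.pi_pos
  have key : ∀ m : ℕ, 0 < m → 2 * m ≤ N → 1 / (N : ℝ) ≤ Real.sin (m * (Real.pi / N)) := by
    intro m hm hmN
    have hm' : (1 : ℝ) ≤ m := by exact_mod_cast hm
    have hmN' : 2 * (m : ℝ) ≤ N := by exact_mod_cast hmN
    have h := Real.mul_le_sin (x := m * (Real.pi / N)) (by positivity) (by
      rw [mul_div_assoc', div_le_div_iff₀ hN two_pos]
      nlinarith)
    refine le_trans ?_ h
    have : 2 / Real.pi * (m * (Real.pi / N)) = 2 * m / N := by field_simp
    rw [this]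
    gcongr
    linarith
  by_cases h : 2 * j ≤ N
  · exact key j hj h
  · have h2 := key (N - j) (by omega) (by omega)
    have h3 : ((N - j : ℕ) : ℝ) * (Real.pi / N) = Real.pi - j * (Real.pi / N) := by
      rw [Nat.cast_sub hjN.le]; field_simp
    rwa [h3, Real.sin_pi_sub] at h2

theorem isCutWeight_sine (hq : q 0 + q 1 = 1) (hq1 : 1 / 8 ≤ q 1) (hq01 : q 1 ≤ q 0) :
    IsCutWeight N q (ladderRate N q 1)
      (fun j => (Real.sqrt (q 0) / Real.sqrt (q 1)) ^ j * Real.sin (j * (Real.pi / N))) := by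
  have h1 : 0 < q 1 := by linarith
  have h0 : 0 < q 0 := by linarith
  have hab : Real.sqrt (q 0 * q 1) = Real.sqrt (q 0) * Real.sqrt (q 1) := Real.sqrt_mul h0.le _
  have hb0 : 0 < Real.sqrt (q 1) := Real.sqrt_pos.2 h1
  have hqa : q 0 = Real.sqrt (q 0) ^ 2 := (Real.sq_sqrt h0.le).symm
  have hqb : q 1 = Real.sqrt (q 1) ^ 2 := (Real.sq_sqrt h1.le).symm
  have hr1 : 1 ≤ Real.sqrt (q 0) / Real.sqrt (q 1) := by
    rw [one_le_div hb0]; exact Real.sqrt_le_sqrt hq01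
  have hr3 : Real.sqrt (q 0) / Real.sqrt (q 1) ≤ 3 := by
    rw [div_le_iff₀ hb0]
    apply Real.sqrt_le_iff.2 ⟨by positivity, ?_⟩
    rw [mul_pow, ← hqb]; linarith
  have hsin : ∀ j, j ≤ N → 0 ≤ Real.sin (j * (Real.pi / N)) := by
    intro j hj
    rcases Nat.eq_zero_or_pos N with rfl | hN
    · simp
    have hN' : (0 : ℝ) < N := by exact_mod_cast hN
    have hj' : (j : ℝ) ≤ N := by exact_mod_cast hj
    have hpi := Real.pi_pos
    apply Real.sin_nonneg_of_nonneg_of_le_pi (by positivity)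
    rw [mul_div_assoc', div_le_iff₀ hN']
    nlinarith
  set a := Real.sqrt (q 0)
  set b := Real.sqrt (q 1)
  set r := a / b with hr
  have har : a = r * b := by rw [hr]; field_simp
  refine ⟨fun j hj => mul_nonneg (by positivity) (hsin j hj), fun j hj hjN => ?_,
    fun j hj hjN => ?_, fun j hj hjN => ?_⟩
  · have := one_div_le_sin hj hjN
    have h2 : 1 ≤ r ^ j := one_le_pow₀ hr1
    have h3 := hsin j hjN.le
    nlinarith
  · calc r ^ j * Real.sin (j * (Real.pi / N)) ≤ r ^ j * 1 := by
          gcongr; exact Real.sin_le_one _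
      _ ≤ 3 ^ j := by rw [mul_one]; gcongr
      _ ≤ 3 ^ N := pow_le_pow_right₀ (by norm_num) hjN.le
  · apply le_of_eq
    obtain ⟨m, rfl⟩ : ∃ m, j = m + 1 := ⟨j - 1, by omega⟩
    have eθ : ((1 : ℕ) : ℝ) * Real.pi / N = Real.pi / N := by simp
    rw [ladderRate, hab, eθ]
    simp only [Nat.add_sub_cancel]
    rw [hqa, hqb, har]
    have e1 : ((m : ℕ) : ℝ) * (Real.pi / N) = ((m + 1 : ℕ) : ℝ) * (Real.pi / N) - Real.pi / N := by
      push_cast; ring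
    have e2 : ((m + 1 + 1 : ℕ) : ℝ) * (Real.pi / N) =
        ((m + 1 : ℕ) : ℝ) * (Real.pi / N) + Real.pi / N := by push_cast; ring
    rw [e1, e2, Real.sin_sub, Real.sin_add]
    ring

theorem IsCutWeight.mono {κ κ' : ℝ} {v : ℕ → ℝ} (h : IsCutWeight N q κ v) (hκ : κ' ≤ κ) :
    IsCutWeight N q κ' v where
  nonneg := h.nonneg
  lower := h.lower
  upper := h.upper
  contract j hj hjN := (h.contract j hj hjN).trans <| by
    have := h.nonneg j hjN.le
    gcongr

/-- The weighted size of a sequence of cumulative sums. -/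
def cutNorm (N : ℕ) (v F : ℕ → ℝ) : ℝ := ∑ j ∈ Finset.range (N - 1), v (j + 1) * |F (j + 1)|

theorem cutNorm_step_le {κ s : ℝ} {v F : ℕ → ℝ} (h : IsCutWeight N q κ v) (h0 : 0 ≤ q 0)
    (h1 : 0 ≤ q 1) (hs0 : 0 ≤ s) (hs1 : s ≤ 1) (hF0 : F 0 = 0) (hFN : F N = 0) :
    cutNorm N v (F + s • cumulativeGen N q F) ≤ (1 - s * κ) * cutNorm N v F := by
  rcases Nat.lt_or_ge N 2 with hN | hN
  · have : N - 1 = 0 := by omega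
    simp [cutNorm, this]
  obtain ⟨M, rfl⟩ : ∃ M, N = M + 1 := ⟨N - 1, by omega⟩
  simp only [cutNorm, Nat.add_sub_cancel]
  have hterm : ∀ j ∈ Finset.range M,
      v (j + 1) * |(F + s • cumulativeGen (M + 1) q F) (j + 1)| ≤
        (1 - s) * (v (j + 1) * |F (j + 1)|) + s * (q 1 * (v (j + 1) * |F j|) +
          q 0 * (v (j + 1) * |F (j + 2)|)) := by
    intro j hj
    have hj' := Finset.mem_range.1 hj
    have hv := h.nonneg (j + 1) (by omega)
    have e : (F + s • cumulativeGen (M + 1) q F) (j + 1) =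
        (1 - s) * F (j + 1) + s * (q 1 * F j + q 0 * F (j + 2)) := by
      simp only [Pi.add_apply, Pi.smul_apply, smul_eq_mul, cumulativeGen]
      rw [if_pos ⟨by omega, by omega⟩]
      simp only [Nat.add_sub_cancel]
      ring
    have e2 : |(1 - s) * F (j + 1) + s * (q 1 * F j + q 0 * F (j + 2))| ≤
        (1 - s) * |F (j + 1)| + s * (q 1 * |F j| + q 0 * |F (j + 2)|) := by
      calc _ ≤ |(1 - s) * F (j + 1)| + |s * (q 1 * F j + q 0 * F (j + 2))| := abs_add_le _ _
        _ = (1 - s) * |F (j + 1)| + s * |q 1 * F j + q 0 * F (j + 2)| := by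
          rw [abs_mul, abs_mul, abs_of_nonneg hs0, abs_of_nonneg (by linarith : 0 ≤ 1 - s)]
        _ ≤ _ := by
          gcongr
          calc _ ≤ |q 1 * F j| + |q 0 * F (j + 2)| := abs_add_le _ _
            _ = _ := by rw [abs_mul, abs_mul, abs_of_nonneg h0, abs_of_nonneg h1]
    rw [e]
    calc _ ≤ v (j + 1) * ((1 - s) * |F (j + 1)| + s * (q 1 * |F j| + q 0 * |F (j + 2)|)) := by
          gcongr
      _ = _ := by ring
  have hshift1 : ∑ j ∈ Finset.range M, v (j + 1) * |F j| ≤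
      ∑ j ∈ Finset.range M, v (j + 2) * |F (j + 1)| := by
    have a := Finset.sum_range_succ (fun j => v (j + 1) * |F j|) M
    have b := Finset.sum_range_succ' (fun j => v (j + 1) * |F j|) M
    simp only [hF0, abs_zero, mul_zero, add_zero] at b
    have := mul_nonneg (h.nonneg (M + 1) le_rfl) (abs_nonneg (F M))
    have b' : ∑ j ∈ Finset.range M, v (j + 2) * |F (j + 1)| =
      ∑ j ∈ Finset.range M, v (j + 1 + 1) * |F (j + 1)| := rfl
    linarith
  have hshift2 : ∑ j ∈ Finset.range M, v (j + 1) * |F (j + 2)| ≤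
      ∑ j ∈ Finset.range M, v j * |F (j + 1)| := by
    have a := Finset.sum_range_succ (fun j => v j * |F (j + 1)|) M
    have b := Finset.sum_range_succ' (fun j => v j * |F (j + 1)|) M
    simp only [hFN, abs_zero, mul_zero, add_zero] at a
    have := mul_nonneg (h.nonneg 0 (by omega)) (abs_nonneg (F (0 + 1)))
    have b' : ∑ j ∈ Finset.range M, v (j + 1) * |F (j + 2)| =
      ∑ j ∈ Finset.range M, v (j + 1) * |F (j + 1 + 1)| := rfl
    linarith
  calc _ ≤ ∑ j ∈ Finset.range M, ((1 - s) * (v (j + 1) * |F (j + 1)|) +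
        s * (q 1 * (v (j + 1) * |F j|) + q 0 * (v (j + 1) * |F (j + 2)|))) :=
        Finset.sum_le_sum hterm
    _ = (1 - s) * ∑ j ∈ Finset.range M, v (j + 1) * |F (j + 1)| +
        s * (q 1 * ∑ j ∈ Finset.range M, v (j + 1) * |F j| +
          q 0 * ∑ j ∈ Finset.range M, v (j + 1) * |F (j + 2)|) := by
        simp only [Finset.mul_sum, ← Finset.sum_add_distrib]
    _ ≤ (1 - s) * ∑ j ∈ Finset.range M, v (j + 1) * |F (j + 1)| +
        s * (q 1 * ∑ j ∈ Finset.range M, v (j + 2) * |F (j + 1)| +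
          q 0 * ∑ j ∈ Finset.range M, v j * |F (j + 1)|) := by gcongr
    _ = (1 - s) * ∑ j ∈ Finset.range M, v (j + 1) * |F (j + 1)| +
        s * ∑ j ∈ Finset.range M, (q 1 * v (j + 2) + q 0 * v j) * |F (j + 1)| := by
        simp only [Finset.mul_sum, ← Finset.sum_add_distrib]
        exact Finset.sum_congr rfl fun j _ => by ring
    _ ≤ (1 - s) * ∑ j ∈ Finset.range M, v (j + 1) * |F (j + 1)| +
        s * ∑ j ∈ Finset.range M, ((1 - κ) * v (j + 1)) * |F (j + 1)| := by
        gcongr with j hj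
        have := h.contract (j + 1) (by omega) (by have := Finset.mem_range.1 hj; omega)
        simpa using this
    _ = _ := by
        simp only [mul_assoc, ← Finset.mul_sum]
        ring

theorem exists_diffVec_eq (d : Fin N → ℝ) (hd : ∑ i, d i = 0) :
    ∃ F : ℕ → ℝ, F 0 = 0 ∧ F N = 0 ∧ d = diffVec N F ∧ ∀ j ≤ N, |F j| ≤ ∑ i, |d i| := by
  set w : ℕ → ℝ := fun i => if h : i < N then d ⟨i, h⟩ else 0 with hw
  have hdw : ∀ i : Fin N, d i = w i := fun i => by simp [hw]
  have hsum : ∑ i ∈ Finset.range N, w i = 0 := by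
    rw [← Fin.sum_univ_eq_sum_range, ← hd]
    exact Finset.sum_congr rfl fun i _ => (hdw i).symm
  have hsum' : ∑ i ∈ Finset.range N, |w i| = ∑ i, |d i| := by
    rw [← Fin.sum_univ_eq_sum_range (fun i => |w i|)]
    exact Finset.sum_congr rfl fun i _ => by rw [hdw]
  refine ⟨fun j => -∑ i ∈ Finset.range j, w i, by simp, by simp [hsum], ?_, fun j hj => ?_⟩
  · ext i
    rw [diffVec, Finset.sum_range_succ, hdw]
    ring
  · rw [abs_neg, ← hsum']
    exact (Finset.abs_sum_le_sum_abs _ _).trans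
      (Finset.sum_le_sum_of_subset_of_nonneg (Finset.range_subset_range.2 hj)
        fun _ _ _ => abs_nonneg _)

theorem sum_abs_diffVec_le {F : ℕ → ℝ} (hF0 : F 0 = 0) (hFN : F N = 0) :
    ∑ i, |diffVec N F i| ≤ 2 * ∑ j ∈ Finset.range (N - 1), |F (j + 1)| := by
  rcases Nat.eq_zero_or_pos N with rfl | hN
  · simp
  obtain ⟨M, rfl⟩ : ∃ M, N = M + 1 := ⟨N - 1, by omega⟩
  have h1 : ∑ i, |diffVec (M + 1) F i| ≤ ∑ j ∈ Finset.range (M + 1), (|F j| + |F (j + 1)|) := by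
    rw [← Fin.sum_univ_eq_sum_range (fun j => |F j| + |F (j + 1)|)]
    exact Finset.sum_le_sum fun i _ => abs_sub _ _
  rw [Finset.sum_add_distrib, Finset.sum_range_succ', Finset.sum_range_succ (fun j => |F (j + 1)|),
    hF0, hFN] at h1
  simp only [abs_zero, add_zero] at h1
  simp only [Nat.add_sub_cancel]
  linarith

theorem one_add_smul_ladder_pow_mulVec_le {κ s : ℝ} {v : ℕ → ℝ} (h : IsCutWeight N q κ v)
    (hN : 0 < N) (h0 : 0 ≤ q 0) (h1 : 0 ≤ q 1) (hq : q 0 + q 1 = 1) (hs0 : 0 ≤ s) (hs1 : s ≤ 1)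
    (hκ : s * κ ≤ 1) (d : Fin N → ℝ) (hd : ∑ i, d i = 0) (L : ℕ) :
    ∑ i, |(((1 + s • ladder N q) ^ L) *ᵥ d) i| ≤
      2 * (N : ℝ) ^ 2 * 3 ^ N * (1 - s * κ) ^ L * ∑ i, |d i| := by
  obtain ⟨F, hF0, hFN, rfl, hFd⟩ := exists_diffVec_eq d hd
  have hN' : (0 : ℝ) < N := by exact_mod_cast hN
  have hit : ∀ L : ℕ, ∃ F' : ℕ → ℝ, F' 0 = 0 ∧ F' N = 0 ∧
      ((1 + s • ladder N q) ^ L) *ᵥ diffVec N F = diffVec N F' ∧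
      cutNorm N v F' ≤ (1 - s * κ) ^ L * cutNorm N v F := by
    intro L
    induction L with
    | zero => exact ⟨F, hF0, hFN, by simp, by simp⟩
    | succ L ih =>
      obtain ⟨F', h0', hN'', he, hn⟩ := ih
      refine ⟨F' + s • cumulativeGen N q F', ?_, ?_, ?_, ?_⟩
      · simp [h0', cumulativeGen]
      · simp [hN'', cumulativeGen]
      · rw [pow_succ', ← Matrix.mulVec_mulVec, he, Matrix.add_mulVec, Matrix.one_mulVec,
          Matrix.smul_mulVec, ladder_mulVec_diffVec hq]
        ext i
        simp only [diffVec, Pi.add_apply, Pi.smul_apply, smul_eq_mul]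
        ring
      · rw [pow_succ', mul_assoc]
        exact (cutNorm_step_le h h0 h1 hs0 hs1 h0' hN'').trans
          (mul_le_mul_of_nonneg_left hn (by linarith))
  obtain ⟨F', hF0', hFN', he, hn⟩ := hit L
  rw [he]
  have hpow : 0 ≤ (1 - s * κ) ^ L := pow_nonneg (by linarith) _
  have hlow : ∑ j ∈ Finset.range (N - 1), |F' (j + 1)| ≤ N * cutNorm N v F' := by
    rw [cutNorm, Finset.mul_sum]
    refine Finset.sum_le_sum fun j hj => ?_
    have hj' := Finset.mem_range.1 hj
    have hl := h.lower (j + 1) (by omega) (by omega)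
    rw [div_le_iff₀ hN'] at hl
    have := abs_nonneg (F' (j + 1))
    nlinarith
  have hup : cutNorm N v F ≤ N * (3 ^ N * ∑ i, |diffVec N F i|) := by
    calc cutNorm N v F ≤ ∑ j ∈ Finset.range (N - 1), 3 ^ N * ∑ i, |diffVec N F i| := by
          refine Finset.sum_le_sum fun j hj => ?_
          have hj' := Finset.mem_range.1 hj
          exact mul_le_mul (h.upper _ (by omega) (by omega)) (hFd _ (by omega)) (abs_nonneg _)
            (by positivity)
      _ = ((N - 1 : ℕ) : ℝ) * (3 ^ N * ∑ i, |diffVec N F i|) := by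
          rw [Finset.sum_const, Finset.card_range, nsmul_eq_mul]
      _ ≤ _ := by
          have : ((N - 1 : ℕ) : ℝ) ≤ N := by exact_mod_cast Nat.sub_le _ _
          exact mul_le_mul_of_nonneg_right this
            (mul_nonneg (by positivity) (Finset.sum_nonneg fun _ _ => abs_nonneg _))
  calc _ ≤ 2 * ∑ j ∈ Finset.range (N - 1), |F' (j + 1)| := sum_abs_diffVec_le hF0' hFN'
    _ ≤ 2 * (N * cutNorm N v F') := by gcongr
    _ ≤ 2 * (N * ((1 - s * κ) ^ L * (N * (3 ^ N * ∑ i, |diffVec N F i|)))) := by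
        gcongr
        exact hn.trans (by gcongr)
    _ = _ := by ring

end LadderMixing

/-! ## Second-order perturbation theory for one interaction -/

section Dyson

open scoped Matrix.Norms.L2Operator

variable {κ : Type} [Fintype κ] [DecidableEq κ]

theorem continuous_exp_matrix : Continuous (NormedSpace.exp : Matrix κ κ ℂ → Matrix κ κ ℂ) := by
  let _ : NormedAlgebra ℚ (Matrix κ κ ℂ) := NormedAlgebra.restrictScalars ℚ ℂ _
  exact NormedSpace.exp_continuous

theorem exp_I_smul_mem_unitary {A : Matrix κ κ ℂ} (hA : A.IsHermitian) (t : ℝ) :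
    NormedSpace.exp ((Complex.I * (t : ℂ)) • A) ∈ unitary (Matrix κ κ ℂ) := by
  let _ : NormedAlgebra ℚ (Matrix κ κ ℂ) := NormedAlgebra.restrictScalars ℚ ℂ _
  apply NormedSpace.exp_mem_unitary_of_mem_skewAdjoint
  rw [skewAdjoint.mem_iff, star_smul, Matrix.star_eq_conjTranspose, hA]
  simp

theorem exp_neg_I_smul {A : Matrix κ κ ℂ} (hA : A.IsHermitian) (t : ℝ) :
    NormedSpace.exp (-((Complex.I * (t : ℂ)) • A)) =
      (NormedSpace.exp ((Complex.I * (t : ℂ)) • A))ᴴ := by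
  rw [← Matrix.exp_conjTranspose, Matrix.conjTranspose_smul, hA]
  congr 1
  simp

theorem hasDerivAt_exp_real_smul (A : Matrix κ κ ℂ) (s : ℝ) :
    HasDerivAt (fun u : ℝ => NormedSpace.exp (u • A)) (NormedSpace.exp (s • A) * A) s :=
  hasDerivAt_exp_smul_const A s

theorem hasDerivAt_exp_real_smul' (A : Matrix κ κ ℂ) (s : ℝ) :
    HasDerivAt (fun u : ℝ => NormedSpace.exp (u • A)) (A * NormedSpace.exp (s • A)) s :=
  hasDerivAt_exp_smul_const' A s

/-- Comparison of the interaction picture propagator with its first-order expansion. -/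
theorem norm_interactionPicture_sub_le (A C : Matrix κ κ ℂ)
    (hA : ∀ s : ℝ, NormedSpace.exp (s • A) ∈ unitary (Matrix κ κ ℂ))
    (hB : ∀ s : ℝ, NormedSpace.exp (s • (A + C)) ∈ unitary (Matrix κ κ ℂ)) {t : ℝ} (ht : 0 ≤ t) :
    ‖NormedSpace.exp (t • -A) * NormedSpace.exp (t • (A + C)) - 1 -
        ∫ u in (0 : ℝ)..t, NormedSpace.exp (u • -A) * C * NormedSpace.exp (u • A)‖ ≤
      (t * ‖C‖) ^ 2 := by
  set X : ℝ → Matrix κ κ ℂ := fun u => NormedSpace.exp (u • -A) with hX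
  set Y : ℝ → Matrix κ κ ℂ := fun u => NormedSpace.exp (u • A) with hY
  set Z : ℝ → Matrix κ κ ℂ := fun u => NormedSpace.exp (u • (A + C)) with hZ
  have hYX : ∀ u, Y u * X u = 1 := by
    intro u
    simp only [hX, hY]
    rw [smul_neg, ← Matrix.exp_add_of_commute _ _ ((Commute.refl (u • A)).neg_right),
      add_neg_cancel, NormedSpace.exp_zero]
  have hXu : ∀ u, X u ∈ unitary (Matrix κ κ ℂ) := by
    intro u
    have := hA (-u)
    simpa [hX] using this
  have hYu : ∀ u, Y u ∈ unitary (Matrix κ κ ℂ) := hA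
  have hZu : ∀ u, Z u ∈ unitary (Matrix κ κ ℂ) := hB
  set Q : ℝ → Matrix κ κ ℂ := fun u => X u * C * Y u with hQ
  have hQc : Continuous Q := by
    have h1 : Continuous X := continuous_iff_continuousAt.2 fun s =>
      (hasDerivAt_exp_real_smul (-A) s).continuousAt
    have h2 : Continuous Y := continuous_iff_continuousAt.2 fun s =>
      (hasDerivAt_exp_real_smul A s).continuousAt
    exact (h1.mul continuous_const).mul h2
  have hQn : ∀ u, ‖Q u‖ = ‖C‖ := fun u => by
    rw [hQ]
    simp only
    rw [CStarRing.norm_mul_mem_unitary _ (hYu u), CStarRing.norm_mem_unitary_mul _ (hXu u)]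
  set V : ℝ → Matrix κ κ ℂ := fun u => X u * Z u with hV
  have hVu : ∀ u, V u ∈ unitary (Matrix κ κ ℂ) := fun u => mul_mem (hXu u) (hZu u)
  have hVd : ∀ u, HasDerivAt V (Q u * V u) u := by
    intro u
    have h := (hasDerivAt_exp_real_smul (-A) u).mul (hasDerivAt_exp_real_smul' (A + C) u)
    have e : NormedSpace.exp (u • -A) * -A * NormedSpace.exp (u • (A + C)) +
        NormedSpace.exp (u • -A) * ((A + C) * NormedSpace.exp (u • (A + C))) = Q u * V u := by
      have : Q u * V u = X u * C * (Y u * X u) * Z u := by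
        simp only [hQ, hV]; noncomm_ring
      rw [this, hYX]
      simp only [hX, hZ]
      noncomm_ring
    rw [e] at h
    exact h
  have hV0 : V 0 = 1 := by simp [hV, hX, hZ]
  have hV1 : ∀ u ∈ Set.Icc (0 : ℝ) t, ‖V u - 1‖ ≤ t * ‖C‖ := by
    intro u hu
    have h := norm_image_sub_le_of_norm_deriv_le_segment' (f := V) (a := 0) (b := t) (C := ‖C‖)
      (fun x _ => (hVd x).hasDerivWithinAt)
      (fun x _ => by rw [CStarRing.norm_mul_mem_unitary _ (hVu x), hQn]) u hu
    rw [hV0] at h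
    refine h.trans ?_
    have := norm_nonneg C
    have := hu.2
    nlinarith
  have hWd : ∀ u, HasDerivAt (fun u => V u - 1 - ∫ x in (0 : ℝ)..u, Q x) (Q u * (V u - 1)) u := by
    intro u
    have hI : HasDerivAt (fun u => ∫ x in (0 : ℝ)..u, Q x) (Q u) u :=
      intervalIntegral.integral_hasDerivAt_right (hQc.intervalIntegrable _ _)
        hQc.aestronglyMeasurable.stronglyMeasurableAtFilter hQc.continuousAt
    have := ((hVd u).sub_const 1).sub hI
    rw [mul_sub, mul_one]
    exact this
  have h := norm_image_sub_le_of_norm_deriv_le_segment'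
    (f := fun u => V u - 1 - ∫ x in (0 : ℝ)..u, Q x) (a := 0) (b := t) (C := ‖C‖ * (t * ‖C‖))
      (fun x _ => (hWd x).hasDerivWithinAt)
      (fun x hx => (norm_mul_le _ _).trans (by
        rw [hQn]; gcongr; exact hV1 x ⟨hx.1, hx.2.le⟩)) t ⟨ht, le_rfl⟩
  simp only [hV0, intervalIntegral.integral_same, sub_self, sub_zero] at h
  refine h.trans (le_of_eq (by ring))

theorem sum_norm_sq_col_le (A : Matrix κ κ ℂ) (y : κ) : ∑ x, ‖A x y‖ ^ 2 ≤ ‖A‖ ^ 2 := by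
  have h := Matrix.l2_opNorm_mulVec A (EuclideanSpace.single y (1 : ℂ))
  rw [PiLp.norm_single, norm_one, mul_one] at h
  have h2 : ‖(EuclideanSpace.equiv κ ℂ).symm (A *ᵥ (EuclideanSpace.single y (1 : ℂ)).ofLp)‖ ^ 2 =
      ∑ x, ‖A x y‖ ^ 2 := by
    rw [EuclideanSpace.norm_sq_eq]
    simp
  rw [← h2]
  gcongr

theorem norm_integral_exp_mul (δ : ℝ) {t : ℝ} (ht : 0 ≤ t) :
    ‖∫ u in (0 : ℝ)..t, Complex.exp (Complex.I * (δ * u : ℝ))‖ = t * |Real.sinc (δ * t / 2)| := by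
  rcases eq_or_ne δ 0 with rfl | hδ
  · simp [abs_of_nonneg ht]
  · have hc : Complex.I * (δ : ℂ) ≠ 0 := by simp [hδ]
    have h := integral_exp_mul_complex (a := 0) (b := t) hc
    have e : ∀ u : ℝ, Complex.exp (Complex.I * (δ * u : ℝ)) =
        Complex.exp (Complex.I * (δ : ℂ) * u) := fun u => by push_cast; rw [mul_assoc]
    simp only [e]
    rw [h, Complex.ofReal_zero, mul_zero, Complex.exp_zero, norm_div, norm_mul, Complex.norm_I,
      one_mul, Complex.norm_real, ← e, Complex.norm_exp_I_mul_ofReal_sub_one]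
    rcases ht.eq_or_lt with rfl | ht'
    · simp
    · rw [Real.sinc_of_ne_zero (by positivity), abs_div, norm_mul, Real.norm_eq_abs,
        Real.norm_eq_abs, Real.norm_eq_abs, abs_div, abs_mul, abs_of_pos ht', abs_two]
      have : |δ| ≠ 0 := abs_ne_zero.2 hδ
      field_simp

/-- The propagator `e^{i (H + α G) t}` for a diagonal Hamiltonian `H`. -/
def propagator (e : κ → ℝ) (α t : ℝ) (G : Matrix κ κ ℂ) : Matrix κ κ ℂ :=
  NormedSpace.exp ((Complex.I * (t : ℂ)) • (diagOp e + (α : ℂ) • G))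

theorem diagOp_isHermitian {κ : Type} [DecidableEq κ] (e : κ → ℝ) : (diagOp e).IsHermitian := by
  rw [diagOp, Matrix.IsHermitian, Matrix.diagonal_conjTranspose]
  congr 1
  ext i
  simp

theorem isHermitian_add_smul {κ : Type} [DecidableEq κ] (e : κ → ℝ) (α : ℝ) {G : Matrix κ κ ℂ} (hG : G.IsHermitian) :
    (diagOp e + (α : ℂ) • G).IsHermitian := by
  apply (diagOp_isHermitian e).add
  rw [Matrix.IsHermitian, Matrix.conjTranspose_smul, hG]
  simp

theorem propagator_mem_unitary (e : κ → ℝ) (α t : ℝ) {G : Matrix κ κ ℂ} (hG : G.IsHermitian) :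
    propagator e α t G ∈ unitary (Matrix κ κ ℂ) :=
  exp_I_smul_mem_unitary (isHermitian_add_smul e α hG) t

theorem continuous_propagator (e : κ → ℝ) (α t : ℝ) :
    Continuous (propagator e α t : Matrix κ κ ℂ → Matrix κ κ ℂ) := by
  unfold propagator
  refine continuous_exp_matrix.comp ?_
  fun_prop

theorem sum_norm_sq_propagator_col (e : κ → ℝ) (α t : ℝ) {G : Matrix κ κ ℂ} (hG : G.IsHermitian)
    (y : κ) : ∑ x, ‖propagator e α t G x y‖ ^ 2 = 1 := by
  have h := congrFun (congrFun (Unitary.mem_iff.1 (propagator_mem_unitary e α t hG)).1 y) y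
  rw [Matrix.star_eq_conjTranspose, Matrix.mul_apply, Matrix.one_apply_eq] at h
  have h2 : ((∑ x, ‖propagator e α t G x y‖ ^ 2 : ℝ) : ℂ) = 1 := by
    rw [← h]
    push_cast
    refine Finset.sum_congr rfl fun x _ => ?_
    rw [Matrix.conjTranspose_apply, ← Complex.conj_mul']
    rfl
  exact_mod_cast h2

theorem exp_smul_diagOp (e : κ → ℝ) (s : ℝ) :
    NormedSpace.exp (s • (Complex.I • diagOp e)) =
      Matrix.diagonal fun x => Complex.exp (Complex.I * (e x * s : ℝ)) := by
  have : s • (Complex.I • diagOp e) =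
      Matrix.diagonal fun x => Complex.I * ((e x * s : ℝ) : ℂ) := by
    rw [diagOp, ← Matrix.diagonal_smul, ← Matrix.diagonal_smul]
    congr 1
    ext x
    simp
    ring
  rw [this, Matrix.exp_diagonal]
  congr 1
  ext x
  rw [Pi.coe_exp, Complex.exp_eq_exp_ℂ]

/-- The transition probabilities of the propagator out of a fixed level agree with first-order
perturbation theory, with a remainder of third order. -/
theorem sum_abs_norm_sq_propagator_sub_le (e : κ → ℝ) {α t : ℝ} (hα : 0 ≤ α) (ht : 0 ≤ t)
    {G : Matrix κ κ ℂ} (hG : G.IsHermitian) (y : κ) :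
    ∑ x ∈ Finset.univ.erase y, |‖propagator e α t G x y‖ ^ 2 -
        (α * t) ^ 2 * Real.sinc ((e x - e y) * t / 2) ^ 2 * ‖G x y‖ ^ 2| ≤
      2 * (α * t * ‖G‖) ^ 3 + (α * t * ‖G‖) ^ 4 := by
  set A : Matrix κ κ ℂ := Complex.I • diagOp e with hAdef
  set C : Matrix κ κ ℂ := (Complex.I * (α : ℂ)) • G with hCdef
  have hCn : ‖C‖ = α * ‖G‖ := by
    rw [hCdef, norm_smul, norm_mul, Complex.norm_I, one_mul, Complex.norm_real,
      Real.norm_of_nonneg hα]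
  have hAu : ∀ s : ℝ, NormedSpace.exp (s • A) ∈ unitary (Matrix κ κ ℂ) := by
    intro s
    have h := exp_I_smul_mem_unitary (diagOp_isHermitian e) s
    rwa [mul_comm, mul_smul, Complex.coe_smul] at h
  have hAC : ∀ s : ℝ, s • (A + C) = (Complex.I * (s : ℂ)) • (diagOp e + (α : ℂ) • G) := by
    intro s
    rw [mul_comm, mul_smul, Complex.coe_smul, hAdef, hCdef, smul_add Complex.I, smul_smul]
  have hBu : ∀ s : ℝ, NormedSpace.exp (s • (A + C)) ∈ unitary (Matrix κ κ ℂ) := by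
    intro s
    rw [hAC]
    exact exp_I_smul_mem_unitary (isHermitian_add_smul e α hG) s
  have hmain := norm_interactionPicture_sub_le A C hAu hBu ht
  rw [hAC t, hCn] at hmain
  have hXdiag : ∀ u : ℝ, NormedSpace.exp (u • -A) =
      Matrix.diagonal fun x => Complex.exp (Complex.I * (e x * (-u) : ℝ)) := by
    intro u
    rw [← exp_smul_diagOp, smul_neg, neg_smul]
  have hYdiag : ∀ u : ℝ, NormedSpace.exp (u • A) =
      Matrix.diagonal fun x => Complex.exp (Complex.I * (e x * u : ℝ)) := by
    intro u
    rw [← exp_smul_diagOp]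
  set Γ : Matrix κ κ ℂ :=
    ∫ u in (0 : ℝ)..t, NormedSpace.exp (u • -A) * C * NormedSpace.exp (u • A) with hΓ
  set R := NormedSpace.exp (t • -A) *
    NormedSpace.exp ((Complex.I * (t : ℂ)) • (diagOp e + (α : ℂ) • G)) - 1 - Γ with hR
  have hXu : ∀ u : ℝ, NormedSpace.exp (u • -A) ∈ unitary (Matrix κ κ ℂ) := by
    intro u
    have := hAu (-u)
    simpa using this
  have hQn : ∀ u : ℝ, ‖NormedSpace.exp (u • -A) * C * NormedSpace.exp (u • A)‖ = ‖C‖ := fun u => by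
    rw [CStarRing.norm_mul_mem_unitary _ (hAu u), CStarRing.norm_mem_unitary_mul _ (hXu u)]
  have hΓn : ‖Γ‖ ≤ α * t * ‖G‖ := by
    have := intervalIntegral.norm_integral_le_of_norm_le_const (a := 0) (b := t) (C := ‖C‖)
      (f := fun u : ℝ => NormedSpace.exp (u • -A) * C * NormedSpace.exp (u • A))
      (fun u _ => (hQn u).le)
    rw [sub_zero, abs_of_nonneg ht, hCn] at this
    linarith
  have hΓe : ∀ x, ‖Γ x y‖ = α * t * |Real.sinc ((e x - e y) * t / 2)| * ‖G x y‖ := by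
    intro x
    have hcont : Continuous fun u : ℝ =>
        NormedSpace.exp (u • -A) * C * NormedSpace.exp (u • A) := by
      have h1 : Continuous fun u : ℝ => NormedSpace.exp (u • -A) :=
        continuous_iff_continuousAt.2 fun s => (hasDerivAt_exp_real_smul (-A) s).continuousAt
      have h2 : Continuous fun u : ℝ => NormedSpace.exp (u • A) :=
        continuous_iff_continuousAt.2 fun s => (hasDerivAt_exp_real_smul A s).continuousAt
      exact (h1.mul continuous_const).mul h2
    have h := ContinuousLinearMap.intervalIntegral_comp_comm
      (LinearMap.toContinuousLinearMap (Matrix.entryLinearMap ℂ ℂ x y))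
      (hcont.intervalIntegrable (μ := volume) 0 t)
    have h' : Γ x y = ∫ u in (0 : ℝ)..t,
        (NormedSpace.exp (u • -A) * C * NormedSpace.exp (u • A)) x y := h.symm
    rw [h']
    have hent : ∀ u : ℝ, (NormedSpace.exp (u • -A) * C * NormedSpace.exp (u • A)) x y =
        (Complex.I * (α : ℂ) * G x y) * Complex.exp (Complex.I * ((-(e x - e y)) * u : ℝ)) := by
      intro u
      rw [hXdiag, hYdiag, Matrix.mul_diagonal, Matrix.diagonal_mul, hCdef, Matrix.smul_apply,
        smul_eq_mul]
      have : Complex.exp (Complex.I * ((-(e x - e y)) * u : ℝ)) =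
          Complex.exp (Complex.I * (e x * (-u) : ℝ)) * Complex.exp (Complex.I * (e y * u : ℝ)) := by
        rw [← Complex.exp_add]
        congr 1
        push_cast
        ring
      rw [this]
      ring
    simp only [hent]
    rw [intervalIntegral.integral_const_mul, norm_mul, norm_integral_exp_mul _ ht, norm_mul,
      norm_mul, Complex.norm_I, one_mul, Complex.norm_real, Real.norm_of_nonneg hα]
    rw [neg_mul, neg_div, Real.sinc_neg]
    ring
  have hUe : ∀ x, x ≠ y → ‖propagator e α t G x y‖ = ‖Γ x y + R x y‖ := by
    intro x hxy
    have e1 : Γ x y + R x y = Complex.exp (Complex.I * (e x * (-t) : ℝ)) *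
        propagator e α t G x y := by
      rw [hR, hXdiag, Matrix.sub_apply, Matrix.sub_apply, Matrix.diagonal_mul,
        Matrix.one_apply_ne hxy, propagator]
      ring
    rw [e1, norm_mul, mul_comm Complex.I, Complex.norm_exp_ofReal_mul_I, one_mul]
  have hpt : ∀ x ∈ Finset.univ.erase y, |‖propagator e α t G x y‖ ^ 2 -
        (α * t) ^ 2 * Real.sinc ((e x - e y) * t / 2) ^ 2 * ‖G x y‖ ^ 2| ≤
      2 * (‖Γ x y‖ * ‖R x y‖) + ‖R x y‖ ^ 2 := by
    intro x hx
    rw [hUe x (Finset.ne_of_mem_erase hx)]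
    have : (α * t) ^ 2 * Real.sinc ((e x - e y) * t / 2) ^ 2 * ‖G x y‖ ^ 2 = ‖Γ x y‖ ^ 2 := by
      rw [hΓe, mul_pow (_ * _) (‖G x y‖), mul_pow (α * t) (|_|), sq_abs]
    rw [this]
    have h1 := norm_add_le (Γ x y) (R x y)
    have h2 := norm_sub_norm_le (Γ x y) (-R x y)
    rw [norm_neg, sub_neg_eq_add] at h2
    have h3 := norm_nonneg (Γ x y)
    have h4 := norm_nonneg (R x y)
    have h5 := norm_nonneg (Γ x y + R x y)
    rw [abs_le]
    constructor
    · by_cases h6 : ‖R x y‖ ≤ ‖Γ x y‖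
      · nlinarith
      · nlinarith
    · nlinarith
  have hRcol := sum_norm_sq_col_le R y
  have hΓcol := sum_norm_sq_col_le Γ y
  have hCS := Real.sum_mul_le_sqrt_mul_sqrt Finset.univ (fun x => ‖Γ x y‖) (fun x => ‖R x y‖)
  have hRn : ‖R‖ ≤ (α * t * ‖G‖) ^ 2 := hmain.trans (le_of_eq (by ring))
  have h1 : √(∑ x, ‖Γ x y‖ ^ 2) ≤ α * t * ‖G‖ :=
    (Real.sqrt_le_left (norm_nonneg _) |>.2 hΓcol).trans hΓn
  have h2 : √(∑ x, ‖R x y‖ ^ 2) ≤ (α * t * ‖G‖) ^ 2 :=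
    (Real.sqrt_le_left (norm_nonneg _) |>.2 hRcol).trans hRn
  have h0 : 0 ≤ α * t * ‖G‖ := by positivity
  calc _ ≤ ∑ x ∈ Finset.univ.erase y, (2 * (‖Γ x y‖ * ‖R x y‖) + ‖R x y‖ ^ 2) :=
        Finset.sum_le_sum hpt
    _ ≤ ∑ x, (2 * (‖Γ x y‖ * ‖R x y‖) + ‖R x y‖ ^ 2) :=
        Finset.sum_le_sum_of_subset_of_nonneg (Finset.erase_subset _ _)
          fun _ _ _ => by positivity
    _ = 2 * ∑ x, ‖Γ x y‖ * ‖R x y‖ + ∑ x, ‖R x y‖ ^ 2 := by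
        rw [Finset.sum_add_distrib, Finset.mul_sum]
    _ ≤ 2 * (√(∑ x, ‖Γ x y‖ ^ 2) * √(∑ x, ‖R x y‖ ^ 2)) + ‖R‖ ^ 2 := by gcongr
    _ ≤ 2 * ((α * t * ‖G‖) * (α * t * ‖G‖) ^ 2) + ((α * t * ‖G‖) ^ 2) ^ 2 := by gcongr
    _ = _ := by ring

end Dyson

/-! ## Moments of the random interaction -/

section Moments

variable {ι : Type} [Fintype ι] [DecidableEq ι]

instance unitaryGroup_secondCountable : SecondCountableTopology (Matrix.unitaryGroup ι ℂ) :=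
  haveI : SecondCountableTopology (Matrix ι ι ℂ) :=
    inferInstanceAs (SecondCountableTopology (ι → ι → ℂ))
  TopologicalSpace.Subtype.secondCountableTopology _

instance haarUnitary_isProbabilityMeasure : IsProbabilityMeasure (haarUnitary ι) :=
  ⟨by simpa [haarUnitary] using
    Measure.haarMeasure_self (K₀ := (⊤ : TopologicalSpace.PositiveCompacts (unitaryGroup ι ℂ)))⟩

instance haarUnitary_isMulLeftInvariant : (haarUnitary ι).IsMulLeftInvariant :=
  inferInstanceAs (Measure.haarMeasure _).IsMulLeftInvariant

instance interactionLaw_isProbabilityMeasure : IsProbabilityMeasure (interactionLaw ι) :=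
  inferInstanceAs (IsProbabilityMeasure ((haarUnitary ι).prod _))

theorem continuous_unitary_entry (x k : ι) :
    Continuous fun U : Matrix.unitaryGroup ι ℂ => (U : Matrix ι ι ℂ) x k :=
  (continuous_apply_apply x k).comp continuous_subtype_val

theorem integrable_of_continuous_haar {f : Matrix.unitaryGroup ι ℂ → ℝ} (hf : Continuous f) :
    Integrable f (haarUnitary ι) :=
  hf.integrable_of_hasCompactSupport (HasCompactSupport.of_compactSpace f)

/-- A reflection mixing two basis vectors with weights `3/5` and `4/5` and a relative phase. -/
def mixingReflection (x y : ι) (φ : ℂ) : Matrix ι ι ℂ :=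
  1 - (2 / 5 : ℂ) • vecMulVec (Pi.single x 1 + Pi.single y (2 * φ))
    (star (Pi.single x 1 + Pi.single y (2 * φ)))

theorem mixingReflection_mem {x y : ι} (hxy : x ≠ y) {φ : ℂ} (hφ : φ * star φ = 1) :
    mixingReflection x y φ ∈ Matrix.unitaryGroup ι ℂ := by
  have hφ' : star φ * φ = 1 := by rw [mul_comm]; exact hφ
  set v : ι → ℂ := Pi.single x 1 + Pi.single y (2 * φ) with hv
  have hvv : star v ⬝ᵥ v = 5 := by
    rw [hv, star_add, ← Pi.single_star, ← Pi.single_star, add_dotProduct, dotProduct_add,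
      dotProduct_add, single_dotProduct, single_dotProduct, single_dotProduct, single_dotProduct]
    have h2 : star (2 * φ) * (2 * φ) = 4 := by
      rw [star_mul']
      have : star (2 : ℂ) = 2 := star_ofNat 2
      rw [this]
      linear_combination 4 * hφ'
    simp only [Pi.single_eq_same, Pi.single_eq_of_ne hxy, Pi.single_eq_of_ne hxy.symm, h2, star_one]
    norm_num
  have hH : (mixingReflection x y φ)ᴴ = mixingReflection x y φ := by
    rw [mixingReflection, ← hv, conjTranspose_sub, conjTranspose_one, conjTranspose_smul,
      conjTranspose_vecMulVec, star_star]
    simp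
  rw [Matrix.mem_unitaryGroup_iff, Matrix.star_eq_conjTranspose, hH, mixingReflection, ← hv]
  have hP : vecMulVec v (star v) * vecMulVec v (star v) = (5 : ℂ) • vecMulVec v (star v) := by
    rw [vecMulVec_mul_vecMulVec, hvv, vecMulVec_smul]
  have hP2 : ((2 / 5 : ℂ) • vecMulVec v (star v)) * ((2 / 5 : ℂ) • vecMulVec v (star v)) =
      (4 / 5 : ℂ) • vecMulVec v (star v) := by
    rw [smul_mul_smul_comm, hP, smul_smul]
    norm_num
  rw [mul_sub, mul_one, sub_mul (1 : Matrix ι ι ℂ), one_mul, hP2]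
  module

theorem mixingReflection_mul_apply {x y : ι} (hxy : x ≠ y) (φ : ℂ) (U : Matrix ι ι ℂ) (k : ι) :
    (mixingReflection x y φ * U) x k = (3 / 5 : ℂ) * U x k - (4 / 5 : ℂ) * star φ * U y k := by
  rw [mixingReflection, sub_mul, one_mul, smul_mul_assoc, vecMulVec_mul, Matrix.sub_apply,
    Matrix.smul_apply, vecMulVec_apply, star_add, ← Pi.single_star, ← Pi.single_star, add_vecMul,
    Pi.add_apply, single_vecMul, single_vecMul]
  simp [hxy]
  ring

theorem norm_pow_four_phase_average (A B : ℂ) :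
    ‖A - B‖ ^ 4 + ‖A - (-1 : ℂ) * B‖ ^ 4 + ‖A - Complex.I * B‖ ^ 4 +
      ‖A - (-Complex.I) * B‖ ^ 4 = 4 * (‖A‖ ^ 4 + ‖B‖ ^ 4 + 4 * (‖A‖ ^ 2 * ‖B‖ ^ 2)) := by
  have h : ∀ z : ℂ, ‖z‖ ^ 4 = (z.re ^ 2 + z.im ^ 2) ^ 2 := fun z => by
    rw [show (4 : ℕ) = 2 * 2 from rfl, pow_mul, Complex.sq_norm, Complex.normSq_apply]; ring
  simp only [h, Complex.sq_norm, Complex.normSq_apply, Complex.sub_re, Complex.sub_im,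
    Complex.mul_re, Complex.mul_im, Complex.neg_re, Complex.neg_im, Complex.I_re, Complex.I_im,
    Complex.one_re, Complex.one_im]
  ring

theorem integral_norm_pow_four_eq {x y : ι} (hxy : x ≠ y) (k : ι) :
    ∫ U : Matrix.unitaryGroup ι ℂ, ‖(U : Matrix ι ι ℂ) x k‖ ^ 4 ∂(haarUnitary ι) =
      (81 / 625) * ∫ U : Matrix.unitaryGroup ι ℂ, ‖(U : Matrix ι ι ℂ) x k‖ ^ 4 ∂(haarUnitary ι) +
      (256 / 625) * ∫ U : Matrix.unitaryGroup ι ℂ, ‖(U : Matrix ι ι ℂ) y k‖ ^ 4 ∂(haarUnitary ι) +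
      (576 / 625) * ∫ U : Matrix.unitaryGroup ι ℂ,
        ‖(U : Matrix ι ι ℂ) x k‖ ^ 2 * ‖(U : Matrix ι ι ℂ) y k‖ ^ 2 ∂(haarUnitary ι) := by
  set a := ∫ U : Matrix.unitaryGroup ι ℂ, ‖(U : Matrix ι ι ℂ) x k‖ ^ 4 ∂(haarUnitary ι) with ha
  have hinv : ∀ φ : ℂ, φ * star φ = 1 → a = ∫ U : Matrix.unitaryGroup ι ℂ,
      ‖(3 / 5 : ℂ) * (U : Matrix ι ι ℂ) x k - φ * ((4 / 5 : ℂ) * (U : Matrix ι ι ℂ) y k)‖ ^ 4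
        ∂(haarUnitary ι) := by
    intro φ hφ
    have h := integral_mul_left_eq_self (μ := haarUnitary ι)
      (fun U : Matrix.unitaryGroup ι ℂ => ‖(U : Matrix ι ι ℂ) x k‖ ^ 4)
      ⟨mixingReflection x y (star φ),
        mixingReflection_mem hxy (by rw [star_star, mul_comm]; exact hφ)⟩
    rw [ha, ← h]
    refine integral_congr_ae (Eventually.of_forall fun U => ?_)
    simp only [Submonoid.coe_mul]
    rw [mixingReflection_mul_apply hxy, star_star]
    congr 2
    ring
  have hcx := continuous_unitary_entry x k
  have hcy := continuous_unitary_entry y k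
  have hint : ∀ φ : ℂ, Integrable (fun U : Matrix.unitaryGroup ι ℂ =>
      ‖(3 / 5 : ℂ) * (U : Matrix ι ι ℂ) x k - φ * ((4 / 5 : ℂ) * (U : Matrix ι ι ℂ) y k)‖ ^ 4)
        (haarUnitary ι) := fun φ => integrable_of_continuous_haar
      (((continuous_const.mul hcx).sub (continuous_const.mul (continuous_const.mul hcy))).norm.pow 4)
  have h1 := hinv 1 (by simp)
  have h2 := hinv (-1) (by simp)
  have h3 := hinv Complex.I (by simp)
  have h4 := hinv (-Complex.I) (by simp)
  have hsum : 4 * a = ∫ U : Matrix.unitaryGroup ι ℂ,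
      4 * ((81 / 625) * ‖(U : Matrix ι ι ℂ) x k‖ ^ 4 +
        (256 / 625) * ‖(U : Matrix ι ι ℂ) y k‖ ^ 4 +
        (576 / 625) * (‖(U : Matrix ι ι ℂ) x k‖ ^ 2 * ‖(U : Matrix ι ι ℂ) y k‖ ^ 2))
        ∂(haarUnitary ι) := by
    calc 4 * a = a + a + a + a := by ring
      _ = _ := by
        nth_rewrite 1 [h1]
        nth_rewrite 1 [h2]
        nth_rewrite 1 [h3]
        nth_rewrite 1 [h4]
        rw [← integral_add (hint _) (hint _), ← integral_add ((hint _).fun_add (hint _)) (hint _),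
          ← integral_add (((hint _).fun_add (hint _)).fun_add (hint _)) (hint _)]
        refine integral_congr_ae (Eventually.of_forall fun U => ?_)
        have := norm_pow_four_phase_average ((3 / 5 : ℂ) * (U : Matrix ι ι ℂ) x k)
          ((4 / 5 : ℂ) * (U : Matrix ι ι ℂ) y k)
        simp only [one_mul] at this ⊢
        rw [this, norm_mul, norm_mul]
        norm_num
        ring
  have hX := (integrable_of_continuous_haar (hcx.norm.fun_pow 4)).const_mul (81 / 625)
  have hY := (integrable_of_continuous_haar (hcy.norm.fun_pow 4)).const_mul (256 / 625)
  have hXY := (integrable_of_continuous_haar ((hcx.norm.fun_pow 2).fun_mul (hcy.norm.fun_pow 2))).const_mul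
    (576 / 625)
  rw [integral_const_mul, integral_add (hX.fun_add hY) hXY, integral_add hX hY, integral_const_mul,
    integral_const_mul, integral_const_mul] at hsum
  linarith

theorem sum_norm_sq_unitary_col (U : Matrix.unitaryGroup ι ℂ) (k : ι) :
    ∑ x, ‖(U : Matrix ι ι ℂ) x k‖ ^ 2 = 1 := by
  have h := congrFun (congrFun (Matrix.mem_unitaryGroup_iff'.1 U.2) k) k
  rw [Matrix.star_eq_conjTranspose, Matrix.mul_apply, Matrix.one_apply_eq] at h
  have h2 : ((∑ x, ‖(U : Matrix ι ι ℂ) x k‖ ^ 2 : ℝ) : ℂ) = 1 := by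
    rw [← h]
    push_cast
    refine Finset.sum_congr rfl fun x _ => ?_
    rw [Matrix.conjTranspose_apply, ← Complex.conj_mul']
    rfl
  exact_mod_cast h2

theorem integral_norm_sq_mul_norm_sq {x y : ι} (hxy : x ≠ y) (k : ι) :
    ∫ U : Matrix.unitaryGroup ι ℂ,
        ‖(U : Matrix ι ι ℂ) x k‖ ^ 2 * ‖(U : Matrix ι ι ℂ) y k‖ ^ 2 ∂(haarUnitary ι) =
      1 / ((Fintype.card ι : ℝ) * (Fintype.card ι + 1)) := by
  set a : ι → ℝ := fun z =>
    ∫ U : Matrix.unitaryGroup ι ℂ, ‖(U : Matrix ι ι ℂ) z k‖ ^ 4 ∂(haarUnitary ι) with ha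
  set b : ι → ι → ℝ := fun z w => ∫ U : Matrix.unitaryGroup ι ℂ,
        ‖(U : Matrix ι ι ℂ) z k‖ ^ 2 * ‖(U : Matrix ι ι ℂ) w k‖ ^ 2 ∂(haarUnitary ι) with hb
  have hsymm : ∀ z w, b z w = b w z := fun z w => by simp only [hb, mul_comm]
  have hdiag : ∀ z, b z z = a z := fun z => by
    simp only [hb, ha]
    refine integral_congr_ae (Eventually.of_forall fun U => ?_)
    simp only
    ring
  have hrel : ∀ z w, z ≠ w → a z = a w ∧ b z w = a z / 2 := by
    intro z w hzw
    have h1 : a z = 81 / 625 * a z + 256 / 625 * a w + 576 / 625 * b z w :=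
      integral_norm_pow_four_eq hzw k
    have h2 : a w = 81 / 625 * a w + 256 / 625 * a z + 576 / 625 * b w z :=
      integral_norm_pow_four_eq hzw.symm k
    rw [hsymm w z] at h2
    constructor <;> linarith
  have hall : ∀ z, a z = a x := fun z => by
    by_cases h : z = x
    · rw [h]
    · exact (hrel z x h).1
  have hball : ∀ z w, b z w = a x / 2 + if z = w then a x / 2 else 0 := by
    intro z w
    split_ifs with h
    · rw [h, hdiag, hall]; ring
    · rw [(hrel z w h).2, hall]; ring
  have htot : ∑ z, ∑ w, b z w = 1 := by
    have hI : ∀ z w : ι, Integrable (fun U : Matrix.unitaryGroup ι ℂ =>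
        ‖(U : Matrix ι ι ℂ) z k‖ ^ 2 * ‖(U : Matrix ι ι ℂ) w k‖ ^ 2) (haarUnitary ι) := by
      intro z w
      have hcx := continuous_unitary_entry z k
      have hcy := continuous_unitary_entry w k
      exact integrable_of_continuous_haar ((hcx.norm.fun_pow 2).fun_mul (hcy.norm.fun_pow 2))
    have h : ∑ z, ∑ w, b z w = ∫ U : Matrix.unitaryGroup ι ℂ, ∑ z, ∑ w,
        ‖(U : Matrix ι ι ℂ) z k‖ ^ 2 * ‖(U : Matrix ι ι ℂ) w k‖ ^ 2 ∂(haarUnitary ι) := by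
      rw [integral_finsetSum _ fun z _ => integrable_finsetSum _ fun w _ => hI z w]
      refine Finset.sum_congr rfl fun z _ => ?_
      rw [integral_finsetSum _ fun w _ => hI z w]
    rw [h]
    have : ∀ U : Matrix.unitaryGroup ι ℂ, ∑ z, ∑ w,
        ‖(U : Matrix ι ι ℂ) z k‖ ^ 2 * ‖(U : Matrix ι ι ℂ) w k‖ ^ 2 = 1 := fun U => by
      simp only [← Finset.mul_sum, sum_norm_sq_unitary_col, mul_one]
    simp [this]
  have hx : b x y = a x / 2 := (hrel x y hxy).2
  simp only [hball, Finset.sum_add_distrib, Finset.sum_ite_eq, Finset.mem_univ, if_true,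
    Finset.sum_const, Finset.card_univ, nsmul_eq_mul] at htot
  change b x y = _
  rw [hx]
  have hn : (0 : ℝ) < Fintype.card ι := by exact_mod_cast Fintype.card_pos_iff.2 ⟨x⟩
  rw [eq_div_iff (by positivity)]
  linarith

/-! ### Gaussian moments -/

variable (ι) in
/-- The law of i.i.d. standard Gaussian eigenvalues. -/
def gaussianLaw : Measure (ι → ℝ) := Measure.pi fun _ => ProbabilityTheory.gaussianReal 0 1

instance gaussianLaw_isProbabilityMeasure : IsProbabilityMeasure (gaussianLaw ι) :=
  inferInstanceAs (IsProbabilityMeasure (Measure.pi _))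

theorem memLp_gaussianLaw_eval {ι : Type} [Fintype ι] (k : ι) (p : NNReal) :
    MemLp (fun D : ι → ℝ => D k) p (gaussianLaw ι) :=
  (ProbabilityTheory.memLp_id_gaussianReal (μ := 0) (v := 1) p).comp_measurePreserving
    (measurePreserving_eval (fun _ : ι => ProbabilityTheory.gaussianReal 0 1) k)

theorem integral_gaussianLaw_eval {ι : Type} [Fintype ι] (k : ι) {f : ℝ → ℝ} (hf : Measurable f) :
    ∫ D, f (D k) ∂(gaussianLaw ι) = ∫ x, f x ∂(ProbabilityTheory.gaussianReal 0 1) := by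
  have h := measurePreserving_eval (fun _ : ι => ProbabilityTheory.gaussianReal 0 1) k
  rw [← h.map_eq, integral_map h.measurable.aemeasurable hf.aestronglyMeasurable]
  rfl

theorem integrable_gaussianLaw_abs_pow {ι : Type} [Fintype ι] (k : ι) (m : ℕ) :
    Integrable (fun D : ι → ℝ => |D k| ^ m) (gaussianLaw ι) := by
  have := (memLp_gaussianLaw_eval k m).integrable_norm_pow'
  simpa using this

theorem integrable_gaussianLaw_mul {ι : Type} [Fintype ι] (k l : ι) :
    Integrable (fun D : ι → ℝ => D k * D l) (gaussianLaw ι) :=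
  MemLp.integrable_mul (p := 2) (q := 2) (memLp_gaussianLaw_eval k 2) (memLp_gaussianLaw_eval l 2)

theorem integral_gaussianLaw_mul (k l : ι) :
    ∫ D, D k * D l ∂(gaussianLaw ι) = if k = l then 1 else 0 := by
  have hmean : ∀ k : ι, ∫ D, D k ∂(gaussianLaw ι) = 0 := fun k => by
    exact (integral_gaussianLaw_eval k measurable_id).trans
      ProbabilityTheory.integral_id_gaussianReal
  split_ifs with h
  · subst h
    have h1 := integral_gaussianLaw_eval k (f := fun x => x * x) (by fun_prop)
    rw [h1]
    have h2 := ProbabilityTheory.variance_id_gaussianReal (μ := 0) (v := 1)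
    rw [ProbabilityTheory.variance_of_integral_eq_zero aemeasurable_id
      ProbabilityTheory.integral_id_gaussianReal] at h2
    simpa [sq] using h2
  · have hind := (ProbabilityTheory.iIndepFun_pi (μ := fun _ : ι =>
      ProbabilityTheory.gaussianReal 0 1) (X := fun _ => id) fun _ => aemeasurable_id).indepFun h
    have := hind.integral_mul_eq_mul_integral
      (measurable_pi_apply k).aestronglyMeasurable (measurable_pi_apply l).aestronglyMeasurable
    have h' : ∫ D, D k * D l ∂(gaussianLaw ι) =
      (∫ D, D k ∂(gaussianLaw ι)) * ∫ D, D l ∂(gaussianLaw ι) := this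
    rw [h', hmean, zero_mul]

/-! ### Moments of the interaction -/

theorem interaction_apply (ω : Matrix.unitaryGroup ι ℂ × (ι → ℝ)) (x y : ι) :
    interaction ω x y = ∑ k, (ω.2 k : ℂ) *
      ((ω.1 : Matrix ι ι ℂ) x k * star ((ω.1 : Matrix ι ι ℂ) y k)) := by
  rw [interaction, Matrix.mul_apply]
  refine Finset.sum_congr rfl fun k _ => ?_
  rw [Matrix.mul_diagonal, Matrix.conjTranspose_apply]
  ring

theorem interaction_isHermitian (ω : Matrix.unitaryGroup ι ℂ × (ι → ℝ)) :
    (interaction ω).IsHermitian := by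
  rw [interaction, Matrix.IsHermitian, Matrix.conjTranspose_mul, Matrix.conjTranspose_mul,
    Matrix.conjTranspose_conjTranspose, Matrix.diagonal_conjTranspose, Matrix.mul_assoc]
  congr 3
  ext i
  simp

theorem continuous_interaction :
    Continuous (interaction : Matrix.unitaryGroup ι ℂ × (ι → ℝ) → Matrix ι ι ℂ) := by
  unfold interaction
  have h : Continuous fun ω : Matrix.unitaryGroup ι ℂ × (ι → ℝ) => (ω.1 : Matrix ι ι ℂ) :=
    continuous_subtype_val.comp continuous_fst
  refine (h.matrix_mul (Continuous.matrix_diagonal ?_)).matrix_mul h.matrix_conjTranspose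
  fun_prop

theorem norm_sq_sum_mul {ι : Type} [Fintype ι] (d : ι → ℝ) (c : ι → ℂ) :
    ‖∑ k, (d k : ℂ) * c k‖ ^ 2 = ∑ k, ∑ l, (c k * star (c l)).re * (d k * d l) := by
  have h : ((‖∑ k, (d k : ℂ) * c k‖ ^ 2 : ℝ) : ℂ) =
      ∑ k, ∑ l, (c k * star (c l)) * (d k * d l : ℝ) := by
    push_cast
    rw [← Complex.mul_conj', map_sum, Finset.sum_mul_sum]
    refine Finset.sum_congr rfl fun k _ => Finset.sum_congr rfl fun l _ => ?_
    rw [map_mul, Complex.conj_ofReal]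
    change _ = c k * (starRingEnd ℂ) (c l) * _
    ring
  have h2 := congrArg Complex.re h
  rw [Complex.ofReal_re] at h2
  rw [h2, Complex.re_sum]
  refine Finset.sum_congr rfl fun k _ => ?_
  rw [Complex.re_sum]
  refine Finset.sum_congr rfl fun l _ => ?_
  rw [Complex.re_mul_ofReal]

theorem integrable_interaction_term (x y k l : ι) :
    Integrable (fun ω : Matrix.unitaryGroup ι ℂ × (ι → ℝ) =>
      (((ω.1 : Matrix ι ι ℂ) x k * star ((ω.1 : Matrix ι ι ℂ) y k)) *
        star ((ω.1 : Matrix ι ι ℂ) x l * star ((ω.1 : Matrix ι ι ℂ) y l))).re *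
        (ω.2 k * ω.2 l)) (interactionLaw ι) := by
  have h1 := continuous_unitary_entry x k
  have h2 := continuous_unitary_entry y k
  have h3 := continuous_unitary_entry x l
  have h4 := continuous_unitary_entry y l
  exact Integrable.mul_prod (ν := gaussianLaw ι)
    (f := fun U : Matrix.unitaryGroup ι ℂ =>
      (((U : Matrix ι ι ℂ) x k * star ((U : Matrix ι ι ℂ) y k)) *
        star ((U : Matrix ι ι ℂ) x l * star ((U : Matrix ι ι ℂ) y l))).re)
    (integrable_of_continuous_haar
      (Complex.continuous_re.comp ((h1.mul h2.star).mul (h3.mul h4.star).star)))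
    (integrable_gaussianLaw_mul k l)

theorem norm_sq_interaction_apply (ω : Matrix.unitaryGroup ι ℂ × (ι → ℝ)) (x y : ι) :
    ‖interaction ω x y‖ ^ 2 = ∑ k, ∑ l,
      (((ω.1 : Matrix ι ι ℂ) x k * star ((ω.1 : Matrix ι ι ℂ) y k)) *
        star ((ω.1 : Matrix ι ι ℂ) x l * star ((ω.1 : Matrix ι ι ℂ) y l))).re *
        (ω.2 k * ω.2 l) := by
  rw [interaction_apply, norm_sq_sum_mul]

theorem integrable_norm_sq_interaction (x y : ι) :
    Integrable (fun ω => ‖interaction ω x y‖ ^ 2) (interactionLaw ι) := by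
  simp only [norm_sq_interaction_apply]
  exact integrable_finsetSum _ fun k _ => integrable_finsetSum _ fun l _ =>
    integrable_interaction_term x y k l

theorem integral_norm_sq_interaction {x y : ι} (hxy : x ≠ y) :
    ∫ ω, ‖interaction ω x y‖ ^ 2 ∂(interactionLaw ι) = 1 / ((Fintype.card ι : ℝ) + 1) := by
  simp only [norm_sq_interaction_apply]
  rw [integral_finsetSum _ fun k _ => integrable_finsetSum _ fun l _ =>
    integrable_interaction_term x y k l]
  have hterm : ∀ k, ∫ ω : Matrix.unitaryGroup ι ℂ × (ι → ℝ), ∑ l,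
      (((ω.1 : Matrix ι ι ℂ) x k * star ((ω.1 : Matrix ι ι ℂ) y k)) *
        star ((ω.1 : Matrix ι ι ℂ) x l * star ((ω.1 : Matrix ι ι ℂ) y l))).re *
        (ω.2 k * ω.2 l) ∂(interactionLaw ι) =
        1 / ((Fintype.card ι : ℝ) * (Fintype.card ι + 1)) := by
    intro k
    rw [integral_finsetSum _ fun l _ => integrable_interaction_term x y k l]
    have hl : ∀ l, ∫ ω : Matrix.unitaryGroup ι ℂ × (ι → ℝ),
      (((ω.1 : Matrix ι ι ℂ) x k * star ((ω.1 : Matrix ι ι ℂ) y k)) *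
        star ((ω.1 : Matrix ι ι ℂ) x l * star ((ω.1 : Matrix ι ι ℂ) y l))).re *
        (ω.2 k * ω.2 l) ∂(interactionLaw ι) =
        (∫ U : Matrix.unitaryGroup ι ℂ, (((U : Matrix ι ι ℂ) x k * star ((U : Matrix ι ι ℂ) y k)) *
        star ((U : Matrix ι ι ℂ) x l * star ((U : Matrix ι ι ℂ) y l))).re ∂(haarUnitary ι)) *
        (if k = l then 1 else 0) := by
      intro l
      rw [← integral_gaussianLaw_mul k l]
      exact integral_prod_mul (μ := haarUnitary ι) (ν := gaussianLaw ι)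
        (fun U : Matrix.unitaryGroup ι ℂ => (((U : Matrix ι ι ℂ) x k *
          star ((U : Matrix ι ι ℂ) y k)) *
          star ((U : Matrix ι ι ℂ) x l * star ((U : Matrix ι ι ℂ) y l))).re)
        (fun D => D k * D l)
    simp only [hl, mul_ite, mul_one, mul_zero, Finset.sum_ite_eq, Finset.mem_univ, if_true]
    rw [← integral_norm_sq_mul_norm_sq hxy k]
    refine integral_congr_ae (Eventually.of_forall fun U => ?_)
    simp only
    change ((((U : Matrix ι ι ℂ) x k * star ((U : Matrix ι ι ℂ) y k)) *
        (starRingEnd ℂ) ((U : Matrix ι ι ℂ) x k * star ((U : Matrix ι ι ℂ) y k))).re) = _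
    rw [Complex.mul_conj', norm_mul, norm_star, ← Complex.ofReal_pow, Complex.ofReal_re]
    exact mul_pow _ _ _
  simp only [hterm]
  have hn : (0 : ℝ) < Fintype.card ι := by exact_mod_cast Fintype.card_pos_iff.2 ⟨x⟩
  rw [Finset.sum_const, Finset.card_univ, nsmul_eq_mul]
  field_simp

open scoped Matrix.Norms.L2Operator in
theorem norm_interaction_pow_le [Nonempty ι] (ω : Matrix.unitaryGroup ι ℂ × (ι → ℝ)) (m : ℕ) :
    ‖interaction ω‖ ^ m ≤ ∑ k, |ω.2 k| ^ m := by
  obtain ⟨k, hk⟩ := Finite.exists_max fun i => |ω.2 i|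
  have h : ‖interaction ω‖ ≤ |ω.2 k| := by
    have hU : (ω.1 : Matrix ι ι ℂ)ᴴ ∈ unitary (Matrix ι ι ℂ) := Unitary.star_mem ω.1.2
    rw [interaction, CStarRing.norm_mul_mem_unitary _ hU, CStarRing.norm_mem_unitary_mul _ ω.1.2,
      Matrix.l2_opNorm_diagonal]
    refine (pi_norm_le_iff_of_nonneg (abs_nonneg _)).2 fun i => ?_
    rw [Complex.norm_real]
    exact hk i
  calc ‖interaction ω‖ ^ m ≤ |ω.2 k| ^ m := by gcongr
    _ ≤ _ := Finset.single_le_sum (f := fun k => |ω.2 k| ^ m) (fun _ _ => by positivity)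
      (Finset.mem_univ k)

/-- The sum of the third and fourth absolute moments of a standard Gaussian. -/
def gaussianMoment : ℝ := ∫ x, (|x| ^ 3 + |x| ^ 4) ∂(ProbabilityTheory.gaussianReal 0 1)

theorem gaussianMoment_nonneg : 0 ≤ gaussianMoment := integral_nonneg fun x => by positivity

theorem integrable_interactionLaw_snd {f : (ι → ℝ) → ℝ} (hf : Integrable f (gaussianLaw ι)) :
    Integrable (fun ω : Matrix.unitaryGroup ι ℂ × (ι → ℝ) => f ω.2) (interactionLaw ι) :=
  hf.comp_snd (haarUnitary ι)

theorem integral_interactionLaw_snd (f : (ι → ℝ) → ℝ) :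
    ∫ ω : Matrix.unitaryGroup ι ℂ × (ι → ℝ), f ω.2 ∂(interactionLaw ι) =
      ∫ D, f D ∂(gaussianLaw ι) := by
  have := integral_prod_mul (μ := haarUnitary ι) (ν := gaussianLaw ι) (fun _ => (1 : ℝ)) f
  simp only [one_mul, integral_const, probReal_univ, one_smul] at this
  exact this

theorem integrable_norm_sq_propagator (e : ι → ℝ) (α t : ℝ) (x y : ι) :
    Integrable (fun ω => ‖propagator e α t (interaction ω) x y‖ ^ 2) (interactionLaw ι) := by
  have hc : Continuous fun ω : Matrix.unitaryGroup ι ℂ × (ι → ℝ) =>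
      ‖propagator e α t (interaction ω) x y‖ ^ 2 :=
    ((((continuous_apply_apply x y).comp (continuous_propagator e α t)).comp
      continuous_interaction).norm).pow 2
  refine Integrable.of_bound hc.aestronglyMeasurable 1 (Eventually.of_forall fun ω => ?_)
  rw [Real.norm_of_nonneg (by positivity),
    ← sum_norm_sq_propagator_col e α t (interaction_isHermitian ω) y]
  exact Finset.single_le_sum (f := fun x => ‖propagator e α t (interaction ω) x y‖ ^ 2)
    (fun _ _ => by positivity) (Finset.mem_univ x)

/-- Averaged transition probabilities agree with the golden rule up to third order. -/
theorem sum_abs_integral_propagator_sub_le (e : ι → ℝ) {α t : ℝ} (hα : 0 ≤ α) (ht : 0 ≤ t)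
    (y : ι) :
    ∑ x ∈ Finset.univ.erase y,
        |∫ ω, ‖propagator e α t (interaction ω) x y‖ ^ 2 ∂(interactionLaw ι) -
          (α * t) ^ 2 * Real.sinc ((e x - e y) * t / 2) ^ 2 / ((Fintype.card ι : ℝ) + 1)| ≤
      Fintype.card ι * gaussianMoment * (2 * (α * t) ^ 3 + (α * t) ^ 4) := by
  have : Nonempty ι := ⟨y⟩
  set f : ι → Matrix.unitaryGroup ι ℂ × (ι → ℝ) → ℝ := fun x ω =>
    ‖propagator e α t (interaction ω) x y‖ ^ 2 -
      (α * t) ^ 2 * Real.sinc ((e x - e y) * t / 2) ^ 2 * ‖interaction ω x y‖ ^ 2 with hf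
  have hfi : ∀ x, Integrable (f x) (interactionLaw ι) := fun x =>
    (integrable_norm_sq_propagator e α t x y).sub
      ((integrable_norm_sq_interaction x y).const_mul _)
  have h1 : ∀ x ∈ Finset.univ.erase y,
      |∫ ω, ‖propagator e α t (interaction ω) x y‖ ^ 2 ∂(interactionLaw ι) -
          (α * t) ^ 2 * Real.sinc ((e x - e y) * t / 2) ^ 2 / ((Fintype.card ι : ℝ) + 1)| ≤
        ∫ ω, |f x ω| ∂(interactionLaw ι) := by
    intro x hx
    refine le_trans (le_of_eq ?_) (abs_integral_le_integral_abs)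
    rw [hf]
    simp only
    rw [integral_sub (integrable_norm_sq_propagator e α t x y)
      ((integrable_norm_sq_interaction x y).const_mul _), integral_const_mul,
      integral_norm_sq_interaction (Finset.ne_of_mem_erase hx), mul_one_div]
  set c : ℝ := 2 * (α * t) ^ 3 + (α * t) ^ 4 with hc
  have hat : 0 ≤ α * t := mul_nonneg hα ht
  set g : (ι → ℝ) → ℝ := fun D => c * ∑ k, (|D k| ^ 3 + |D k| ^ 4) with hg
  have hgi : Integrable g (gaussianLaw ι) :=
    (integrable_finsetSum _ fun k _ => (integrable_gaussianLaw_abs_pow k 3).add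
      (integrable_gaussianLaw_abs_pow k 4)).const_mul _
  have hgI : ∫ D, g D ∂(gaussianLaw ι) = c * (Fintype.card ι * gaussianMoment) := by
    rw [hg]
    simp only
    rw [integral_const_mul, integral_finsetSum _ fun k _ =>
      (integrable_gaussianLaw_abs_pow k 3).fun_add (integrable_gaussianLaw_abs_pow k 4)]
    have : ∀ k : ι, ∫ D : ι → ℝ, (|D k| ^ 3 + |D k| ^ 4) ∂(gaussianLaw ι) = gaussianMoment :=
      fun k => integral_gaussianLaw_eval k (f := fun x => |x| ^ 3 + |x| ^ 4) (by fun_prop)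
    simp only [this]
    rw [Finset.sum_const, Finset.card_univ, nsmul_eq_mul]
  have hpt : ∀ ω : Matrix.unitaryGroup ι ℂ × (ι → ℝ),
      ∑ x ∈ Finset.univ.erase y, |f x ω| ≤ g ω.2 := by
    intro ω
    have hd := sum_abs_norm_sq_propagator_sub_le e hα ht (interaction_isHermitian ω) y
    refine hd.trans ?_
    have h3 := norm_interaction_pow_le ω 3
    have h4 := norm_interaction_pow_le ω 4
    rw [hg]
    simp only
    rw [Finset.sum_add_distrib, mul_pow (α * t), mul_pow (α * t), hc]
    have hs3 : 0 ≤ ∑ k, |ω.2 k| ^ 3 := Finset.sum_nonneg fun _ _ => by positivity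
    have hs4 : 0 ≤ ∑ k, |ω.2 k| ^ 4 := Finset.sum_nonneg fun _ _ => by positivity
    have e3 := mul_le_mul_of_nonneg_left h3 (by positivity : 0 ≤ 2 * (α * t) ^ 3)
    have e4 := mul_le_mul_of_nonneg_left h4 (by positivity : 0 ≤ (α * t) ^ 4)
    have p1 : 0 ≤ 2 * (α * t) ^ 3 * ∑ k, |ω.2 k| ^ 4 := by positivity
    have p2 : 0 ≤ (α * t) ^ 4 * ∑ k, |ω.2 k| ^ 3 := by positivity
    linarith
  calc _ ≤ ∑ x ∈ Finset.univ.erase y, ∫ ω, |f x ω| ∂(interactionLaw ι) := Finset.sum_le_sum h1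
    _ = ∫ ω, ∑ x ∈ Finset.univ.erase y, |f x ω| ∂(interactionLaw ι) :=
        (integral_finsetSum _ fun x _ => (hfi x).abs).symm
    _ ≤ ∫ ω : Matrix.unitaryGroup ι ℂ × (ι → ℝ), g ω.2 ∂(interactionLaw ι) :=
        integral_mono (integrable_finsetSum _ fun x _ => (hfi x).abs)
          (integrable_interactionLaw_snd hgi) hpt
    _ = _ := by rw [integral_interactionLaw_snd, hgI]; ring

end Moments

/-! ## Reduction of the channel to a classical Markov chain -/

section ChannelReduction

variable {S : Type} [Fintype S] [DecidableEq S]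

/-- Eigenvalues of the total free Hamiltonian. -/
def totalEnergy {S : Type} (E : S → ℝ) (γ : ℝ) (x : S × Fin 2) : ℝ := E x.1 + envEnergy γ x.2

theorem freeHamiltonian_eq_diagOp {S : Type} [DecidableEq S] (E : S → ℝ) (γ : ℝ) :
    freeHamiltonian E γ = diagOp (totalEnergy E γ) := by
  rw [freeHamiltonian, diagOp, diagOp, diagOp, ← Matrix.diagonal_one, ← Matrix.diagonal_one]
  ext ⟨i, a⟩ ⟨j, b⟩
  by_cases hi : i = j <;> by_cases ha : a = b <;>
    simp [Matrix.kroneckerMap_apply, totalEnergy, hi, ha]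

theorem kronecker_diagOp_diagOp {S : Type} [DecidableEq S] (p : S → ℝ) (q : Fin 2 → ℝ) :
    Matrix.kronecker (diagOp p) (diagOp q) = diagOp fun x : S × Fin 2 => p x.1 * q x.2 := by
  ext ⟨i, a⟩ ⟨j, b⟩
  by_cases hi : i = j <;> by_cases ha : a = b <;>
    simp [Matrix.kroneckerMap_apply, diagOp, hi, ha]

theorem fixedEvolution_eq (E : S → ℝ) (γ α t : ℝ) {G : Matrix (S × Fin 2) (S × Fin 2) ℂ}
    (hG : G.IsHermitian) (σ : Matrix (S × Fin 2) (S × Fin 2) ℂ) :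
    fixedEvolution E γ α t G σ =
      propagator (totalEnergy E γ) α t G * σ * (propagator (totalEnergy E γ) α t G)ᴴ := by
  rw [fixedEvolution, freeHamiltonian_eq_diagOp, exp_neg_I_smul (isHermitian_add_smul _ _ hG)]
  rfl

theorem continuous_fixedEvolution (E : S → ℝ) (γ α t : ℝ)
    (σ : Matrix (S × Fin 2) (S × Fin 2) ℂ) (x y : S × Fin 2) :
    Continuous fun ω => fixedEvolution E γ α t (interaction ω) σ x y := by
  simp only [fixedEvolution_eq E γ α t (interaction_isHermitian _) σ]
  have h := (continuous_propagator (totalEnergy E γ) α t).comp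
    (continuous_interaction (ι := S × Fin 2))
  exact (continuous_apply_apply x y).comp
    ((h.matrix_mul continuous_const).matrix_mul h.matrix_conjTranspose)

theorem integrable_fixedEvolution (E : S → ℝ) (γ α t : ℝ)
    (σ : Matrix (S × Fin 2) (S × Fin 2) ℂ) (x y : S × Fin 2) :
    Integrable (fun ω => fixedEvolution E γ α t (interaction ω) σ x y)
      (interactionLaw (S × Fin 2)) := by
  refine Integrable.of_bound (continuous_fixedEvolution E γ α t σ x y).aestronglyMeasurable
    (∑ l, ∑ k, ‖σ k l‖) (Eventually.of_forall fun ω => ?_)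
  have hu := propagator_mem_unitary (totalEnergy E γ) α t (interaction_isHermitian ω)
  rw [fixedEvolution_eq E γ α t (interaction_isHermitian ω) σ, Matrix.mul_apply]
  refine (norm_sum_le _ _).trans (Finset.sum_le_sum fun l _ => ?_)
  rw [norm_mul, Matrix.conjTranspose_apply, norm_star, Matrix.mul_apply]
  refine (mul_le_of_le_one_right (norm_nonneg _) (entry_norm_bound_of_unitary hu y l)).trans ?_
  refine (norm_sum_le _ _).trans (Finset.sum_le_sum fun k _ => ?_)
  rw [norm_mul]
  exact mul_le_of_le_one_left (norm_nonneg _) (entry_norm_bound_of_unitary hu x k)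

/-- The channel depends linearly on the populations of the environment qubit. -/
theorem channel_eq_add (E : S → ℝ) (γ : ℝ) (q : Fin 2 → ℝ) (α t : ℝ) (ρ : Matrix S S ℂ) :
    channel E γ q α t ρ = (q 0 : ℂ) • channel E γ ![1, 0] α t ρ +
      (q 1 : ℂ) • channel E γ ![0, 1] α t ρ := by
  have hσ : Matrix.kronecker ρ (diagOp q) = (q 0 : ℂ) • Matrix.kronecker ρ (diagOp ![1, 0]) +
      (q 1 : ℂ) • Matrix.kronecker ρ (diagOp ![0, 1]) := by
    ext ⟨i, a⟩ ⟨j, b⟩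
    fin_cases a <;> fin_cases b <;>
      simp [Matrix.kroneckerMap_apply, diagOp, mul_comm]
  have hent : ∀ x y, ∫ ω, fixedEvolution E γ α t (interaction ω)
      (Matrix.kronecker ρ (diagOp q)) x y ∂(interactionLaw (S × Fin 2)) =
      (q 0 : ℂ) * ∫ ω, fixedEvolution E γ α t (interaction ω)
        (Matrix.kronecker ρ (diagOp ![1, 0])) x y ∂(interactionLaw (S × Fin 2)) +
      (q 1 : ℂ) * ∫ ω, fixedEvolution E γ α t (interaction ω)
        (Matrix.kronecker ρ (diagOp ![0, 1])) x y ∂(interactionLaw (S × Fin 2)) := by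
    intro x y
    rw [← integral_const_mul, ← integral_const_mul, ← integral_add
      ((integrable_fixedEvolution E γ α t _ x y).const_mul _)
      ((integrable_fixedEvolution E γ α t _ x y).const_mul _)]
    refine integral_congr_ae (Eventually.of_forall fun ω => ?_)
    simp only [hσ, fixedEvolution, Matrix.mul_add, Matrix.add_mul, Matrix.mul_smul,
      Matrix.smul_mul, Matrix.add_apply, Matrix.smul_apply, smul_eq_mul]
  ext i j
  simp only [channel, traceEnv, Matrix.of_apply, Matrix.add_apply, Matrix.smul_apply, hent,
    smul_eq_mul, Finset.sum_add_distrib, Finset.mul_sum]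

theorem tendsto_channel (E : S → ℝ) (γ : ℝ) {q : ℝ → Fin 2 → ℝ} {q' : Fin 2 → ℝ} {l : Filter ℝ}
    (hq : Tendsto q l (𝓝 q')) (α t : ℝ) (ρ : Matrix S S ℂ) :
    Tendsto (fun β => channel E γ (q β) α t ρ) l (𝓝 (channel E γ q' α t ρ)) := by
  simp only [channel_eq_add E γ (q _), channel_eq_add E γ q']
  have h : ∀ a, Tendsto (fun β => (q β a : ℂ)) l (𝓝 (q' a : ℂ)) := fun a =>
    (Complex.continuous_ofReal.tendsto _).comp ((continuous_apply a).tendsto _ |>.comp hq)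
  exact ((h 0).smul_const _).add ((h 1).smul_const _)

/-! ### Diagonal states stay diagonal -/

/-- The sign flip of one system level. -/
def signFlip (i : S) : Matrix (S × Fin 2) (S × Fin 2) ℂ :=
  Matrix.diagonal fun x => if x.1 = i then -1 else 1

theorem signFlip_mul_self (i : S) : signFlip i * signFlip i = 1 := by
  rw [signFlip, Matrix.diagonal_mul_diagonal, ← Matrix.diagonal_one]
  congr 1
  ext x
  split_ifs <;> simp

theorem signFlip_conjTranspose {S : Type} [DecidableEq S] (i : S) :
    (signFlip i)ᴴ = signFlip i := by
  rw [signFlip, Matrix.diagonal_conjTranspose]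
  congr 1
  ext x
  simp only [Pi.star_apply]
  split_ifs <;> simp

theorem signFlip_mem (i : S) : signFlip i ∈ Matrix.unitaryGroup (S × Fin 2) ℂ := by
  rw [Matrix.mem_unitaryGroup_iff, Matrix.star_eq_conjTranspose, signFlip_conjTranspose,
    signFlip_mul_self]

theorem signFlip_mul_diagOp_mul (i : S) (v : S × Fin 2 → ℝ) :
    signFlip i * diagOp v * signFlip i = diagOp v := by
  rw [signFlip, diagOp, Matrix.diagonal_mul_diagonal, Matrix.diagonal_mul_diagonal]
  congr 1
  ext x
  split_ifs <;> simp

theorem propagator_signFlip (i : S) (e : S × Fin 2 → ℝ) (α t : ℝ)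
    (G : Matrix (S × Fin 2) (S × Fin 2) ℂ) :
    propagator e α t (signFlip i * G * signFlip i) =
      signFlip i * propagator e α t G * signFlip i := by
  have hinv : (signFlip i)⁻¹ = signFlip i := Matrix.inv_eq_left_inv (signFlip_mul_self i)
  have hunit : IsUnit (signFlip i) := ⟨⟨_, _, signFlip_mul_self i, signFlip_mul_self i⟩, rfl⟩
  have h := Matrix.exp_conj (signFlip i)
    ((Complex.I * (t : ℂ)) • (diagOp e + (α : ℂ) • G)) hunit
  rw [hinv] at h
  rw [propagator, propagator, ← h]
  congr 1
  rw [Matrix.mul_smul, Matrix.smul_mul, Matrix.mul_add, Matrix.add_mul, signFlip_mul_diagOp_mul,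
    Matrix.mul_smul, Matrix.smul_mul]

theorem integral_interactionLaw_mul_left {ι : Type} [Fintype ι] [DecidableEq ι]
    (V : Matrix.unitaryGroup ι ℂ) {f : Matrix.unitaryGroup ι ℂ × (ι → ℝ) → ℂ}
    (hf : Continuous f) :
    ∫ ω, f (V * ω.1, ω.2) ∂(interactionLaw ι) = ∫ ω, f ω ∂(interactionLaw ι) := by
  have h : MeasurePreserving (fun ω : Matrix.unitaryGroup ι ℂ × (ι → ℝ) => (V * ω.1, ω.2))
      (interactionLaw ι) (interactionLaw ι) :=
    (measurePreserving_mul_left (haarUnitary ι) V).prod (MeasurePreserving.id _)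
  nth_rewrite 2 [← h.map_eq]
  rw [integral_map h.measurable.aemeasurable hf.aestronglyMeasurable]

theorem interaction_mul_left {ι : Type} [Fintype ι] [DecidableEq ι]
    (V : Matrix.unitaryGroup ι ℂ) (ω : Matrix.unitaryGroup ι ℂ × (ι → ℝ)) :
    interaction (V * ω.1, ω.2) = (V : Matrix ι ι ℂ) * interaction ω * (V : Matrix ι ι ℂ)ᴴ := by
  simp only [interaction, Submonoid.coe_mul, Matrix.conjTranspose_mul, Matrix.mul_assoc]

theorem integral_fixedEvolution_eq_zero (E : S → ℝ) (γ α t : ℝ) (v : S × Fin 2 → ℝ)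
    {x y : S × Fin 2} (hxy : x.1 ≠ y.1) :
    ∫ ω, fixedEvolution E γ α t (interaction ω) (diagOp v) x y
      ∂(interactionLaw (S × Fin 2)) = 0 := by
  have h := integral_interactionLaw_mul_left ⟨signFlip x.1, signFlip_mem x.1⟩
    (continuous_fixedEvolution E γ α t (diagOp v) x y)
  have hpt : ∀ ω : Matrix.unitaryGroup (S × Fin 2) ℂ × (S × Fin 2 → ℝ),
      fixedEvolution E γ α t (interaction
        ((⟨signFlip x.1, signFlip_mem x.1⟩ : Matrix.unitaryGroup (S × Fin 2) ℂ) * ω.1, ω.2))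
          (diagOp v) x y = -fixedEvolution E γ α t (interaction ω) (diagOp v) x y := by
    intro ω
    rw [fixedEvolution_eq E γ α t (interaction_isHermitian _),
      fixedEvolution_eq E γ α t (interaction_isHermitian _), interaction_mul_left,
      signFlip_conjTranspose, propagator_signFlip]
    set U := propagator (totalEnergy E γ) α t (interaction ω)
    have e1 : signFlip x.1 * U * signFlip x.1 * diagOp v * (signFlip x.1 * U * signFlip x.1)ᴴ =
        signFlip x.1 * (U * diagOp v * Uᴴ) * signFlip x.1 := by
      rw [Matrix.conjTranspose_mul, Matrix.conjTranspose_mul, signFlip_conjTranspose]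
      calc _ = signFlip x.1 * U * (signFlip x.1 * diagOp v * signFlip x.1) * Uᴴ *
            signFlip x.1 := by simp only [Matrix.mul_assoc]
        _ = _ := by rw [signFlip_mul_diagOp_mul]; simp only [Matrix.mul_assoc]
    rw [e1]
    generalize U * diagOp v * Uᴴ = M
    rw [signFlip, Matrix.mul_diagonal, Matrix.diagonal_mul, if_pos rfl, if_neg (Ne.symm hxy)]
    ring
  simp only [hpt] at h
  rw [integral_neg] at h
  exact self_eq_neg.1 h.symm

/-- The level-to-level transition probabilities of the channel (row: target, column: source). -/
def levelTransition (E : S → ℝ) (γ : ℝ) (q : Fin 2 → ℝ) (α t : ℝ) : Matrix S S ℝ :=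
  Matrix.of fun j i => ∑ a, q a * ∑ b,
    ∫ ω, ‖propagator (totalEnergy E γ) α t (interaction ω) (j, b) (i, a)‖ ^ 2
      ∂(interactionLaw (S × Fin 2))

theorem mul_diagOp_mul_conjTranspose_apply {κ : Type} [Fintype κ] [DecidableEq κ]
    (U : Matrix κ κ ℂ) (v : κ → ℝ) (x : κ) :
    (U * diagOp v * Uᴴ) x x = ((∑ k, v k * ‖U x k‖ ^ 2 : ℝ) : ℂ) := by
  rw [Matrix.mul_apply]
  push_cast
  refine Finset.sum_congr rfl fun k _ => ?_
  rw [diagOp, Matrix.mul_diagonal, Matrix.conjTranspose_apply, ← Complex.mul_conj']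
  change _ = (v k : ℂ) * (U x k * star (U x k))
  ring

theorem channel_diagOp (E : S → ℝ) (γ : ℝ) (q : Fin 2 → ℝ) (α t : ℝ) (p : S → ℝ) :
    channel E γ q α t (diagOp p) = diagOp (levelTransition E γ q α t *ᵥ p) := by
  rw [channel, kronecker_diagOp_diagOp]
  ext i j
  rw [traceEnv, Matrix.of_apply]
  simp only [Matrix.of_apply]
  by_cases hij : i = j
  · subst hij
    have hI : ∀ b, ∫ ω, fixedEvolution E γ α t (interaction ω)
        (diagOp fun x : S × Fin 2 => p x.1 * q x.2) (i, b) (i, b)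
          ∂(interactionLaw (S × Fin 2)) =
        ((∑ k, ∑ a, (p k * q a) * ∫ ω, ‖propagator (totalEnergy E γ) α t (interaction ω)
          (i, b) (k, a)‖ ^ 2 ∂(interactionLaw (S × Fin 2)) : ℝ) : ℂ) := by
      intro b
      simp only [fixedEvolution_eq E γ α t (interaction_isHermitian _),
        mul_diagOp_mul_conjTranspose_apply]
      rw [integral_complex_ofReal, integral_finsetSum _ fun x _ =>
        (integrable_norm_sq_propagator _ α t _ x).const_mul _, Fintype.sum_prod_type]
      simp only [integral_const_mul]
    have h2 : (levelTransition E γ q α t *ᵥ p) i = ∑ k, levelTransition E γ q α t i k * p k := rfl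
    simp only [hI]
    have h3 : diagOp (levelTransition E γ q α t *ᵥ p) i i =
        (((levelTransition E γ q α t *ᵥ p) i : ℝ) : ℂ) := diagonal_apply_eq _ _
    rw [h3, h2, ← Complex.ofReal_sum]
    congr 1
    rw [Finset.sum_comm]
    refine Finset.sum_congr rfl fun k _ => ?_
    rw [levelTransition, Matrix.of_apply, Finset.sum_comm, Finset.sum_mul]
    refine Finset.sum_congr rfl fun a _ => ?_
    rw [← Finset.mul_sum]
    ring
  · have h3 : diagOp (levelTransition E γ q α t *ᵥ p) i j = 0 := diagonal_apply_ne _ hij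
    rw [h3]
    exact Finset.sum_eq_zero fun a _ =>
      integral_fixedEvolution_eq_zero E γ α t _ (x := (i, a)) (y := (j, a)) hij

theorem levelTransition_mem_colStochastic (E : S → ℝ) (γ : ℝ) {q : Fin 2 → ℝ} (α t : ℝ)
    (h0 : ∀ a, 0 ≤ q a) (hq : q 0 + q 1 = 1) :
    levelTransition E γ q α t ∈ Matrix.colStochastic ℝ S := by
  rw [Matrix.mem_colStochastic_iff_sum]
  refine ⟨fun j i => ?_, fun i => ?_⟩
  · rw [levelTransition, Matrix.of_apply]
    exact Finset.sum_nonneg fun a _ => mul_nonneg (h0 a) (Finset.sum_nonneg fun b _ =>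
      integral_nonneg fun ω => by positivity)
  · simp only [levelTransition, Matrix.of_apply]
    rw [Finset.sum_comm]
    simp only [← Finset.mul_sum]
    have h : ∀ a, ∑ j, ∑ b, ∫ ω, ‖propagator (totalEnergy E γ) α t (interaction ω)
        (j, b) (i, a)‖ ^ 2 ∂(interactionLaw (S × Fin 2)) = 1 := by
      intro a
      rw [← Fintype.sum_prod_type (f := fun x : S × Fin 2 =>
        ∫ ω, ‖propagator (totalEnergy E γ) α t (interaction ω) x (i, a)‖ ^ 2
          ∂(interactionLaw (S × Fin 2))), ← integral_finsetSum _ fun x _ =>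
        integrable_norm_sq_propagator _ α t x _]
      simp only [sum_norm_sq_propagator_col _ α t (interaction_isHermitian _)]
      simp
    rw [Fin.sum_univ_two, h, h, mul_one, mul_one, hq]

theorem iterate_channel_diagOp (E : S → ℝ) (γ : ℝ) (q : Fin 2 → ℝ) (α t : ℝ) (p : S → ℝ) (L : ℕ) :
    (channel E γ q α t)^[L] (diagOp p) = diagOp (levelTransition E γ q α t ^ L *ᵥ p) := by
  induction L with
  | zero => simp
  | succ L ih => rw [Function.iterate_succ_apply', ih, channel_diagOp, pow_succ',
      Matrix.mulVec_mulVec]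

/-! ### Trace norm and densities -/

theorem traceNorm_diagOp (v : S → ℝ) : traceNorm (diagOp v) = ∑ i, |v i| := by
  have hA : (diagOp v)ᴴ * diagOp v = Matrix.diagonal fun i => ((v i ^ 2 : ℝ) : ℂ) := by
    rw [diagOp_isHermitian v, diagOp, Matrix.diagonal_mul_diagonal]
    congr 1
    ext i
    push_cast
    ring
  have h := (Matrix.isHermitian_conjTranspose_mul_self (diagOp v)).roots_charpoly_eq_eigenvalues
  have hc : ((diagOp v)ᴴ * diagOp v).charpoly =
      ∏ i, (Polynomial.X - Polynomial.C ((v i ^ 2 : ℝ) : ℂ)) := by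
    rw [hA, Matrix.charpoly_diagonal]
  rw [hc, Polynomial.roots_prod _ _
    (Finset.prod_ne_zero_iff.2 fun _ _ => Polynomial.X_sub_C_ne_zero _)] at h
  simp only [Polynomial.roots_X_sub_C, Multiset.bind_singleton] at h
  have h2 := congrArg (fun m : Multiset ℂ => (m.map fun z => Real.sqrt z.re).sum) h
  simp only [Multiset.map_map, Function.comp_def] at h2
  have h3 : ∑ i, Real.sqrt (((v i ^ 2 : ℝ) : ℂ)).re = traceNorm (diagOp v) := h2
  rw [← h3]
  refine Finset.sum_congr rfl fun i _ => ?_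
  rw [Complex.ofReal_re, Real.sqrt_sq_eq_abs]

theorem exists_diagOp_eq_of_commute {E : S → ℝ} (hE : Function.Injective E) {ρ : Matrix S S ℂ}
    (hρ : IsDensity ρ) (hc : Commute ρ (diagOp E)) :
    ∃ p : S → ℝ, ρ = diagOp p ∧ (∀ i, 0 ≤ p i) ∧ ∑ i, p i = 1 := by
  have hd : ∀ i, ρ i i = ((ρ i i).re : ℂ) := fun i =>
    (Complex.conj_eq_iff_re.1 (hρ.1.isHermitian.apply i i)).symm
  refine ⟨fun i => (ρ i i).re, ?_, fun i => ?_, ?_⟩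
  · ext i j
    by_cases hij : i = j
    · subst hij
      rw [diagOp, Matrix.diagonal_apply_eq]
      exact hd i
    · rw [diagOp, Matrix.diagonal_apply_ne _ hij]
      have h := congrFun (congrFun hc.eq i) j
      rw [diagOp, Matrix.mul_diagonal, Matrix.diagonal_mul] at h
      have h2 : ρ i j * ((E j : ℂ) - E i) = 0 := by linear_combination h
      rcases mul_eq_zero.1 h2 with h3 | h3
      · exact h3
      · exact absurd (hE (Complex.ofReal_injective (sub_eq_zero.1 h3))).symm hij
  · exact (Complex.nonneg_iff.1 (hρ.1.diag_nonneg (i := i))).1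
  · have h := congrArg Complex.re hρ.2
    rwa [Matrix.trace, Complex.re_sum, Complex.one_re] at h

end ChannelReduction

/-! ## The oscillator chain -/

section OscillatorChain

variable {N : ℕ} {q : Fin 2 → ℝ}

theorem oscEnergy_sub (Δ b : ℝ) (i j : Fin N) :
    oscEnergy N Δ b i - oscEnergy N Δ b j = (((i : ℕ) : ℤ) - ((j : ℕ) : ℤ) : ℤ) * Δ := by
  simp only [oscEnergy]
  push_cast
  ring

theorem abs_intCast_mul_ge {Δ : ℝ} (hΔ : 0 < Δ) {m : ℤ} (hm : m ≠ 0) : Δ ≤ |(m : ℝ) * Δ| := by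
  rw [abs_mul, abs_of_pos hΔ]
  have : (1 : ℝ) ≤ |(m : ℝ)| := by exact_mod_cast Int.one_le_abs hm
  nlinarith

theorem deltaMin_oscEnergy (hN : 2 ≤ N) {Δ : ℝ} (hΔ : 0 < Δ) (b : ℝ) :
    deltaMin (oscEnergy N Δ b) = Δ := by
  apply IsLeast.csInf_eq
  constructor
  · refine ⟨⟨1, by omega⟩, ⟨0, by omega⟩, ⟨0, by omega⟩, ⟨0, by omega⟩, ?_, ?_⟩
    · rw [oscEnergy_sub, oscEnergy_sub]
      simp [hΔ.ne']
    · rw [oscEnergy_sub, oscEnergy_sub]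
      simp [abs_of_pos hΔ]
  · rintro x ⟨i, j, k, l, hne, rfl⟩
    rw [oscEnergy_sub, oscEnergy_sub, ← sub_mul, ← Int.cast_sub] at *
    refine abs_intCast_mul_ge hΔ fun h => hne ?_
    rw [sub_eq_zero.1 h]

theorem resonant_intCast_mul {Δ : ℝ} (hΔ : 0 < Δ) (t : ℝ) (m : ℤ) :
    resonant Δ t (m * Δ) = if m = 0 then 1 else 0 := by
  unfold resonant
  by_cases hm : m = 0
  · simp [hm, hΔ]
  · rw [if_neg hm, if_neg (not_lt.2 (abs_intCast_mul_ge hΔ hm))]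

theorem onRate_oscEnergy (hN : 2 ≤ N) {Δ : ℝ} (hΔ : 0 < Δ) (b : ℝ) (q : Fin 2 → ℝ) (α t : ℝ)
    (i j : Fin N) :
    onRate (oscEnergy N Δ b) Δ q α t i j = rescaledCoupling (Fin N) α t ^ 2 *
      ((if (j : ℕ) + 1 = i then q 0 else 0) + (if (j : ℕ) = i + 1 then q 1 else 0)) := by
  have e1 : oscEnergy N Δ b i - oscEnergy N Δ b j - Δ =
      ((((i : ℕ) : ℤ) - ((j : ℕ) : ℤ) - 1 : ℤ) : ℝ) * Δ := by
    rw [oscEnergy_sub]; push_cast; ring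
  have e2 : oscEnergy N Δ b i - oscEnergy N Δ b j + Δ =
      ((((i : ℕ) : ℤ) - ((j : ℕ) : ℤ) + 1 : ℤ) : ℝ) * Δ := by
    rw [oscEnergy_sub]; push_cast; ring
  rw [onRate, deltaMin_oscEnergy hN hΔ, e1, e2, resonant_intCast_mul hΔ, resonant_intCast_mul hΔ]
  have c1 : (((i : ℕ) : ℤ) - ((j : ℕ) : ℤ) - 1 = 0) ↔ (j : ℕ) + 1 = i := by omega
  have c2 : (((i : ℕ) : ℤ) - ((j : ℕ) : ℤ) + 1 = 0) ↔ (j : ℕ) = i + 1 := by omega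
  simp only [c1, c2, mul_ite, mul_one, mul_zero]

theorem sum_ite_succ_eq (c : ℝ) (i : Fin N) :
    (∑ k : Fin N, if (k : ℕ) + 1 = i then c else 0) = if 0 < (i : ℕ) then c else 0 := by
  split_ifs with h
  · rw [Finset.sum_eq_single (⟨(i : ℕ) - 1, by omega⟩ : Fin N)]
    · exact if_pos (by simp only; omega)
    · intro k _ hk
      exact if_neg fun h' => hk (Fin.ext (by simp only; omega))
    · intro h'; exact absurd (Finset.mem_univ _) h'
  · exact Finset.sum_eq_zero fun k _ => if_neg (by omega)

theorem sum_ite_eq_succ (c : ℝ) (i : Fin N) :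
    (∑ k : Fin N, if (k : ℕ) = i + 1 then c else 0) = if (i : ℕ) + 1 < N then c else 0 := by
  split_ifs with h
  · rw [Finset.sum_eq_single (⟨(i : ℕ) + 1, h⟩ : Fin N)]
    · exact if_pos rfl
    · intro k _ hk
      exact if_neg fun h' => hk (Fin.ext h')
    · intro h'; exact absurd (Finset.mem_univ _) h'
  · exact Finset.sum_eq_zero fun k _ => if_neg (by omega)

theorem transition_oscEnergy (hN : 2 ≤ N) {Δ : ℝ} (hΔ : 0 < Δ) (b : ℝ) (q : Fin 2 → ℝ) (α t : ℝ) :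
    transition (oscEnergy N Δ b) Δ q α t = rescaledCoupling (Fin N) α t ^ 2 • ladder N q := by
  ext j i
  rw [transition, Matrix.of_apply, Matrix.smul_apply, smul_eq_mul, ladder, Matrix.of_apply]
  simp only [onRate_oscEnergy hN hΔ]
  by_cases hji : j = i
  · subst hji
    rw [if_pos rfl, if_neg (by omega), if_neg (by omega), if_pos rfl, ← Finset.mul_sum,
      ← sum_ite_succ_eq, ← sum_ite_eq_succ, ← Finset.sum_add_distrib, ← mul_neg]
    congr 2
    refine Finset.sum_subset (Finset.subset_univ _) fun k _ hk => ?_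
    have : k = j := by simpa using hk
    subst this
    rw [if_neg (by omega), if_neg (by omega), add_zero]
  · rw [if_neg hji, if_neg hji]
    congr 1
    split_ifs with h1 h2 <;> first | omega | simp

theorem sum_transition_col {S : Type} [Fintype S] [DecidableEq S] (E : S → ℝ) (γ : ℝ)
    (q : Fin 2 → ℝ) (α t : ℝ) (i : S) : ∑ j, transition E γ q α t j i = 0 := by
  rw [← Finset.add_sum_erase _ _ (Finset.mem_univ i)]
  simp only [transition, Matrix.of_apply, if_true]
  rw [Finset.sum_congr rfl fun j hj => if_neg (Finset.ne_of_mem_erase hj)]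
  ring

theorem rescaledCoupling_sq (N : ℕ) (α t : ℝ) :
    rescaledCoupling (Fin N) α t ^ 2 = (α * t) ^ 2 / (2 * (N : ℝ) + 1) := by
  rw [rescaledCoupling, div_pow, Fintype.card_fin, Real.sq_sqrt (by positivity)]

theorem one_add_transition_mem_colStochastic (hN : 2 ≤ N) {Δ : ℝ} (hΔ : 0 < Δ) (b : ℝ)
    (h0 : 0 ≤ q 0) (h1 : 0 ≤ q 1) (hq : q 0 + q 1 = 1) {α t : ℝ}
    (hs : rescaledCoupling (Fin N) α t ^ 2 ≤ 1) :
    1 + transition (oscEnergy N Δ b) Δ q α t ∈ Matrix.colStochastic ℝ (Fin N) := by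
  rw [Matrix.mem_colStochastic_iff_sum]
  refine ⟨fun j i => ?_, fun i => ?_⟩
  · rw [transition_oscEnergy hN hΔ, Matrix.add_apply, Matrix.smul_apply, smul_eq_mul]
    have hs0 : 0 ≤ rescaledCoupling (Fin N) α t ^ 2 := sq_nonneg _
    by_cases hji : j = i
    · subst hji
      rw [Matrix.one_apply_eq, ladder, Matrix.of_apply, if_neg (by omega), if_neg (by omega),
        if_pos rfl]
      have : (if 0 < (j : ℕ) then q 0 else 0) + (if (j : ℕ) + 1 < N then q 1 else 0) ≤ 1 := by
        split_ifs <;> linarith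
      nlinarith
    · rw [Matrix.one_apply_ne hji, zero_add]
      refine mul_nonneg hs0 ?_
      rw [ladder, Matrix.of_apply]
      split_ifs <;> first | assumption | simp
  · simp only [Matrix.add_apply, Finset.sum_add_distrib, sum_transition_col, add_zero]
    simp [Matrix.one_apply]

theorem fixedPoints_one_add_transition (hN : 2 ≤ N) {Δ : ℝ} (hΔ : 0 < Δ) (b : ℝ)
    (hq0 : q 0 ≠ 0) {α t : ℝ} (hs : rescaledCoupling (Fin N) α t ^ 2 ≠ 0) {π : Fin N → ℝ}
    (hπ : π ∈ stdSimplex ℝ (Fin N)) (hL : ladder N q *ᵥ π = 0) :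
    {p ∈ stdSimplex ℝ (Fin N) | (1 + transition (oscEnergy N Δ b) Δ q α t) *ᵥ p = p} = {π} := by
  have hiff : ∀ p : Fin N → ℝ, (1 + transition (oscEnergy N Δ b) Δ q α t) *ᵥ p = p ↔
      ladder N q *ᵥ p = 0 := by
    intro p
    rw [transition_oscEnergy hN hΔ, Matrix.add_mulVec, Matrix.one_mulVec, Matrix.smul_mulVec,
      add_eq_left, smul_eq_zero, or_iff_right hs]
  ext p
  constructor
  · rintro ⟨hp, hfix⟩
    exact eq_of_ladder_mulVec_eq_zero hq0 ((hiff p).1 hfix) hL hp.2 hπ.2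
  · rintro rfl
    exact ⟨hπ, (hiff _).2 hL⟩

/-! ### Thermal populations -/

theorem gibbs_mem_stdSimplex {κ : Type} [Fintype κ] [Nonempty κ] (E : κ → ℝ) (β : ℝ) :
    gibbs E β ∈ stdSimplex ℝ κ := by
  have hZ : 0 < ∑ j, Real.exp (-β * E j) :=
    Finset.sum_pos (fun _ _ => Real.exp_pos _) Finset.univ_nonempty
  refine ⟨fun i => by unfold gibbs; positivity, ?_⟩
  simp only [gibbs]
  rw [← Finset.sum_div, div_self hZ.ne']

theorem gibbs_pos {κ : Type} [Fintype κ] [Nonempty κ] (E : κ → ℝ) (β : ℝ) (i : κ) :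
    0 < gibbs E β i :=
  div_pos (Real.exp_pos _) (Finset.sum_pos (fun _ _ => Real.exp_pos _) Finset.univ_nonempty)

theorem gibbs_env_add (Δ β : ℝ) : gibbs (envEnergy Δ) β 0 + gibbs (envEnergy Δ) β 1 = 1 := by
  have := (gibbs_mem_stdSimplex (envEnergy Δ) β).2
  rwa [Fin.sum_univ_two] at this

theorem gibbs_env_le {Δ β : ℝ} (hΔ : 0 < Δ) (hβ : 0 ≤ β) :
    gibbs (envEnergy Δ) β 1 ≤ gibbs (envEnergy Δ) β 0 := by
  unfold gibbs
  refine div_le_div_of_nonneg_right ?_ (Finset.sum_nonneg fun _ _ => (Real.exp_pos _).le)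
  apply Real.exp_le_exp.2
  have : 0 ≤ β * Δ := by positivity
  simp [envEnergy]
  exact this

theorem ladder_mulVec_gibbs (N : ℕ) (Δ b β : ℝ) :
    ladder N (gibbs (envEnergy Δ) β) *ᵥ gibbs (oscEnergy N Δ b) β = 0 := by
  have h := (ladder_mulVec_eq_zero_iff (N := N) (q := gibbs (envEnergy Δ) β)
    (fun i : ℕ => Real.exp (-β * (((i : ℕ) + 1 : ℝ) * Δ + b)) /
      ∑ j, Real.exp (-β * oscEnergy N Δ b j))).2 ?_
  · exact h
  · intro i _
    simp only [gibbs, envEnergy, Matrix.cons_val_zero, Matrix.cons_val_one]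
    rw [div_mul_div_comm, div_mul_div_comm, ← Real.exp_add, ← Real.exp_add]
    congr 2
    push_cast
    ring

theorem ground_mem_stdSimplex (hN : 0 < N) : ground N ∈ stdSimplex ℝ (Fin N) := by
  refine ⟨fun i => by unfold ground; split_ifs <;> norm_num, ?_⟩
  rw [Finset.sum_eq_single (⟨0, hN⟩ : Fin N)]
  · simp [ground]
  · intro i _ hi
    exact if_neg fun h => hi (Fin.ext h)
  · intro h; exact absurd (Finset.mem_univ _) h

theorem ladder_mulVec_ground (N : ℕ) : ladder N (ground 2) *ᵥ ground N = 0 := by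
  have h := (ladder_mulVec_eq_zero_iff (N := N) (q := ground 2)
    (fun i : ℕ => if i = 0 then (1 : ℝ) else 0)).2 ?_
  · exact h
  · intro i _
    simp [ground]

theorem tendsto_gibbs_oscEnergy (hN : 0 < N) {Δ : ℝ} (hΔ : 0 < Δ) (b : ℝ) :
    Tendsto (fun β => gibbs (oscEnergy N Δ b) β) atTop (𝓝 (ground N)) := by
  have hshift : ∀ β (i : Fin N), gibbs (oscEnergy N Δ b) β i =
      Real.exp (-(β * (((i : ℕ) : ℝ) * Δ))) /
        ∑ j : Fin N, Real.exp (-(β * (((j : ℕ) : ℝ) * Δ))) := by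
    intro β i
    have e : ∀ j : Fin N, Real.exp (-β * oscEnergy N Δ b j) =
        Real.exp (-β * (Δ + b)) * Real.exp (-(β * (((j : ℕ) : ℝ) * Δ))) := by
      intro j
      rw [← Real.exp_add, oscEnergy]
      congr 1
      ring
    simp only [gibbs, e]
    rw [← Finset.mul_sum, mul_div_mul_left _ _ (Real.exp_pos _).ne']
  have hterm : ∀ i : Fin N, Tendsto (fun β : ℝ => Real.exp (-(β * (((i : ℕ) : ℝ) * Δ)))) atTop
      (𝓝 (ground N i)) := by
    intro i
    unfold ground
    split_ifs with hi
    · simp [hi]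
    · have : (0 : ℝ) < ((i : ℕ) : ℝ) * Δ :=
        mul_pos (by exact_mod_cast Nat.pos_of_ne_zero hi) hΔ
      exact Real.tendsto_exp_neg_atTop_nhds_zero.comp (tendsto_id.atTop_mul_const this)
  rw [tendsto_pi_nhds]
  intro i
  simp only [hshift]
  have h := (hterm i).div (tendsto_finsetSum Finset.univ fun j _ => hterm j)
    (by rw [(ground_mem_stdSimplex hN).2]; exact one_ne_zero)
  rwa [(ground_mem_stdSimplex hN).2, div_one] at h

theorem tendsto_gibbs_envEnergy {Δ : ℝ} (hΔ : 0 < Δ) :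
    Tendsto (fun β => gibbs (envEnergy Δ) β) atTop (𝓝 (ground 2)) := by
  have : envEnergy Δ = oscEnergy 2 Δ (-Δ) := by
    ext a
    fin_cases a <;> simp [envEnergy, oscEnergy]
    ring
  rw [this]
  exact tendsto_gibbs_oscEnergy two_pos hΔ _

theorem continuous_ladder (N : ℕ) : Continuous (ladder N) := by
  refine continuous_matrix fun j i => ?_
  simp only [ladder, Matrix.of_apply]
  split_ifs <;> fun_prop

theorem oscGap_eq (hN : 2 ≤ N) (Δ β : ℝ) :
    oscGap N Δ β = ladderRate N (gibbs (envEnergy Δ) β) 1 :=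
  spectralGap_ladder (gibbs_pos _ _ _) (gibbs_pos _ _ _) (gibbs_env_add Δ β) hN

theorem oscGap_pos (hN : 2 ≤ N) (Δ β : ℝ) : 0 < oscGap N Δ β := by
  rw [oscGap_eq hN]
  exact ladderRate_pos (gibbs_env_add Δ β) one_pos (by omega)

theorem oscGap_le_one (hN : 2 ≤ N) (Δ β : ℝ) : oscGap N Δ β ≤ 1 := by
  rw [oscGap_eq hN, ladderRate]
  have hN' : (2 : ℝ) ≤ N := by exact_mod_cast hN
  have hpi := Real.pi_pos
  have hc : 0 ≤ Real.cos (((1 : ℕ) : ℝ) * Real.pi / N) := by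
    apply Real.cos_nonneg_of_neg_pi_div_two_le_of_le
    · have : 0 ≤ ((1 : ℕ) : ℝ) * Real.pi / N := by positivity
      linarith
    · rw [Nat.cast_one, one_mul]
      gcongr
  have := mul_nonneg (Real.sqrt_nonneg (gibbs (envEnergy Δ) β 0 * gibbs (envEnergy Δ) β 1)) hc
  linarith

theorem tendsto_oscGap (hN : 2 ≤ N) {Δ : ℝ} (hΔ : 0 < Δ) :
    Tendsto (fun β => oscGap N Δ β) atTop (𝓝 1) := by
  simp only [oscGap_eq hN, ladderRate]
  have hq := tendsto_pi_nhds.1 (tendsto_gibbs_envEnergy hΔ)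
  have h := (((Real.continuous_sqrt.tendsto _).comp ((hq 0).mul (hq 1))).const_mul 2).mul_const
    (Real.cos (((1 : ℕ) : ℝ) * Real.pi / N))
  have h2 := h.const_sub 1
  simpa [ground] using h2

theorem exists_isCutWeight (hN : 2 ≤ N) {Δ β : ℝ} (hΔ : 0 < Δ) (hβ : 0 ≤ β) :
    ∃ v, IsCutWeight N (gibbs (envEnergy Δ) β) (oscGap N Δ β / 4) v := by
  have hpos := oscGap_pos hN Δ β
  have hle := oscGap_le_one hN Δ β
  by_cases h : gibbs (envEnergy Δ) β 1 ≤ 1 / 8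
  · exact ⟨_, (isCutWeight_two_pow (gibbs_env_add Δ β) h).mono (by linarith)⟩
  · refine ⟨_, (isCutWeight_sine (gibbs_env_add Δ β) (le_of_not_ge h)
      (gibbs_env_le hΔ hβ)).mono ?_⟩
    rw [← oscGap_eq hN]
    linarith

end OscillatorChain

/-! ## Perturbation of stochastic matrices -/

section Stochastic

variable {S : Type} [Fintype S] [DecidableEq S]

theorem sum_abs_sub_col_le {A B : Matrix S S ℝ} (hA : A ∈ Matrix.colStochastic ℝ S)
    (hB : B ∈ Matrix.colStochastic ℝ S) (i : S) :
    ∑ j, |A j i - B j i| ≤ 2 * ∑ j ∈ Finset.univ.erase i, |A j i - B j i| := by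
  have hsum : ∑ j, (A j i - B j i) = 0 := by
    rw [Finset.sum_sub_distrib, Matrix.sum_col_of_mem_colStochastic hA,
      Matrix.sum_col_of_mem_colStochastic hB, sub_self]
  rw [← Finset.add_sum_erase _ _ (Finset.mem_univ i)] at hsum
  rw [← Finset.add_sum_erase _ _ (Finset.mem_univ i)]
  have h1 : A i i - B i i = -∑ j ∈ Finset.univ.erase i, (A j i - B j i) := by linarith
  have h2 : |A i i - B i i| ≤ ∑ j ∈ Finset.univ.erase i, |A j i - B j i| := by
    rw [h1, abs_neg]
    exact Finset.abs_sum_le_sum_abs _ _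
  linarith

theorem sum_abs_mulVec_le {S : Type} [Fintype S] {A : Matrix S S ℝ} {δ : ℝ} (hA : ∀ i, ∑ j, |A j i| ≤ δ) (p : S → ℝ) :
    ∑ j, |(A *ᵥ p) j| ≤ δ * ∑ i, |p i| := by
  calc ∑ j, |(A *ᵥ p) j| ≤ ∑ j, ∑ i, |A j i| * |p i| := by
        refine Finset.sum_le_sum fun j _ => ?_
        refine (Finset.abs_sum_le_sum_abs _ _).trans (le_of_eq ?_)
        exact Finset.sum_congr rfl fun i _ => abs_mul _ _
    _ = ∑ i, (∑ j, |A j i|) * |p i| := by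
        rw [Finset.sum_comm]
        exact Finset.sum_congr rfl fun i _ => (Finset.sum_mul _ _ _).symm
    _ ≤ ∑ i, δ * |p i| := Finset.sum_le_sum fun i _ =>
        mul_le_mul_of_nonneg_right (hA i) (abs_nonneg _)
    _ = _ := (Finset.mul_sum _ _ _).symm

theorem mulVec_mem_stdSimplex {A : Matrix S S ℝ} (hA : A ∈ Matrix.colStochastic ℝ S)
    {p : S → ℝ} (hp : p ∈ stdSimplex ℝ S) : A *ᵥ p ∈ stdSimplex ℝ S := by
  refine ⟨fun j => Finset.sum_nonneg fun i _ =>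
    mul_nonneg (Matrix.nonneg_of_mem_colStochastic hA) (hp.1 i), ?_⟩
  have : ∑ j, (A *ᵥ p) j = ∑ j, ∑ i, A j i * p i := rfl
  rw [this, Finset.sum_comm]
  simp only [← Finset.sum_mul, Matrix.sum_col_of_mem_colStochastic hA, one_mul]
  exact hp.2

theorem sum_abs_pow_mulVec_sub_le {A B : Matrix S S ℝ} (hA : A ∈ Matrix.colStochastic ℝ S)
    (hB : B ∈ Matrix.colStochastic ℝ S) {δ : ℝ} (hδ : ∀ i, ∑ j, |A j i - B j i| ≤ δ)
    {p : S → ℝ} (hp : p ∈ stdSimplex ℝ S) (L : ℕ) :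
    ∑ j, |(A ^ L *ᵥ p) j - (B ^ L *ᵥ p) j| ≤ L * δ := by
  induction L with
  | zero => simp
  | succ L ih =>
    have hAL : A ^ L *ᵥ p ∈ stdSimplex ℝ S := mulVec_mem_stdSimplex (pow_mem hA L) hp
    have hdec : ∀ j, (A ^ (L + 1) *ᵥ p) j - (B ^ (L + 1) *ᵥ p) j =
        ((A - B) *ᵥ (A ^ L *ᵥ p)) j + (B *ᵥ (A ^ L *ᵥ p - B ^ L *ᵥ p)) j := by
      intro j
      rw [pow_succ', pow_succ', ← Matrix.mulVec_mulVec, ← Matrix.mulVec_mulVec, Matrix.sub_mulVec,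
        Matrix.mulVec_sub, Pi.sub_apply, Pi.sub_apply]
      ring
    have h1 : ∑ j, |((A - B) *ᵥ (A ^ L *ᵥ p)) j| ≤ δ := by
      have h := sum_abs_mulVec_le (A := A - B) hδ (A ^ L *ᵥ p)
      have : ∑ i, |(A ^ L *ᵥ p) i| = 1 := by
        rw [← hAL.2]
        exact Finset.sum_congr rfl fun i _ => abs_of_nonneg (hAL.1 i)
      rwa [this, mul_one] at h
    have h2 : ∑ j, |(B *ᵥ (A ^ L *ᵥ p - B ^ L *ᵥ p)) j| ≤ L * δ := by
      have h := sum_abs_mulVec_le (A := B) (δ := 1) (fun i => by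
        rw [← Matrix.sum_col_of_mem_colStochastic hB i]
        exact Finset.sum_le_sum fun j _ =>
          (abs_of_nonneg (Matrix.nonneg_of_mem_colStochastic hB)).le) (A ^ L *ᵥ p - B ^ L *ᵥ p)
      rw [one_mul] at h
      exact h.trans ih
    calc _ ≤ ∑ j, (|((A - B) *ᵥ (A ^ L *ᵥ p)) j| + |(B *ᵥ (A ^ L *ᵥ p - B ^ L *ᵥ p)) j|) :=
          Finset.sum_le_sum fun j _ => by rw [hdec]; exact abs_add_le _ _
      _ ≤ δ + L * δ := by rw [Finset.sum_add_distrib]; exact add_le_add h1 h2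
      _ = _ := by push_cast; ring

end Stochastic

/-! ## Error per interaction -/

section ErrorBound

variable {N : ℕ} {q : Fin 2 → ℝ}

theorem abs_sinc_sq_sub_ite_le {Δ t : ℝ} (hΔ : 0 < Δ) (ht : 0 < t) (m : ℤ) :
    |Real.sinc (m * Δ * t / 2) ^ 2 - (if m = 0 then 1 else 0)| ≤
      if m = 0 then 0 else 4 / (Δ * t) ^ 2 := by
  by_cases hm : m = 0
  · simp [hm]
  · have hmR : (m : ℝ) ≠ 0 := by exact_mod_cast hm
    have hΔt : 0 < Δ * t := mul_pos hΔ ht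
    rw [if_neg hm, if_neg hm, sub_zero, abs_of_nonneg (sq_nonneg _),
      Real.sinc_of_ne_zero (by positivity), div_pow, div_le_div_iff₀ (by positivity) (by positivity)]
    have h1 : Real.sin (m * Δ * t / 2) ^ 2 ≤ 1 := Real.sin_sq_le_one _
    have h2 : (1 : ℝ) ≤ (m : ℝ) ^ 2 := by
      rw [one_le_sq_iff_one_le_abs]
      exact_mod_cast Int.one_le_abs hm
    have h3 : 0 < (Δ * t) ^ 2 := by positivity
    have h4 : 4 * (m * Δ * t / 2) ^ 2 = (m : ℝ) ^ 2 * (Δ * t) ^ 2 := by ring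
    rw [h4]
    exact mul_le_mul_of_nonneg_right (h1.trans h2) h3.le

/-- Off-resonant contributions to the golden rule are small. -/
theorem abs_goldenRule_sub_ladder_le (h0 : ∀ a, 0 ≤ q a) (hq : q 0 + q 1 = 1) {Δ t : ℝ}
    (hΔ : 0 < Δ) (ht : 0 < t) (b : ℝ) {i j : Fin N} (hij : j ≠ i) :
    |∑ a, q a * ∑ c, Real.sinc ((totalEnergy (oscEnergy N Δ b) Δ (j, c) -
        totalEnergy (oscEnergy N Δ b) Δ (i, a)) * t / 2) ^ 2 - ladder N q j i| ≤
      8 / (Δ * t) ^ 2 := by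
  set m : ℤ := ((j : ℕ) : ℤ) - ((i : ℕ) : ℤ) with hm
  have hm0 : m ≠ 0 := fun h => hij (Fin.ext (by omega))
  have hE : oscEnergy N Δ b j - oscEnergy N Δ b i = (m : ℝ) * Δ := oscEnergy_sub Δ b j i
  have e00 : totalEnergy (oscEnergy N Δ b) Δ (j, 0) - totalEnergy (oscEnergy N Δ b) Δ (i, 0) =
      (m : ℝ) * Δ := by
    simp only [totalEnergy, envEnergy, Matrix.cons_val_zero]; linarith
  have e11 : totalEnergy (oscEnergy N Δ b) Δ (j, 1) - totalEnergy (oscEnergy N Δ b) Δ (i, 1) =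
      (m : ℝ) * Δ := by
    simp only [totalEnergy]; linarith
  have e10 : totalEnergy (oscEnergy N Δ b) Δ (j, 1) - totalEnergy (oscEnergy N Δ b) Δ (i, 0) =
      ((m + 1 : ℤ) : ℝ) * Δ := by
    simp only [totalEnergy, envEnergy, Matrix.cons_val_zero, Matrix.cons_val_one]
    push_cast; linarith
  have e01 : totalEnergy (oscEnergy N Δ b) Δ (j, 0) - totalEnergy (oscEnergy N Δ b) Δ (i, 1) =
      ((m - 1 : ℤ) : ℝ) * Δ := by
    simp only [totalEnergy, envEnergy, Matrix.cons_val_zero, Matrix.cons_val_one]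
    push_cast; linarith
  have hlad : ladder N q j i = q 0 * (if m + 1 = 0 then 1 else 0) +
      q 1 * (if m - 1 = 0 then 1 else 0) := by
    rw [ladder, Matrix.of_apply]
    have c1 : (m + 1 = 0) ↔ (j : ℕ) + 1 = i := by omega
    have c2 : (m - 1 = 0) ↔ (j : ℕ) = i + 1 := by omega
    simp only [c1, c2]
    split_ifs <;> first | omega | simp
  have η0 : 0 ≤ 4 / (Δ * t) ^ 2 := by positivity
  have bnd : ∀ k : ℤ, |Real.sinc (k * Δ * t / 2) ^ 2 - (if k = 0 then 1 else 0)| ≤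
      4 / (Δ * t) ^ 2 := fun k =>
    (abs_sinc_sq_sub_ite_le hΔ ht k).trans (by split_ifs <;> simp [η0])
  have b0 := abs_le.1 (bnd m)
  have b1 := abs_le.1 (bnd (m + 1))
  have b2 := abs_le.1 (bnd (m - 1))
  rw [if_neg hm0, sub_zero] at b0
  simp only [Fin.sum_univ_two, e00, e11, e10, e01, hlad]
  set x0 := Real.sinc ((m : ℝ) * Δ * t / 2) ^ 2
  set x1 := Real.sinc (((m + 1 : ℤ) : ℝ) * Δ * t / 2) ^ 2
  set x2 := Real.sinc (((m - 1 : ℤ) : ℝ) * Δ * t / 2) ^ 2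
  set y1 : ℝ := if m + 1 = 0 then 1 else 0
  set y2 : ℝ := if m - 1 = 0 then 1 else 0
  have e8 : (8 : ℝ) / (Δ * t) ^ 2 = (q 0 + q 1) * (2 * (4 / (Δ * t) ^ 2)) := by rw [hq]; ring
  rw [e8]
  set η := 4 / (Δ * t) ^ 2
  have q0 := h0 0
  have q1 := h0 1
  have e : q 0 * (x0 + x1) + q 1 * (x2 + x0) - (q 0 * y1 + q 1 * y2) =
      q 0 * (x0 + (x1 - y1)) + q 1 * (x0 + (x2 - y2)) := by ring
  rw [e, abs_le]
  constructor
  · have := mul_le_mul_of_nonneg_left (by linarith : -(2 * η) ≤ x0 + (x1 - y1)) q0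
    have := mul_le_mul_of_nonneg_left (by linarith : -(2 * η) ≤ x0 + (x2 - y2)) q1
    linarith
  · have := mul_le_mul_of_nonneg_left (by linarith : x0 + (x1 - y1) ≤ 2 * η) q0
    have := mul_le_mul_of_nonneg_left (by linarith : x0 + (x2 - y2) ≤ 2 * η) q1
    linarith

theorem sum_abs_levelTransition_sub_le (hN : 2 ≤ N) (h0 : ∀ a, 0 ≤ q a) (hq : q 0 + q 1 = 1)
    {Δ α t : ℝ} (hΔ : 0 < Δ) (hα : 0 ≤ α) (ht : 0 < t) (b : ℝ)
    (hs : rescaledCoupling (Fin N) α t ^ 2 ≤ 1) (i : Fin N) :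
    ∑ j, |levelTransition (oscEnergy N Δ b) Δ q α t j i -
        (1 + transition (oscEnergy N Δ b) Δ q α t) j i| ≤
      2 * (2 * N * gaussianMoment * (2 * (α * t) ^ 3 + (α * t) ^ 4) +
        N * ((α * t) ^ 2 / (2 * (N : ℝ) + 1) * (8 / (Δ * t) ^ 2))) := by
  refine (sum_abs_sub_col_le (levelTransition_mem_colStochastic _ _ _ _ h0 hq)
    (one_add_transition_mem_colStochastic hN hΔ b (h0 0) (h0 1) hq hs) i).trans ?_
  refine mul_le_mul_of_nonneg_left ?_ zero_le_two
  set E := oscEnergy N Δ b with hE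
  set e := totalEnergy E Δ with he
  set s : ℝ := (α * t) ^ 2 / (2 * (N : ℝ) + 1) with hsdef
  have hs0 : 0 ≤ s := by positivity
  set I : Fin N × Fin 2 → Fin N × Fin 2 → ℝ := fun x y =>
    ∫ ω, ‖propagator e α t (interaction ω) x y‖ ^ 2 ∂(interactionLaw (Fin N × Fin 2)) with hI
  set Q : Fin N × Fin 2 → Fin N × Fin 2 → ℝ := fun x y =>
    Real.sinc ((e x - e y) * t / 2) ^ 2 with hQ
  have hcard : (Fintype.card (Fin N × Fin 2) : ℝ) = 2 * N := by
    rw [Fintype.card_prod, Fintype.card_fin, Fintype.card_fin]; push_cast; ring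
  have hcol : ∀ y, ∑ x ∈ Finset.univ.erase y, |I x y - s * Q x y| ≤
      2 * N * gaussianMoment * (2 * (α * t) ^ 3 + (α * t) ^ 4) := by
    intro y
    have h := sum_abs_integral_propagator_sub_le e hα ht.le y
    rw [hcard] at h
    refine le_trans (le_of_eq (Finset.sum_congr rfl fun x _ => ?_)) h
    rw [hsdef, hI, hQ]
    simp only
    congr 2
    ring
  have hpt : ∀ j ∈ Finset.univ.erase i, |levelTransition E Δ q α t j i -
      (1 + transition E Δ q α t) j i| ≤
        ∑ a, q a * ∑ c, |I (j, c) (i, a) - s * Q (j, c) (i, a)| + s * (8 / (Δ * t) ^ 2) := by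
    intro j hj
    have hji := Finset.ne_of_mem_erase hj
    have hT : (1 + transition E Δ q α t) j i = s * ladder N q j i := by
      rw [hE, transition_oscEnergy hN hΔ, Matrix.add_apply, Matrix.one_apply_ne hji, zero_add,
        Matrix.smul_apply, smul_eq_mul, rescaledCoupling_sq]
    have hP : levelTransition E Δ q α t j i = ∑ a, q a * ∑ c, I (j, c) (i, a) := rfl
    have hsplit : levelTransition E Δ q α t j i - s * ladder N q j i =
        ∑ a, q a * ∑ c, (I (j, c) (i, a) - s * Q (j, c) (i, a)) +
          s * (∑ a, q a * ∑ c, Q (j, c) (i, a) - ladder N q j i) := by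
      rw [hP]
      simp only [Fin.sum_univ_two]
      ring
    rw [hT, hsplit]
    refine (abs_add_le _ _).trans (add_le_add ?_ ?_)
    · refine (Finset.abs_sum_le_sum_abs _ _).trans (Finset.sum_le_sum fun a _ => ?_)
      rw [abs_mul, abs_of_nonneg (h0 a)]
      exact mul_le_mul_of_nonneg_left (Finset.abs_sum_le_sum_abs _ _) (h0 a)
    · rw [abs_mul, abs_of_nonneg hs0]
      exact mul_le_mul_of_nonneg_left (abs_goldenRule_sub_ladder_le h0 hq hΔ ht b hji) hs0
  calc _ ≤ ∑ j ∈ Finset.univ.erase i,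
        (∑ a, q a * ∑ c, |I (j, c) (i, a) - s * Q (j, c) (i, a)| + s * (8 / (Δ * t) ^ 2)) :=
        Finset.sum_le_sum hpt
    _ = ∑ a, q a * ∑ j ∈ Finset.univ.erase i, ∑ c, |I (j, c) (i, a) - s * Q (j, c) (i, a)| +
        ((Finset.univ.erase i).card : ℝ) * (s * (8 / (Δ * t) ^ 2)) := by
        rw [Finset.sum_add_distrib, Finset.sum_const, nsmul_eq_mul, Finset.sum_comm]
        simp only [Finset.mul_sum]
    _ ≤ ∑ a, q a * (2 * N * gaussianMoment * (2 * (α * t) ^ 3 + (α * t) ^ 4)) +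
        N * (s * (8 / (Δ * t) ^ 2)) := by
        refine add_le_add (Finset.sum_le_sum fun a _ => mul_le_mul_of_nonneg_left ?_ (h0 a)) ?_
        · refine le_trans ?_ (hcol (i, a))
          rw [← Finset.sum_product (Finset.univ.erase i) Finset.univ
            (fun x => |I x (i, a) - s * Q x (i, a)|)]
          refine Finset.sum_le_sum_of_subset_of_nonneg (fun x hx => ?_) fun _ _ _ => abs_nonneg _
          refine Finset.mem_erase.2 ⟨fun h => ?_, Finset.mem_univ _⟩
          exact Finset.ne_of_mem_erase (Finset.mem_product.1 hx).1 (by rw [h])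
        · refine mul_le_mul_of_nonneg_right ?_ (by positivity)
          have : (Finset.univ.erase i).card ≤ N := by
            rw [Finset.card_erase_of_mem (Finset.mem_univ _), Finset.card_univ, Fintype.card_fin]
            exact Nat.sub_le _ _
          exact_mod_cast this
    _ = _ := by rw [← Finset.sum_mul, Fin.sum_univ_two, hq, one_mul]

end ErrorBound

/-! ## Simulation cost -/

section Cost

variable {N : ℕ} {q : Fin 2 → ℝ}

theorem rpow_div_two_eq_sqrt_pow {x : ℝ} (hx : 0 ≤ x) (m : ℕ) :
    x ^ ((m : ℝ) / 2) = Real.sqrt x ^ m := by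
  rw [Real.sqrt_eq_rpow, ← Real.rpow_natCast, ← Real.rpow_mul hx]
  congr 1
  ring

theorem oscAlpha_mul_oscTime (hN : 0 < N) {Δ ε lam : ℝ} (hΔ : 0 < Δ) (hε : 0 < ε)
    (hl : 0 < lam) : oscAlpha N Δ ε lam * oscTime N Δ ε lam = ε * lam / (N : ℝ) ^ 3 := by
  have hN' : (0 : ℝ) < N := by exact_mod_cast hN
  have e1 : ε ^ (3 / 2 : ℝ) = Real.sqrt ε ^ 3 := by
    exact_mod_cast rpow_div_two_eq_sqrt_pow hε.le 3
  have e2 : lam ^ (3 / 2 : ℝ) = Real.sqrt lam ^ 3 := by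
    exact_mod_cast rpow_div_two_eq_sqrt_pow hl.le 3
  have hse : 0 < Real.sqrt ε := Real.sqrt_pos.2 hε
  have hsl : 0 < Real.sqrt lam := Real.sqrt_pos.2 hl
  have h1 : ε = Real.sqrt ε ^ 2 := (Real.sq_sqrt hε.le).symm
  have h2 : lam = Real.sqrt lam ^ 2 := (Real.sq_sqrt hl.le).symm
  rw [oscAlpha, oscTime, e1, e2, Real.sqrt_mul hε.le]
  have h3 : ε * lam = Real.sqrt ε ^ 2 * Real.sqrt lam ^ 2 := by rw [← h1, ← h2]
  rw [h3]
  field_simp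

theorem mul_oscTime_sq {Δ ε lam : ℝ} (hΔ : 0 < Δ) (hε : 0 < ε) (hl : 0 < lam) :
    (Δ * oscTime N Δ ε lam) ^ 2 = (N : ℝ) ^ 2 / (ε * lam) := by
  have h : Δ * ((N : ℝ) / (Δ * Real.sqrt (ε * lam))) = N / Real.sqrt (ε * lam) := by
    field_simp
  rw [oscTime, h, div_pow, Real.sq_sqrt (mul_pos hε hl).le]

theorem oscSteps_mul_oscTime (hN : 0 < N) {Δ ε lam : ℝ} (hΔ : 0 < Δ) (hε : 0 < ε)
    (hl : 0 < lam) : oscSteps N Δ ε lam * oscTime N Δ ε lam =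
      (N : ℝ) ^ 9 / (Δ * ε ^ (5 / 2 : ℝ) * lam ^ (7 / 2 : ℝ)) := by
  have hN' : (0 : ℝ) < N := by exact_mod_cast hN
  have e1 : ε ^ (5 / 2 : ℝ) = Real.sqrt ε ^ 5 := by
    exact_mod_cast rpow_div_two_eq_sqrt_pow hε.le 5
  have e2 : lam ^ (7 / 2 : ℝ) = Real.sqrt lam ^ 7 := by
    exact_mod_cast rpow_div_two_eq_sqrt_pow hl.le 7
  have hse : 0 < Real.sqrt ε := Real.sqrt_pos.2 hε
  have hsl : 0 < Real.sqrt lam := Real.sqrt_pos.2 hl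
  rw [oscSteps, ← mul_pow, oscAlpha_mul_oscTime hN hΔ hε hl, oscTime, e1, e2,
    Real.sqrt_mul hε.le]
  generalize hx : Real.sqrt ε = x at *
  generalize hy : Real.sqrt lam = y at *
  have h1 : ε = x ^ 2 := by rw [← hx]; exact (Real.sq_sqrt hε.le).symm
  have h2 : lam = y ^ 2 := by rw [← hy]; exact (Real.sq_sqrt hl.le).symm
  rw [h1, h2]
  field_simp

theorem four_mul_sq_mul_pow_le (hN : 2 ≤ N) : 4 * (N : ℝ) ^ 2 * 3 ^ N ≤ Real.exp (4 * N) := by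
  have h1 : (N : ℝ) ≤ 2 ^ N := by exact_mod_cast Nat.lt_two_pow_self.le
  have h2 : (4 : ℝ) ≤ 2 ^ N := by
    calc (4 : ℝ) = 2 ^ 2 := by norm_num
      _ ≤ 2 ^ N := pow_le_pow_right₀ (by norm_num) hN
  have h3 : (24 : ℝ) ≤ Real.exp 4 := by
    have he : (2.7 : ℝ) ≤ Real.exp 1 := by have := Real.exp_one_gt_d9; linarith
    have : Real.exp 4 = Real.exp 1 ^ 4 := by rw [← Real.exp_nat_mul]; norm_num
    rw [this]
    calc (24 : ℝ) ≤ 2.7 ^ 4 := by norm_num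
      _ ≤ _ := by gcongr
  calc 4 * (N : ℝ) ^ 2 * 3 ^ N ≤ 2 ^ N * (2 ^ N) ^ 2 * 3 ^ N := by gcongr
    _ = 24 ^ N := by rw [← pow_mul, mul_comm N 2, pow_mul, ← mul_pow, ← mul_pow]; norm_num
    _ ≤ Real.exp 4 ^ N := by gcongr
    _ = Real.exp (4 * N) := by rw [← Real.exp_nat_mul, mul_comm]

theorem stepError_le {n m ε lam a : ℝ} (hn : 0 < n) (hm : 0 ≤ m) (hel : 0 < ε * lam)
    (ha : 0 < a) (ha1 : a ≤ 1) (haeq : a = ε * lam / n ^ 3) :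
    2 * (2 * n * m * (2 * a ^ 3 + a ^ 4) +
      n * (a ^ 2 / (2 * n + 1) * (8 / (n ^ 2 / (ε * lam))))) ≤
      (12 * m + 8) * (ε * (a ^ 2 * lam) / n ^ 2) := by
  have h1 : 2 * a ^ 3 + a ^ 4 ≤ 3 * a ^ 2 * (ε * lam / n ^ 3) := by
    rw [← haeq]
    have : a ^ 4 ≤ a ^ 3 := pow_le_pow_of_le_one ha.le ha1 (by norm_num)
    linarith [show 3 * a ^ 2 * a = 3 * a ^ 3 by ring]
  have h2 : a ^ 2 / (2 * n + 1) ≤ a ^ 2 / (2 * n) := by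
    gcongr
    linarith
  have h3 : 0 ≤ 8 / (n ^ 2 / (ε * lam)) := by positivity
  have h4 := mul_le_mul_of_nonneg_left h1 (by positivity : 0 ≤ 2 * n * m)
  have h5 := mul_le_mul_of_nonneg_left (mul_le_mul_of_nonneg_right h2 h3) hn.le
  have e1 : 2 * n * m * (3 * a ^ 2 * (ε * lam / n ^ 3)) =
      6 * m * (ε * (a ^ 2 * lam) / n ^ 2) := by
    field_simp
    ring
  have e2 : n * (a ^ 2 / (2 * n) * (8 / (n ^ 2 / (ε * lam)))) =
      4 * (ε * (a ^ 2 * lam) / n ^ 2) := by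
    rw [div_div_eq_mul_div]
    field_simp
    ring
  linarith

theorem one_sub_pow_le_exp {n a lam ℓ L : ℝ} (hn : 2 ≤ n) (ha : 0 < a) (hl : 0 < lam)
    (hℓ : 0 ≤ ℓ) (hL : 100 * (n ^ 2 / (a ^ 2 * lam)) * ℓ ≤ L) :
    10 * (n * ℓ) ≤ L * (a ^ 2 / (2 * n + 1) * (lam / 4)) := by
  have h0 : 0 ≤ a ^ 2 / (2 * n + 1) * (lam / 4) := by positivity
  have h2 := mul_le_mul_of_nonneg_right hL h0
  have hn0 : (2 * n + 1) ≠ 0 := by positivity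
  have h3 : 100 * (n ^ 2 / (a ^ 2 * lam)) * ℓ * (a ^ 2 / (2 * n + 1) * (lam / 4)) =
      25 * (n ^ 2 / (2 * n + 1)) * ℓ := by
    field_simp
    ring
  have h4 : 2 / 5 * n ≤ n ^ 2 / (2 * n + 1) := by
    rw [le_div_iff₀ (by positivity)]
    nlinarith
  have h5 := mul_le_mul_of_nonneg_right h4 hℓ
  linarith

theorem sum_abs_sub_pow_mulVec_le (hN : 2 ≤ N) {a lam ε ℓ : ℝ} (ha : 0 < a) (ha1 : a ≤ 1)
    (hl : 0 < lam) (hl1 : lam ≤ 1) (h0 : ∀ a, 0 ≤ q a) (hq : q 0 + q 1 = 1) {v : ℕ → ℝ}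
    (hv : IsCutWeight N q (lam / 4) v) {π p : Fin N → ℝ} (hπ : π ∈ stdSimplex ℝ (Fin N))
    (hπL : ladder N q *ᵥ π = 0) (hp : p ∈ stdSimplex ℝ (Fin N)) (hℓ : 0.69 ≤ ℓ)
    (hexpℓ : Real.exp (-ℓ) ≤ ε) {L : ℕ}
    (hL : 100 * ((N : ℝ) ^ 2 / (a ^ 2 * lam)) * ℓ ≤ L) :
    ∑ j, |π j - ((1 + (a ^ 2 / (2 * (N : ℝ) + 1)) • ladder N q) ^ L *ᵥ p) j| ≤ 2 * ε * ℓ := by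
  have hN0 : 0 < N := by omega
  have hN' : (2 : ℝ) ≤ N := by exact_mod_cast hN
  have hLexp := one_sub_pow_le_exp hN' ha hl (by linarith) hL
  set s := a ^ 2 / (2 * (N : ℝ) + 1) with hs
  have hs0 : 0 ≤ s := by positivity
  have hs1 : s ≤ 1 := by
    rw [hs, div_le_one (by positivity)]
    have : a ^ 2 ≤ 1 := pow_le_one₀ ha.le ha1
    linarith
  have hκ0 : 0 ≤ s * (lam / 4) := by positivity
  have hκ : s * (lam / 4) ≤ 1 := mul_le_one₀ hs1 (by linarith) (by linarith)
  set B := 1 + s • ladder N q with hB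
  have hBπ : ∀ L : ℕ, B ^ L *ᵥ π = π := by
    intro L
    induction L with
    | zero => simp
    | succ L ih =>
      rw [pow_succ', ← Matrix.mulVec_mulVec, ih, hB, Matrix.add_mulVec, Matrix.one_mulVec,
        Matrix.smul_mulVec, hπL, smul_zero, add_zero]
  have hd : ∑ i, (π - p) i = 0 := by
    simp only [Pi.sub_apply, Finset.sum_sub_distrib]
    rw [hπ.2, hp.2, sub_self]
  have h := one_add_smul_ladder_pow_mulVec_le hv hN0 (h0 0) (h0 1) hq hs0 hs1 hκ (π - p) hd L
  rw [← hB, Matrix.mulVec_sub, hBπ] at h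
  have hnorm : ∑ i, |(π - p) i| ≤ 2 := by
    calc _ ≤ ∑ i, (|π i| + |p i|) := Finset.sum_le_sum fun i _ => abs_sub _ _
      _ = 2 := by
        simp only [abs_of_nonneg (hπ.1 _), abs_of_nonneg (hp.1 _), Finset.sum_add_distrib]
        rw [hπ.2, hp.2]
        norm_num
  have hexp : (1 - s * (lam / 4)) ^ L ≤ Real.exp (-(10 * (N * ℓ))) := by
    have h1 : 1 - s * (lam / 4) ≤ Real.exp (-(s * (lam / 4))) := Real.one_sub_le_exp_neg _
    calc _ ≤ Real.exp (-(s * (lam / 4))) ^ L := pow_le_pow_left₀ (by linarith) h1 L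
      _ = Real.exp (L * -(s * (lam / 4))) := (Real.exp_nat_mul _ _).symm
      _ ≤ _ := Real.exp_le_exp.2 (by linarith)
  calc ∑ j, |π j - (B ^ L *ᵥ p) j| ≤ 2 * (N : ℝ) ^ 2 * 3 ^ N *
        (1 - s * (lam / 4)) ^ L * ∑ i, |(π - p) i| := h
    _ ≤ 2 * (N : ℝ) ^ 2 * 3 ^ N * Real.exp (-(10 * (N * ℓ))) * 2 := by
        refine mul_le_mul (mul_le_mul_of_nonneg_left hexp (by positivity)) hnorm
          (Finset.sum_nonneg fun _ _ => abs_nonneg _) (by positivity)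
    _ = 4 * (N : ℝ) ^ 2 * 3 ^ N * Real.exp (-(10 * (N * ℓ))) := by ring
    _ ≤ Real.exp (4 * N) * Real.exp (-(10 * (N * ℓ))) :=
        mul_le_mul_of_nonneg_right (four_mul_sq_mul_pow_le hN) (Real.exp_pos _).le
    _ ≤ Real.exp (-ℓ) := by
        rw [← Real.exp_add]
        apply Real.exp_le_exp.2
        have h1 : 0.69 * (N : ℝ) ≤ N * ℓ := by nlinarith
        have h2 : ℓ ≤ N * ℓ := by nlinarith
        linarith
    _ ≤ ε := hexpℓ
    _ ≤ 2 * ε * ℓ := by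
        have : 0 < ε := (Real.exp_pos _).trans_le hexpℓ
        nlinarith

/-- The cost bound for a qubit environment with populations `q` whose chain has stationary state
`π` and contracts at rate `lam / 4`. -/
theorem cost_bound (hN : 2 ≤ N) {Δ ε lam K : ℝ} (b : ℝ) (hΔ : 0 < Δ) (hε : 0 < ε) (hε1 : ε ≤ 1)
    (hl : 0 < lam) (hl1 : lam ≤ 1) (hK : 0 < K) (h0 : ∀ a, 0 ≤ q a) (hq : q 0 + q 1 = 1)
    {v : ℕ → ℝ} (hv : IsCutWeight N q (lam / 4) v) {π : Fin N → ℝ}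
    (hπ : π ∈ stdSimplex ℝ (Fin N)) (hπL : ladder N q *ᵥ π = 0) (L : ℕ)
    (hL : 100 * oscSteps N Δ ε lam * oscLog N ε lam ^ 1 ≤ (L : ℝ))
    (hL' : (L : ℝ) ≤ K * oscSteps N Δ ε lam * oscLog N ε lam ^ 1) :
    (∀ ρ : Matrix (Fin N) (Fin N) ℂ, IsDensity ρ → Commute ρ (diagOp (oscEnergy N Δ b)) →
      traceNorm (diagOp π - (channel (oscEnergy N Δ b) Δ q
        (oscAlpha N Δ ε lam) (oscTime N Δ ε lam))^[L] ρ) ≤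
        (2 + K * (12 * gaussianMoment + 8) + K) * ε * oscLog N ε lam ^ 1) ∧
    (L : ℝ) * oscTime N Δ ε lam ≤ (2 + K * (12 * gaussianMoment + 8) + K) *
      ((N : ℝ) ^ 9 / (Δ * ε ^ (5 / 2 : ℝ) * lam ^ (7 / 2 : ℝ))) * oscLog N ε lam ^ 1 := by
  rw [pow_one] at *
  have hN0 : 0 < N := by omega
  have hN' : (2 : ℝ) ≤ N := by exact_mod_cast hN
  have hel : 0 < ε * lam := mul_pos hε hl
  have hel1 : ε * lam ≤ 1 := mul_le_one₀ hε1 hl.le hl1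
  set ℓ := oscLog N ε lam with hℓ
  have hlog2 : 0.69 ≤ Real.log 2 := by have := Real.log_two_gt_d9; linarith
  have hℓ2 : 0.69 ≤ ℓ := by
    refine hlog2.trans (Real.log_le_log two_pos ?_)
    rw [le_div_iff₀ hel]
    nlinarith
  have hexpℓ : Real.exp (-ℓ) ≤ ε := by
    rw [hℓ, oscLog, Real.exp_neg, Real.exp_log (by positivity), inv_div, div_le_iff₀ (by linarith)]
    nlinarith
  set α := oscAlpha N Δ ε lam with hα
  set t := oscTime N Δ ε lam with ht
  have hαpos : 0 < α := by rw [hα, oscAlpha]; positivity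
  have htpos : 0 < t := by rw [ht, oscTime]; positivity
  have hm := gaussianMoment_nonneg
  set a := α * t with ha
  have haeq : a = ε * lam / (N : ℝ) ^ 3 := oscAlpha_mul_oscTime hN0 hΔ hε hl
  have hapos : 0 < a := mul_pos hαpos htpos
  have ha1 : a ≤ 1 := by
    rw [haeq, div_le_one (by positivity)]
    exact hel1.trans (one_le_pow₀ (by linarith))
  have hsteps : oscSteps N Δ ε lam = (N : ℝ) ^ 2 / (a ^ 2 * lam) := by
    rw [oscSteps, ← mul_pow]
  have hgap : 0 ≤ K * (12 * gaussianMoment + 8) := by positivity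
  refine ⟨fun ρ hρ hcomm => ?_, ?_⟩
  · have hE : Function.Injective (oscEnergy N Δ b) := by
      intro i j hij
      have h := oscEnergy_sub Δ b i j
      rw [hij, sub_self] at h
      rcases mul_eq_zero.1 h.symm with h | h
      · exact Fin.ext (by have : (((i : ℕ) : ℤ) - ((j : ℕ) : ℤ) : ℤ) = 0 := by exact_mod_cast h
                          omega)
      · exact absurd h hΔ.ne'
    obtain ⟨p, rfl, hp0, hp1⟩ := exists_diagOp_eq_of_commute hE hρ hcomm
    have hp : p ∈ stdSimplex ℝ (Fin N) := ⟨hp0, hp1⟩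
    set s := rescaledCoupling (Fin N) α t ^ 2 with hs
    have hseq : s = a ^ 2 / (2 * (N : ℝ) + 1) := rescaledCoupling_sq N α t
    have hs0 : 0 ≤ s := sq_nonneg _
    have hs1 : s ≤ 1 := by
      rw [hseq, div_le_one (by positivity)]
      nlinarith
    set A := levelTransition (oscEnergy N Δ b) Δ q α t with hA
    set B := 1 + transition (oscEnergy N Δ b) Δ q α t with hB
    have hAst : A ∈ Matrix.colStochastic ℝ (Fin N) :=
      levelTransition_mem_colStochastic _ _ _ _ h0 hq
    have hBst : B ∈ Matrix.colStochastic ℝ (Fin N) :=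
      one_add_transition_mem_colStochastic hN hΔ b (h0 0) (h0 1) hq hs1
    have hBeq : B = 1 + s • ladder N q := by rw [hB, transition_oscEnergy hN hΔ]
    have hδ : ∀ i, ∑ j, |A j i - B j i| ≤
        (12 * gaussianMoment + 8) * (ε * (a ^ 2 * lam) / (N : ℝ) ^ 2) := by
      intro i
      refine (sum_abs_levelTransition_sub_le hN h0 hq hΔ hαpos.le htpos b hs1 i).trans ?_
      rw [mul_oscTime_sq hΔ hε hl, ← ha]
      exact stepError_le (by linarith) gaussianMoment_nonneg hel hapos ha1 haeq
    have hpert := sum_abs_pow_mulVec_sub_le hAst hBst hδ hp L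
    have hpert2 : (L : ℝ) * ((12 * gaussianMoment + 8) * (ε * (a ^ 2 * lam) / (N : ℝ) ^ 2)) ≤
        K * (12 * gaussianMoment + 8) * ε * ℓ := by
      calc _ ≤ (K * oscSteps N Δ ε lam * ℓ) *
            ((12 * gaussianMoment + 8) * (ε * (a ^ 2 * lam) / (N : ℝ) ^ 2)) := by gcongr
        _ = _ := by
          rw [hsteps]
          field_simp
    have hmix : ∑ j, |π j - (B ^ L *ᵥ p) j| ≤ 2 * ε * ℓ := by
      rw [hBeq, hseq]
      rw [hsteps] at hL
      exact sum_abs_sub_pow_mulVec_le hN hapos ha1 hl hl1 h0 hq hv hπ hπL hp hℓ2 hexpℓ hL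
    rw [iterate_channel_diagOp]
    have hsub : diagOp π - diagOp (A ^ L *ᵥ p) = diagOp fun j => π j - (A ^ L *ᵥ p) j := by
      rw [diagOp, diagOp, diagOp, Matrix.diagonal_sub]
      congr 1
      ext j
      simp
    rw [hsub, traceNorm_diagOp]
    calc _ ≤ ∑ j, (|π j - (B ^ L *ᵥ p) j| + |(A ^ L *ᵥ p) j - (B ^ L *ᵥ p) j|) := by
          refine Finset.sum_le_sum fun j _ => ?_
          rw [abs_sub_comm ((A ^ L *ᵥ p) j)]
          exact abs_sub_le _ _ _
      _ ≤ 2 * ε * ℓ + K * (12 * gaussianMoment + 8) * ε * ℓ := by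
          rw [Finset.sum_add_distrib]
          exact add_le_add hmix (hpert.trans hpert2)
      _ ≤ _ := by
          have : 0 ≤ K * ε * ℓ := by positivity
          linarith
  · rw [← oscSteps_mul_oscTime hN0 hΔ hε hl]
    have hst : 0 < oscSteps N Δ ε lam := by rw [hsteps]; positivity
    calc (L : ℝ) * t ≤ K * oscSteps N Δ ε lam * ℓ * t := by gcongr
      _ = K * (oscSteps N Δ ε lam * t) * ℓ := by ring
      _ ≤ _ := by
        gcongr
        linarith

end Cost

end OscThermal

end

theorem mainTheorem4 :
    -- the Markov chain, for every coupling `α` and time `t`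
    (∀ (N : ℕ), 2 ≤ N → ∀ (Δ b α t : ℝ), 0 < Δ → 0 < α → 0 < t →
      (∀ β : ℝ, 0 ≤ β →
        OscThermal.transition (OscThermal.oscEnergy N Δ b) Δ
            (OscThermal.gibbs (OscThermal.envEnergy Δ) β) α t =
          OscThermal.rescaledCoupling (Fin N) α t ^ 2 •
            OscThermal.ladder N (OscThermal.gibbs (OscThermal.envEnergy Δ) β) ∧
        (OscThermal.rescaledCoupling (Fin N) α t ≤ 1 →
          1 + OscThermal.transition (OscThermal.oscEnergy N Δ b) Δ
            (OscThermal.gibbs (OscThermal.envEnergy Δ) β) α t ∈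
              Matrix.colStochastic ℝ (Fin N)) ∧
        {p ∈ stdSimplex ℝ (Fin N) |
            (1 + OscThermal.transition (OscThermal.oscEnergy N Δ b) Δ
              (OscThermal.gibbs (OscThermal.envEnergy Δ) β) α t) *ᵥ p = p} =
          {OscThermal.gibbs (OscThermal.oscEnergy N Δ b) β} ∧
        0 < OscThermal.oscGap N Δ β) ∧
      -- the limit `β → ∞`
      Tendsto (fun β => OscThermal.transition (OscThermal.oscEnergy N Δ b) Δ
          (OscThermal.gibbs (OscThermal.envEnergy Δ) β) α t) atTop
        (𝓝 (OscThermal.transition (OscThermal.oscEnergy N Δ b) Δ (OscThermal.ground 2) α t)) ∧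
      OscThermal.transition (OscThermal.oscEnergy N Δ b) Δ (OscThermal.ground 2) α t =
          OscThermal.rescaledCoupling (Fin N) α t ^ 2 •
            OscThermal.ladder N (OscThermal.ground 2) ∧
      (OscThermal.transition (OscThermal.oscEnergy N Δ b) Δ
        (OscThermal.ground 2) α t).BlockTriangular id ∧
      spectrum ℝ (OscThermal.transition (OscThermal.oscEnergy N Δ b) Δ
          (OscThermal.ground 2) α t) =
        {0, -(OscThermal.rescaledCoupling (Fin N) α t ^ 2)} ∧
      (OscThermal.transition (OscThermal.oscEnergy N Δ b) Δ
          (OscThermal.ground 2) α t).charpoly =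
        Polynomial.X * (Polynomial.X +
          Polynomial.C (OscThermal.rescaledCoupling (Fin N) α t ^ 2)) ^ (N - 1) ∧
      {p ∈ stdSimplex ℝ (Fin N) |
          (1 + OscThermal.transition (OscThermal.oscEnergy N Δ b) Δ
            (OscThermal.ground 2) α t) *ᵥ p = p} = {OscThermal.ground N} ∧
      Tendsto (fun β => OscThermal.oscGap N Δ β) atTop (𝓝 1) ∧
      OscThermal.spectralGap (OscThermal.ladder N (OscThermal.ground 2)) = 1 ∧
      Tendsto (fun β => OscThermal.gibbs (OscThermal.envEnergy Δ) β) atTop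
        (𝓝 (OscThermal.ground 2)) ∧
      Tendsto (fun β => OscThermal.gibbs (OscThermal.oscEnergy N Δ b) β) atTop
        (𝓝 (OscThermal.ground N)) ∧
      (∀ ρ : Matrix (Fin N) (Fin N) ℂ,
        Tendsto (fun β => OscThermal.channel (OscThermal.oscEnergy N Δ b) Δ
            (OscThermal.gibbs (OscThermal.envEnergy Δ) β) α t ρ) atTop
          (𝓝 (OscThermal.channel (OscThermal.oscEnergy N Δ b) Δ (OscThermal.ground 2) α t ρ)))) ∧
    -- the simulation cost, with universal constants
    (∃ (c : ℝ) (k : ℕ), 0 < c ∧ ∀ K : ℝ, 0 < K → ∃ C : ℝ, 0 < C ∧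
      ∀ (N : ℕ), 2 ≤ N → ∀ (Δ b ε : ℝ), 0 < Δ → 0 < ε → ε ≤ 1 →
        -- finite inverse temperature
        (∀ β : ℝ, 0 ≤ β → ∀ lam : ℝ, lam = OscThermal.oscGap N Δ β → ∀ L : ℕ,
          c * OscThermal.oscSteps N Δ ε lam * OscThermal.oscLog N ε lam ^ k ≤ (L : ℝ) →
          (L : ℝ) ≤ K * OscThermal.oscSteps N Δ ε lam * OscThermal.oscLog N ε lam ^ k →
          (∀ ρ : Matrix (Fin N) (Fin N) ℂ, OscThermal.IsDensity ρ →
            Commute ρ (OscThermal.diagOp (OscThermal.oscEnergy N Δ b)) →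
            OscThermal.traceNorm
              (OscThermal.diagOp (OscThermal.gibbs (OscThermal.oscEnergy N Δ b) β) -
                (OscThermal.channel (OscThermal.oscEnergy N Δ b) Δ
                  (OscThermal.gibbs (OscThermal.envEnergy Δ) β)
                  (OscThermal.oscAlpha N Δ ε lam) (OscThermal.oscTime N Δ ε lam))^[L] ρ) ≤
              C * ε * OscThermal.oscLog N ε lam ^ k) ∧
          (L : ℝ) * OscThermal.oscTime N Δ ε lam ≤
            C * ((N : ℝ) ^ 9 / (Δ * ε ^ (5 / 2 : ℝ) * lam ^ (7 / 2 : ℝ))) *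
              OscThermal.oscLog N ε lam ^ k) ∧
        -- zero temperature, where the gap is `1`
        (∀ L : ℕ,
          c * OscThermal.oscSteps N Δ ε 1 * OscThermal.oscLog N ε 1 ^ k ≤ (L : ℝ) →
          (L : ℝ) ≤ K * OscThermal.oscSteps N Δ ε 1 * OscThermal.oscLog N ε 1 ^ k →
          (∀ ρ : Matrix (Fin N) (Fin N) ℂ, OscThermal.IsDensity ρ →
            Commute ρ (OscThermal.diagOp (OscThermal.oscEnergy N Δ b)) →
            OscThermal.traceNorm
              (OscThermal.diagOp (OscThermal.ground N) -
                (OscThermal.channel (OscThermal.oscEnergy N Δ b) Δ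
                  (OscThermal.ground 2)
                  (OscThermal.oscAlpha N Δ ε 1) (OscThermal.oscTime N Δ ε 1))^[L] ρ) ≤
              C * ε * OscThermal.oscLog N ε 1 ^ k) ∧
          (L : ℝ) * OscThermal.oscTime N Δ ε 1 ≤
            C * ((N : ℝ) ^ 9 / (Δ * ε ^ (5 / 2 : ℝ))) * OscThermal.oscLog N ε 1 ^ k)) := by
  refine ⟨fun N hN Δ b α t hΔ hα ht => ?_, ?_⟩
  · have hN0 : 0 < N := by omega
    have : Nonempty (Fin N) := ⟨⟨0, hN0⟩⟩
    have hr : 0 < OscThermal.rescaledCoupling (Fin N) α t := by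
      unfold OscThermal.rescaledCoupling
      positivity
    have hs : OscThermal.rescaledCoupling (Fin N) α t ^ 2 ≠ 0 := (pow_pos hr 2).ne'
    have hlimit := OscThermal.tendsto_gibbs_envEnergy hΔ
    have hground := OscThermal.transition_oscEnergy hN hΔ b (OscThermal.ground 2) α t
    have hchar := OscThermal.charpoly_smul_ladder_ground (N := N) (by omega)
      (OscThermal.rescaledCoupling (Fin N) α t ^ 2)
    refine ⟨fun β hβ => ⟨?_, fun h => ?_, ?_, ?_⟩, ?_, hground, ?_, ?_, ?_, ?_,
      OscThermal.tendsto_oscGap hN hΔ, OscThermal.spectralGap_ladder_ground hN, hlimit,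
      OscThermal.tendsto_gibbs_oscEnergy hN0 hΔ b,
      fun ρ => OscThermal.tendsto_channel _ _ hlimit α t ρ⟩
    · exact OscThermal.transition_oscEnergy hN hΔ b _ α t
    · exact OscThermal.one_add_transition_mem_colStochastic hN hΔ b
        (OscThermal.gibbs_pos _ _ _).le (OscThermal.gibbs_pos _ _ _).le
        (OscThermal.gibbs_env_add Δ β) (pow_le_one₀ hr.le h)
    · exact OscThermal.fixedPoints_one_add_transition hN hΔ b (OscThermal.gibbs_pos _ _ _).ne' hs
        (OscThermal.gibbs_mem_stdSimplex _ _) (OscThermal.ladder_mulVec_gibbs N Δ b β)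
    · exact OscThermal.oscGap_pos hN Δ β
    · simp only [OscThermal.transition_oscEnergy hN hΔ]
      exact (((OscThermal.continuous_ladder N).tendsto _).comp hlimit).const_smul _
    · rw [hground]
      exact fun i j h => by
        rw [Matrix.smul_apply, OscThermal.ladder_ground_blockTriangular _ h, smul_zero]
    · ext x
      rw [Matrix.mem_spectrum_iff_isRoot_charpoly, hground, hchar]
      simp only [Polynomial.IsRoot.def, Polynomial.eval_mul, Polynomial.eval_X,
        Polynomial.eval_pow, Polynomial.eval_add, Polynomial.eval_C, mul_eq_zero,
        pow_eq_zero_iff (show N - 1 ≠ 0 by omega), Set.mem_insert_iff, Set.mem_singleton_iff,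
        eq_neg_iff_add_eq_zero]
    · rw [hground, hchar]
    · exact OscThermal.fixedPoints_one_add_transition hN hΔ b (by simp [OscThermal.ground]) hs
        (OscThermal.ground_mem_stdSimplex hN0) (OscThermal.ladder_mulVec_ground N)
  · refine ⟨100, 1, by norm_num, fun K hK =>
      ⟨2 + K * (12 * OscThermal.gaussianMoment + 8) + K, ?_,
        fun N hN Δ b ε hΔ hε hε1 => ⟨?_, ?_⟩⟩⟩
    · have := OscThermal.gaussianMoment_nonneg
      positivity
    · rintro β hβ lam rfl L hL hL'
      have : Nonempty (Fin N) := ⟨⟨0, by omega⟩⟩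
      obtain ⟨v, hv⟩ := OscThermal.exists_isCutWeight hN hΔ hβ
      exact OscThermal.cost_bound hN b hΔ hε hε1 (OscThermal.oscGap_pos hN Δ β)
        (OscThermal.oscGap_le_one hN Δ β) hK (fun a => (OscThermal.gibbs_pos _ _ a).le)
        (OscThermal.gibbs_env_add Δ β) hv (OscThermal.gibbs_mem_stdSimplex _ _)
        (OscThermal.ladder_mulVec_gibbs N Δ b β) L hL hL'
    · intro L hL hL'
      have hv : OscThermal.IsCutWeight N (OscThermal.ground 2) (1 / 4) (fun j => 2 ^ j) :=
        OscThermal.isCutWeight_two_pow (by simp [OscThermal.ground])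
          (by norm_num [OscThermal.ground])
      have h := OscThermal.cost_bound hN b hΔ hε hε1 one_pos le_rfl hK
        (OscThermal.ground_mem_stdSimplex two_pos).1 (by simp [OscThermal.ground]) hv
        (OscThermal.ground_mem_stdSimplex (by omega)) (OscThermal.ladder_mulVec_ground N) L hL hL'
      rwa [Real.one_rpow, mul_one] at h
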